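/- **Setting.** Let $d\ge1$, let $\Theta\subset\mathbb R^q$ and $\mathcal X\subset\mathbb R^d$ be compact and convex, $\mathcal X$ with non-empty interior, and let $f(\theta;x)=\mathbb E[F(\theta;x)]$, where $F(\theta;x)$ is the random output of a simulation experiment. Assume: (A1) $f$ is $C^{m+1}$ on $\Theta\times\mathcal X$ for some $m\ge1$, and $f(\cdot;x)$ is strongly convex on $\Theta$ for every $x\in\mathcal X$. (A2) For every $x\in\mathcal X$ the minimizer $\theta_*(x)$ of $f(\cdot;x)$ over $\Theta$ is an interior point of $\Theta$. (A3) There are $K_1,\delta>0$ such that for every $x\in\mathcal X$ there is a matrix $G_x$ with $\|\nabla_\theta f(\theta;x)-G_x(\theta-\theta_*(x))\|\le K_1\|\theta-\theta_*(x)\|^2$ for all $\theta\in\Theta$ with $\|\theta-\theta_*(x)\|\le\delta$. *Offline stage.* Given $n,T\in\mathbb N$ and design points $x_1,\dots,x_n\in\mathcal X$, run, independently at each $x_i$, $T$ steps of projected SGD $\theta_t(x_i)=\Pi_\Theta[\theta_{t-1}(x_i)-\gamma_t\nabla_\theta F(\theta_{t-1}(x_i);x_i)]$ from a deterministic $\theta_0(x_i)\in\Theta$,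 where $\nabla_\theta F$ is a gradient estimator computed from one simulation experiment, and report the Polyak–Ruppert average $\bar\theta_T(x_i)=\frac1{T+1}\sum_{t=0}^T\theta_t(x_i)$. Assume: (A4) In each run the noise $\xi_t=\nabla_\theta F(\theta_{t-1};x_i)-\nabla_\theta f(\theta_{t-1};x_i)$ is a square-integrable martingale-difference process with respect to a filtration $(\mathcal F_t)$ to which the run is adapted, and $\mathbb E[\|\xi_t\|^2\mid\mathcal F_{t-1}]+\|\nabla_\theta f(\theta_{t-1};x_i)\|^2\le K_2(1+\|\theta_{t-1}\|^2)$ a.s., with a constant $K_2$ that is the same for all runs. (A5) The step sizes satisfy $\gamma_t>0$, $(\gamma_t-\gamma_{t+1})/\gamma_t=o(\gamma_t)$ and $\gamma_t\asymp(\log t)/t$. The designs are quasi-uniform: the fill distance $\sup_{x\in\mathcal X}\min_i\|x-x_i\|$ and the separation distance $\frac12\min_{i\ne j}\|x_i-x_j\|$ are both $\asymp n^{-1/d}$. *Online stage.* For bandwidth $h>0$ and $x\in\mathcal X$, the predicted solution is the Nadaraya–Watson estimator with sphere kernel $K(u)=I\{\|u\|\le1\}$, $$\hat\theta_{KS}(x)=\frac{\sum_{i=1}^n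 k_h(x-x_i)\,\bar\theta_T(x_i)}{\sum_{i=1}^n k_h(x-x_i)},\qquad k_h(u)=h^{-d}K(u/h).$$ *Notation.* All asymptotics are along a sequence of budgets $\Gamma\to\infty$, for a fixed problem (in particular $d,q$ are fixed). $u=\tilde O(a)$ means $u=O(a|\log a|^\kappa)$ for some constant $\kappa>0$, and $\tilde O_{\rm P}$ is defined likewise from $O_{\rm P}$. A rule $(n,T,h)$ (positive numbers depending on $\Gamma$) is *feasible* if $nT=\Gamma$, $h=o(1)$ and $(nh^d)^{-1}=o(1)$; with $R(n,T,h)=h^2+\frac1{T^2}+\frac1{nTh^d}$, it is *optimal* if it is feasible and $R(n,T,h)=O(R(n',T',h'))$ for every feasible rule $(n',T',h')$ for the same budgets (here $n,T$ range over positive reals). **Theorem.** (i) For all budgets $\Gamma\to\infty$ optimal rules exist, and a rule with $nT=\Gamma$ is optimal if and only if $h\asymp\Gamma^{-1/(d+2)}$, $T\gtrsim\Gamma^{1/(d+2)}$ and $T=o(\Gamma^{2/(d+2)})$. That is, $h^*\asymp\Gamma^{-1/(d+2)}$ and the order of $T^*$ lies in $[\Gamma^{1/(d+2)},\Gamma^{2/(d+2)})$;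 then the order of $n^*=\Gamma/T^*$ lies in $(\Gamma^{d/(d+2)},\Gamma^{(d+1)/(d+2)}]$, i.e. $\Gamma^{d/(d+2)}=o(n^*)$ and $n^*\lesssim\Gamma^{(d+1)/(d+2)}$, and $R(n^*,T^*,h^*)\asymp\Gamma^{-2/(d+2)}$. (ii) Let $x\in\mathcal X$. Under every feasible rule with integer $n,T$ and $T\to\infty$, for every $j=1,\dots,q$, $$\mathbb E\big[(\hat\theta^j_{KS}(x)-\theta^j_*(x))^2\big]=\tilde O\Big(h^2+\frac1{T^2}+\frac1{nTh^d}\Big).$$ (iii) Let $x\in\mathcal X$. Under every optimal rule with integer $n,T$, the optimality gap $f(\hat\theta_{KS}(x);x)-f(\theta_*(x);x)$ tends to $0$ in probability and is $\tilde O_{\rm P}\big(q\,\Gamma^{-2/(d+2)}\big)$. -/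

import Mathlib

open Filter Topology Asymptotics MeasureTheory ProbabilityTheory

noncomputable section

namespace OTP

/-- Euclidean space of dimension `n`, with the Euclidean norm. -/
abbrev Vec (n : ℕ) := EuclideanSpace ℝ (Fin n)

section Problem

variable {d q : ℕ} {S : Type*} [MeasurableSpace S]

/-- The objective `f(θ; x) = 𝔼[F(θ; x)]`, where `F θ x s` is the simulated performance when the
randomness of the experiment is `s`, with law `ν`. -/
def objective (ν : Measure S) (F : Vec q → Vec d → S → ℝ) (θ : Vec q) (x : Vec d) : ℝ :=
  ∫ s, F θ x s ∂ν

/-- The optimal-solution function `θ_*(x)`: a minimizer of `f(·; x)` over `Θ`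
(unique when `f(·; x)` is strongly convex). -/
def optSol (Θ : Set (Vec q)) (f : Vec q → Vec d → ℝ) (x : Vec d) : Vec q :=
  Classical.epsilon fun θ => θ ∈ Θ ∧ IsMinOn (fun θ' => f θ' x) Θ θ

/-- The gradient `∇_θ f(θ; x)`; it is taken within `Θ`, so that it is also meaningful at boundary
points of `Θ`. -/
def gradθ (Θ : Set (Vec q)) (f : Vec q → Vec d → ℝ) (x : Vec d) (θ : Vec q) : Vec q :=
  gradientWithin (fun θ' => f θ' x) Θ θ

/-- The assumptions on a contextual strongly convex problem `min_{θ ∈ Θ} f(θ; x)`, `x ∈ X`. -/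
structure IsRegularProblem (Θ : Set (Vec q)) (X : Set (Vec d)) (f : Vec q → Vec d → ℝ) :
    Prop where
  convex_feasible : Convex ℝ Θ
  compact_feasible : IsCompact Θ
  convex_covariates : Convex ℝ X
  compact_covariates : IsCompact X
  covariates_interior : (interior X).Nonempty
  /-- `f` is of class `C^{m+1}` on `Θ × X` for some `m ≥ 1`. -/
  smooth : ∃ m : ℕ, 1 ≤ m ∧
    ContDiffOn ℝ ((m + 1 : ℕ) : WithTop ℕ∞) (fun p : Vec q × Vec d => f p.1 p.2) (Θ ×ˢ X)
  /-- `f(·; x)` is strongly convex for every `x`. -/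
  strongly_convex : ∀ x ∈ X, ∃ μ : ℝ, 0 < μ ∧ StrongConvexOn Θ μ (fun θ => f θ x)
  /-- The optimal solution is an interior point of `Θ`. -/
  interior_solution : ∀ x ∈ X, optSol Θ f x ∈ interior Θ
  /-- Linearization of the gradient at the optimal solution with a quadratic remainder; the
  constants do not depend on the covariate. -/
  linearization : ∃ K₁ δ : ℝ, 0 < K₁ ∧ 0 < δ ∧ ∀ x ∈ X, ∃ G : Vec q →L[ℝ] Vec q,
    ∀ θ ∈ Θ, ‖θ - optSol Θ f x‖ ≤ δ →
      ‖gradθ Θ f x θ - G (θ - optSol Θ f x)‖ ≤ K₁ * ‖θ - optSol Θ f x‖ ^ 2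

/-- Step sizes: positive, `(γ_t - γ_{t+1}) / γ_t = o(γ_t)`, and of the order `log t / t`. -/
structure IsStepSize (γ : ℕ → ℝ) : Prop where
  pos : ∀ t, 1 ≤ t → 0 < γ t
  slow : (fun t => (γ t - γ (t + 1)) / γ t) =o[atTop] γ
  order : γ =Θ[atTop] fun t : ℕ => Real.log t / t

/-- The metric projection `Π_Θ` onto `Θ` (a nearest point, unique for closed convex `Θ`). -/
def proj (Θ : Set (Vec q)) (z : Vec q) : Vec q :=
  Classical.epsilon fun p => p ∈ Θ ∧ dist z p = Metric.infDist z Θ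

/-- The projected SGD iterates at the covariate `x`:
`θ_{t+1} = Π_Θ[θ_t - γ_{t+1} ∇_θ F(θ_t; x)]`. Here `gradF θ x s` is the gradient estimator computed
from one simulation experiment with randomness `s`, and `ζ t` is the randomness of the experiment
made in step `t + 1`. -/
def sgd (Θ : Set (Vec q)) (gradF : Vec q → Vec d → S → Vec q) (γ : ℕ → ℝ) (θ₀ : Vec d → Vec q)
    (x : Vec d) (ζ : ℕ → S) : ℕ → Vec q
  | 0 => θ₀ x
  | t + 1 => proj Θ (sgd Θ gradF γ θ₀ x ζ t -
      γ (t + 1) • gradF (sgd Θ gradF γ θ₀ x ζ t) x (ζ t))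

/-- The solution of `T`-step PR-SGD: the average of the iterates `θ_0, …, θ_T`. -/
def prSGD (Θ : Set (Vec q)) (gradF : Vec q → Vec d → S → Vec q) (γ : ℕ → ℝ)
    (θ₀ : Vec d → Vec q) (x : Vec d) (ζ : ℕ → S) (T : ℕ) : Vec q :=
  ((T : ℝ) + 1)⁻¹ • ∑ t ∈ Finset.range (T + 1), sgd Θ gradF γ θ₀ x ζ t

/-- The simulation noise `ξ_{t+1} = ∇_θ F(θ_t; x) - ∇_θ f(θ_t; x)` of a run at the covariate `x`. -/
def noise {Ω : Type*} (Θ : Set (Vec q)) (f : Vec q → Vec d → ℝ)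
    (gradF : Vec q → Vec d → S → Vec q) (γ : ℕ → ℝ) (θ₀ : Vec d → Vec q) (x : Vec d)
    (ζ : ℕ → Ω → S) (t : ℕ) (ω : Ω) : Vec q :=
  gradF (sgd Θ gradF γ θ₀ x (fun s => ζ s ω) t) x (ζ t ω) -
    gradθ Θ f x (sgd Θ gradF γ θ₀ x (fun s => ζ s ω) t)

/-- The condition on the simulation noise of a run at the covariate `x`: for some filtration to
which the run is adapted, the noise is a square-integrable martingale-difference process (that is,
the gradient estimator is unbiased) and
`𝔼[‖ξ_{t+1}‖² | ℱ_t] + ‖∇_θ f(θ_t; x)‖² ≤ K₂ (1 + ‖θ_t‖²)` almost surely. -/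
def IsMartingaleNoise {Ω : Type*} [mΩ : MeasurableSpace Ω] (P : Measure Ω) (Θ : Set (Vec q))
    (f : Vec q → Vec d → ℝ) (gradF : Vec q → Vec d → S → Vec q) (γ : ℕ → ℝ)
    (θ₀ : Vec d → Vec q) (K₂ : ℝ) (x : Vec d) (ζ : ℕ → Ω → S) : Prop :=
  ∃ ℱ : Filtration ℕ mΩ, ∀ t : ℕ,
    Measurable[ℱ (t + 1)] (ζ t) ∧
    MemLp (noise Θ f gradF γ θ₀ x ζ t) 2 P ∧
    P[noise Θ f gradF γ θ₀ x ζ t | ℱ t] =ᵐ[P] 0 ∧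
    ∀ᵐ ω ∂P, (P[fun ω' => ‖noise Θ f gradF γ θ₀ x ζ t ω'‖ ^ 2 | ℱ t]) ω +
        ‖gradθ Θ f x (sgd Θ gradF γ θ₀ x (fun s => ζ s ω) t)‖ ^ 2 ≤
      K₂ * (1 + ‖sgd Θ gradF γ θ₀ x (fun s => ζ s ω) t‖ ^ 2)

end Problem

section Design

variable {d : ℕ}

/-- The fill distance `sup_{x ∈ X} min_i ‖x - x_i‖`. -/
def fillDist {n : ℕ} (X : Set (Vec d)) (pts : Fin n → Vec d) : ℝ :=
  ⨆ x : X, ⨅ i, ‖(x : Vec d) - pts i‖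

/-- The separation distance `(1/2) min_{i ≠ j} ‖x_i - x_j‖`. -/
def sepDist {n : ℕ} (pts : Fin n → Vec d) : ℝ :=
  (1 / 2) * ⨅ p : {p : Fin n × Fin n // p.1 ≠ p.2}, ‖pts p.1.1 - pts p.1.2‖

/-- A sequence of quasi-uniform designs on `X`, the `k`-th one with `n k` points: the fill distance
and the separation distance are both of the order `n^{-1/d}`. -/
structure IsQuasiUniform (X : Set (Vec d)) (n : ℕ → ℕ) (pts : ∀ k, Fin (n k) → Vec d) :
    Prop where
  mem : ∀ k i, pts k i ∈ X
  fill : (fun k => fillDist X (pts k)) =Θ[atTop] fun k => (n k : ℝ) ^ (-(1 / (d : ℝ)))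
  sep : (fun k => sepDist (pts k)) =Θ[atTop] fun k => (n k : ℝ) ^ (-(1 / (d : ℝ)))

/-- The sphere kernel `K(u) = I{‖u‖ ≤ 1}`. -/
def sphereKernel (u : Vec d) : ℝ := if ‖u‖ ≤ 1 then 1 else 0

/-- `k_h(u) = h^{-d} K(u / h)`. -/
def scaledKernel (h : ℝ) (u : Vec d) : ℝ := (1 / h ^ d) * sphereKernel (h⁻¹ • u)

/-- The Nadaraya–Watson estimator
`∑ i, k_h(x - x_i) y_i / ∑ i, k_h(x - x_i)` with the sphere kernel. -/
def nadarayaWatson {n q : ℕ} (h : ℝ) (pts : Fin n → Vec d) (y : Fin n → Vec q) (x : Vec d) :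
    Vec q :=
  (∑ i, scaledKernel h (x - pts i))⁻¹ • ∑ i, scaledKernel h (x - pts i) • y i

end Design

section Algorithm

variable {d q : ℕ} {S : Type*} [MeasurableSpace S]

/-- The predicted solution `θ̂(x)`: PR-SGD with `T` steps is run at each design point, and the
results are smoothed by the Nadaraya–Watson estimator. -/
def predict {n : ℕ} (Θ : Set (Vec q)) (gradF : Vec q → Vec d → S → Vec q) (γ : ℕ → ℝ)
    (θ₀ : Vec d → Vec q) (T : ℕ) (h : ℝ) (pts : Fin n → Vec d) (ζ : Fin n → ℕ → S) (x : Vec d) :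
    Vec q :=
  nadarayaWatson h pts (fun i => prSGD Θ gradF γ θ₀ (pts i) (ζ i) T) x

/-- Admissible offline stages, one for each `k`: a quasi-uniform design with `n k` points, and at
each design point a PR-SGD run whose noise satisfies the noise condition, the runs at different
design points being independent. -/
structure IsOfflineStage {Ω : Type*} [MeasurableSpace Ω] (P : Measure Ω) (Θ : Set (Vec q))
    (X : Set (Vec d)) (f : Vec q → Vec d → ℝ) (gradF : Vec q → Vec d → S → Vec q) (γ : ℕ → ℝ)
    (θ₀ : Vec d → Vec q) (K₂ : ℝ) (n : ℕ → ℕ) (pts : ∀ k, Fin (n k) → Vec d)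
    (ζ : ∀ k, Fin (n k) → ℕ → Ω → S) : Prop where
  design : IsQuasiUniform X n pts
  runs : ∀ k i, IsMartingaleNoise P Θ f gradF γ θ₀ K₂ (pts k i) (ζ k i)
  indep : ∀ k, iIndepFun (fun (i : Fin (n k)) (ω : Ω) (t : ℕ) => ζ k i t ω) P

end Algorithm

section Asymptotic

/-- Soft-O: `u = Õ(a)` if `u = O(a |log a|^κ)` for some `κ > 0`. -/
def IsSoftO (u a : ℕ → ℝ) : Prop :=
  ∃ κ : ℝ, 0 < κ ∧ u =O[atTop] fun k => a k * |Real.log (a k)| ^ κ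

/-- `Y = O_P(a)`. -/
def IsBigOP {Ω : Type*} [MeasurableSpace Ω] (P : Measure Ω) (Y : ℕ → Ω → ℝ) (a : ℕ → ℝ) : Prop :=
  ∀ δ : ℝ, 0 < δ → ∃ M : ℝ, 0 < M ∧ ∀ᶠ k in atTop, P.real {ω | M * a k < |Y k ω|} < δ

/-- `Y = Õ_P(a)`. -/
def IsSoftOP {Ω : Type*} [MeasurableSpace Ω] (P : Measure Ω) (Y : ℕ → Ω → ℝ) (a : ℕ → ℝ) :
    Prop :=
  ∃ κ : ℝ, 0 < κ ∧ IsBigOP P Y fun k => a k * |Real.log (a k)| ^ κ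

/-- The order of the componentwise mean squared error, `h² + 1/T² + 1/(n T h^d)`. -/
def mseOrder (d : ℕ) (n T h : ℕ → ℝ) (k : ℕ) : ℝ :=
  h k ^ 2 + 1 / T k ^ 2 + 1 / (n k * T k * h k ^ d)

/-- Feasible rules for the budgets `Γ`: positive `n`, `T`, `h` with `n T = Γ`, `h = o(1)` and
`(n h^d)⁻¹ = o(1)`. -/
structure IsFeasibleRule (d : ℕ) (Γ n T h : ℕ → ℝ) : Prop where
  pos_n : ∀ k, 0 < n k
  pos_T : ∀ k, 0 < T k
  pos_h : ∀ k, 0 < h k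
  budget : ∀ k, n k * T k = Γ k
  bandwidth : Tendsto h atTop (𝓝 0)
  coverage : Tendsto (fun k => (n k * h k ^ d)⁻¹) atTop (𝓝 0)

/-- Optimal rules: feasible rules that minimize the order of `h² + 1/T² + 1/(n T h^d)` among all
feasible rules for the same budgets. -/
def IsOptimalRule (d : ℕ) (Γ n T h : ℕ → ℝ) : Prop :=
  IsFeasibleRule d Γ n T h ∧ ∀ n' T' h' : ℕ → ℝ, IsFeasibleRule d Γ n' T' h' →
    mseOrder d n T h =O[atTop] mseOrder d n' T' h'

end Asymptotic

end OTP

end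

/-! Put `s = Γ^(1/(d+2))`, so that `n T = s^(d+2)`. With `u = h s` the smoothing and variance terms
add up to `s⁻² (u² + u⁻ᵈ) ≥ s⁻²` (`inv_sq_le_sq_add`), while `h = 1/s`, `T = s`, `n = s^(d+1)`
attains `3 s⁻²`. Hence a feasible rule is optimal exactly when each of the three terms is `O(s⁻²)`,
that is, `h ≍ 1/s` and `T ≳ s`. The upper limit `T = o(s²)` is the coverage condition in disguise,
because `(n h^d)⁻¹ (h s)^d = T / s²`.

The error bound rests on runs whose mean squared error and bias are both `O((log T)²/T)`, with
constants common to all covariates. Compactness makes the strong monotonicity of the gradient, the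
Lipschitz constant of the solution and its distance to the boundary uniform
(`exists_uniformRegularity`). The squared error of the iterates contracts up to `O(γ²)` per step,
hence is `O(γ_t)` (`exists_forall_le_mul`). The expected error obeys a recursion of the same type
(`norm_integral_proj_step_le`): the martingale noise averages out, the linearization remainder costs
`γ` times the squared error, and the projection moves a point only if the iterate or the increment
is large, which again costs `O(γ²)` in expectation. Averaging with `γ_t ≍ log t / t` gives `(log
T)²/T`.

The estimator is a plain average over the design points in a ball, at least of order `n h^d` many by
a volume comparison. Independence divides the variance by their number, the bias of the runs enters
squared, and the Lipschitz solution adds `O(h²)`; the logarithms are absorbed by the soft-O.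
Convexity bounds the optimality gap by a multiple of the squared error, and Markov's inequality
finishes. -/

open Filter Topology Asymptotics MeasureTheory ProbabilityTheory

noncomputable section

namespace OTP

/-! ### Optimal rules for the error order -/

section Rules

variable {d : ℕ}

/-- In terms of `u = h * s` the right side is `s⁻² (u² + u⁻ᵈ)`, and either `u²` or `u⁻ᵈ` is at least
1. -/
theorem inv_sq_le_sq_add {s h : ℝ} (hs : 0 < s) (hh : 0 < h) :
    (s ^ 2)⁻¹ ≤ h ^ 2 + 1 / (s ^ (d + 2) * h ^ d) := by
  have hu : 0 < h * s := by positivity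
  have key : 1 ≤ (h * s) ^ 2 + 1 / (h * s) ^ d := by
    rcases le_total 1 (h * s) with h1 | h1
    · have := one_le_pow₀ h1 (n := 2)
      have : 0 ≤ 1 / (h * s) ^ d := by positivity
      linarith
    · have h2 : (h * s) ^ d ≤ 1 := pow_le_one₀ hu.le h1
      have : 1 ≤ 1 / (h * s) ^ d := by
        rw [le_div_iff₀ (by positivity)]; linarith
      have : 0 ≤ (h * s) ^ 2 := by positivity
      linarith
  have e : h ^ 2 + 1 / (s ^ (d + 2) * h ^ d)
      = (s ^ 2)⁻¹ * ((h * s) ^ 2 + 1 / (h * s) ^ d) := by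
    field_simp
    ring
  rw [e]
  exact le_mul_of_one_le_right (by positivity) key

theorem le_mseOrder {s n T h : ℕ → ℝ} (k : ℕ) (hs : 0 < s k) (hh : 0 < h k)
    (hb : n k * T k = s k ^ (d + 2)) : (s k ^ 2)⁻¹ ≤ mseOrder d n T h k := by
  have h1 := inv_sq_le_sq_add (d := d) hs hh
  have h2 : 0 ≤ 1 / T k ^ 2 := by positivity
  unfold mseOrder
  rw [hb]
  linarith

/-- The competitor that balances the three terms: each of them equals `s⁻²`, and `n h^d = s` tends
to infinity. -/
theorem isFeasibleRule_reference {Γ s : ℕ → ℝ} (hs : ∀ k, 0 < s k)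
    (hΓ : ∀ k, Γ k = s k ^ (d + 2)) (hlim : Tendsto s atTop atTop) :
    IsFeasibleRule d Γ (fun k => s k ^ (d + 1)) s fun k => (s k)⁻¹ where
  pos_n k := pow_pos (hs k) _
  pos_T := hs
  pos_h k := inv_pos.2 (hs k)
  budget k := by rw [hΓ]; ring
  bandwidth := tendsto_inv_atTop_zero.comp hlim
  coverage := by
    refine (tendsto_inv_atTop_zero.comp hlim).congr fun k => ?_
    have := (hs k).ne'
    simp only [Function.comp, inv_pow]
    field_simp
    ring

theorem mseOrder_reference {s : ℕ → ℝ} (hs : ∀ k, 0 < s k) (k : ℕ) :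
    mseOrder d (fun k => s k ^ (d + 1)) s (fun k => (s k)⁻¹) k = 3 * (s k ^ 2)⁻¹ := by
  have := (hs k).ne'
  simp only [mseOrder, inv_pow]
  field_simp
  ring

theorem isOptimalRule_of_isBigO {Γ s n T h : ℕ → ℝ} (hs : ∀ k, 0 < s k)
    (hΓ : ∀ k, Γ k = s k ^ (d + 2)) (hf : IsFeasibleRule d Γ n T h)
    (hR : mseOrder d n T h =O[atTop] fun k => (s k ^ 2)⁻¹) : IsOptimalRule d Γ n T h := by
  refine ⟨hf, fun n' T' h' hf' => hR.trans ?_⟩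
  refine IsBigO.of_bound 1 (Eventually.of_forall fun k => ?_)
  have h1 := le_mseOrder (d := d) (s := s) (n := n') (T := T') k (hs k) (hf'.pos_h k)
    (by rw [hf'.budget, hΓ])
  have h2 : 0 < (s k ^ 2)⁻¹ := by have := hs k; positivity
  rw [Real.norm_of_nonneg h2.le, Real.norm_of_nonneg (h2.le.trans h1), one_mul]
  exact h1

theorem IsOptimalRule.mseOrder_isTheta {Γ s n T h : ℕ → ℝ} (hs : ∀ k, 0 < s k)
    (hΓ : ∀ k, Γ k = s k ^ (d + 2)) (hlim : Tendsto s atTop atTop)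
    (ho : IsOptimalRule d Γ n T h) : mseOrder d n T h =Θ[atTop] fun k => (s k ^ 2)⁻¹ := by
  constructor
  · refine (ho.2 _ _ _ (isFeasibleRule_reference hs hΓ hlim)).trans ?_
    rw [funext (mseOrder_reference (d := d) hs)]
    exact (isBigO_refl _ _).const_mul_left 3
  · refine IsBigO.of_bound 1 (Eventually.of_forall fun k => ?_)
    have h1 := le_mseOrder (d := d) (s := s) (n := n) (T := T) k (hs k) (ho.1.pos_h k)
      (by rw [ho.1.budget, hΓ])
    have h2 : 0 < (s k ^ 2)⁻¹ := by have := hs k; positivity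
    rw [Real.norm_of_nonneg h2.le, Real.norm_of_nonneg (h2.le.trans h1), one_mul]
    exact h1

/-- The three terms are nonnegative, so the bound `C s⁻²` on their sum bounds each of them;
multiplying by `s²` gives the three conclusions. -/
theorem IsOptimalRule.eventually_le {Γ s n T h : ℕ → ℝ} (hs : ∀ k, 0 < s k)
    (hΓ : ∀ k, Γ k = s k ^ (d + 2)) (hlim : Tendsto s atTop atTop)
    (ho : IsOptimalRule d Γ n T h) : ∃ C : ℝ, 1 ≤ C ∧ ∀ᶠ k in atTop,
      (h k * s k) ^ 2 ≤ C ∧ s k ^ 2 ≤ C * T k ^ 2 ∧ 1 ≤ C * (h k * s k) ^ d := by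
  obtain ⟨C, hC⟩ := (ho.mseOrder_isTheta hs hΓ hlim).1.bound
  refine ⟨max 1 C, le_max_left _ _, hC.mono fun k hk => ?_⟩
  have hsk := hs k
  have hT := ho.1.pos_T k
  have hh := ho.1.pos_h k
  have hn := ho.1.pos_n k
  have hk : mseOrder d n T h k ≤ max 1 C * (s k ^ 2)⁻¹ := by
    refine (le_abs_self _).trans (hk.trans ?_)
    rw [Real.norm_of_nonneg (by positivity)]
    gcongr
    exact le_max_right _ _
  have e : mseOrder d n T h k = h k ^ 2 + 1 / T k ^ 2 + 1 / (s k ^ (d + 2) * h k ^ d) := by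
    unfold mseOrder
    rw [ho.1.budget, hΓ]
  rw [e, ← div_eq_mul_inv, le_div_iff₀ (by positivity)] at hk
  have e1 : (h k ^ 2 + 1 / T k ^ 2 + 1 / (s k ^ (d + 2) * h k ^ d)) * s k ^ 2
      = (h k * s k) ^ 2 + s k ^ 2 / T k ^ 2 + 1 / (h k * s k) ^ d := by
    field_simp
    ring
  rw [e1] at hk
  have p1 : 0 ≤ (h k * s k) ^ 2 := by positivity
  have p2 : 0 ≤ s k ^ 2 / T k ^ 2 := by positivity
  have p3 : 0 ≤ 1 / (h k * s k) ^ d := by positivity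
  refine ⟨by linarith, ?_, ?_⟩
  · rw [← div_le_iff₀ (by positivity)]; linarith
  · rw [← div_le_iff₀ (by positivity)]; linarith

theorem inv_le_of_one_le_mul_pow (hd : 1 ≤ d) {C u : ℝ} (hC : 1 ≤ C) (hu : 0 < u)
    (h : 1 ≤ C * u ^ d) : 1 ≤ C * u := by
  rcases le_total 1 u with h1 | h1
  · nlinarith
  · have : u ^ d ≤ u ^ 1 := pow_le_pow_of_le_one hu.le h1 hd
    rw [pow_one] at this
    nlinarith

theorem isOptimalRule_iff (hd : 1 ≤ d) {Γ s n T h : ℕ → ℝ} (hs : ∀ k, 0 < s k)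
    (hΓ : ∀ k, Γ k = s k ^ (d + 2)) (hlim : Tendsto s atTop atTop)
    (hn : ∀ k, 0 < n k) (hT : ∀ k, 0 < T k) (hh : ∀ k, 0 < h k) (hb : ∀ k, n k * T k = Γ k) :
    IsOptimalRule d Γ n T h ↔
      h =Θ[atTop] (fun k => (s k)⁻¹) ∧ s =O[atTop] T ∧ T =o[atTop] fun k => s k ^ 2 := by
  -- The budget identity turns the coverage quantity into `T / s²` up to the factor `(h s)^d`, which
  -- lies between positive constants once `h ≍ 1/s`. Coverage and `T = o(s²)` are therefore
  -- interchangeable.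
  have hcov : ∀ k, (n k * h k ^ d)⁻¹ * (h k * s k) ^ d = T k / s k ^ 2 := fun k => by
    have h1 := hn k
    have h2 := hT k
    have h3 := hh k
    have h4 := hs k
    have h5 : n k * T k = s k ^ d * s k ^ 2 := by rw [hb, hΓ, pow_add]
    rw [mul_pow, inv_mul_eq_div, div_eq_div_iff (by positivity) (by positivity)]
    linear_combination -h k ^ d * h5
  constructor
  · intro ho
    obtain ⟨C, hC1, hC⟩ := ho.eventually_le hs hΓ hlim
    -- Since `1 ≤ C` gives `C ≤ C²`, the same constant survives the square root.
    have hsq : ∀ {a b : ℝ}, 0 ≤ b → a ^ 2 ≤ C * b ^ 2 → a ≤ C * b := fun {a b} hb0 hab => by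
      refine le_of_sq_le_sq ?_ (by positivity)
      nlinarith [sq_nonneg b, mul_nonneg (by linarith : (0:ℝ) ≤ C - 1)
        (mul_nonneg (by linarith : (0:ℝ) ≤ C) (sq_nonneg b))]
    have hup : ∀ᶠ k in atTop, h k * s k ≤ C := hC.mono fun k hk => by
      have := hsq (a := h k * s k) zero_le_one (by simpa using hk.1)
      simpa using this
    refine ⟨⟨IsBigO.of_bound C (hup.mono fun k hk => ?_),
      IsBigO.of_bound C (hC.mono fun k hk => ?_)⟩, IsBigO.of_bound C (hC.mono fun k hk => ?_), ?_⟩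
    · rw [Real.norm_of_nonneg (hh k).le, Real.norm_of_nonneg (inv_pos.2 (hs k)).le,
        ← div_eq_mul_inv, le_div_iff₀ (hs k)]
      exact hk
    · rw [Real.norm_of_nonneg (hh k).le, Real.norm_of_nonneg (inv_pos.2 (hs k)).le,
        inv_le_iff_one_le_mul₀ (hs k)]
      have := inv_le_of_one_le_mul_pow hd hC1 (mul_pos (hh k) (hs k)) hk.2.2
      linarith
    · rw [Real.norm_of_nonneg (hs k).le, Real.norm_of_nonneg (hT k).le]
      exact hsq (hT k).le hk.2.1
    · rw [isLittleO_iff_tendsto (fun k hk => absurd hk (pow_pos (hs k) 2).ne')]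
      have h0 : Tendsto (fun k => (n k * h k ^ d)⁻¹ * C ^ d) atTop (𝓝 0) := by
        simpa using ho.1.coverage.mul_const (C ^ d)
      refine squeeze_zero' (Eventually.of_forall fun k => ?_) (hup.mono fun k hk => ?_) h0
      · have := hT k
        positivity
      · rw [← hcov k]
        have h1 := hn k
        have h2 := hh k
        have h3 := hs k
        gcongr
  · rintro ⟨⟨h1, h2⟩, h3, h4⟩
    obtain ⟨C1, hC1, h1⟩ := h1.exists_pos
    obtain ⟨C2, hC2, h2⟩ := h2.exists_pos
    obtain ⟨C3, hC3, h3⟩ := h3.exists_pos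
    have h1' : ∀ᶠ k in atTop, h k ≤ C1 * (s k)⁻¹ := h1.bound.mono fun k hk => by
      rwa [Real.norm_of_nonneg (hh k).le, Real.norm_of_nonneg (inv_pos.2 (hs k)).le] at hk
    have h2' : ∀ᶠ k in atTop, 1 ≤ C2 * (h k * s k) := h2.bound.mono fun k hk => by
      rw [Real.norm_of_nonneg (hh k).le, Real.norm_of_nonneg (inv_pos.2 (hs k)).le,
        inv_le_iff_one_le_mul₀ (hs k)] at hk
      linarith
    have h3' : ∀ᶠ k in atTop, s k ≤ C3 * T k := h3.bound.mono fun k hk => by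
      rwa [Real.norm_of_nonneg (hs k).le, Real.norm_of_nonneg (hT k).le] at hk
    have hinv : Tendsto (fun k => (s k)⁻¹) atTop (𝓝 0) := tendsto_inv_atTop_zero.comp hlim
    refine isOptimalRule_of_isBigO hs hΓ ⟨hn, hT, hh, hb, ?_, ?_⟩ ?_
    · refine squeeze_zero' (Eventually.of_forall fun k => (hh k).le) h1' ?_
      simpa using hinv.const_mul C1
    · rw [isLittleO_iff_tendsto (fun k hk => absurd hk (pow_pos (hs k) 2).ne')] at h4
      have h0 : Tendsto (fun k => C2 ^ d * (T k / s k ^ 2)) atTop (𝓝 0) := by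
        simpa using h4.const_mul (C2 ^ d)
      refine squeeze_zero' (Eventually.of_forall fun k => ?_) (h2'.mono fun k hk => ?_) h0
      · have := hn k
        have := hh k
        positivity
      · rw [← hcov k, mul_left_comm, ← mul_pow]
        have h1 := hn k
        have h2 := hh k
        exact le_mul_of_one_le_right (by positivity) (one_le_pow₀ hk)
    · refine IsBigO.of_bound (C1 ^ 2 + C3 ^ 2 + C2 ^ d) ?_
      filter_upwards [h1', h2', h3'] with k k1 k2 k3
      have p1 := hn k
      have p2 := hh k
      have p3 := hs k
      have p4 := hT k
      have e : mseOrder d n T h k = h k ^ 2 + 1 / T k ^ 2 + 1 / (s k ^ (d + 2) * h k ^ d) := by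
        unfold mseOrder
        rw [hb, hΓ]
      rw [e, Real.norm_of_nonneg (by positivity), Real.norm_of_nonneg (by positivity),
        add_mul, add_mul]
      refine add_le_add (add_le_add ?_ ?_) ?_
      · calc h k ^ 2 ≤ (C1 * (s k)⁻¹) ^ 2 := by gcongr
          _ = C1 ^ 2 * (s k ^ 2)⁻¹ := by rw [mul_pow, inv_pow]
      · rw [← div_eq_mul_inv, div_le_div_iff₀ (by positivity) (by positivity), one_mul, ← mul_pow]
        gcongr
      · rw [← div_eq_mul_inv, div_le_div_iff₀ (by positivity) (by positivity), one_mul]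
        have : C2 ^ d * (s k ^ (d + 2) * h k ^ d) = (C2 * (h k * s k)) ^ d * s k ^ 2 := by ring
        rw [this]
        exact le_mul_of_one_le_left (by positivity) (one_le_pow₀ k2)

theorem order_of_isOptimalRule {s n T : ℕ → ℝ} (hs : ∀ k, 0 < s k)
    (hn : ∀ k, 0 < n k) (hT : ∀ k, 0 < T k) (hb : ∀ k, n k * T k = s k ^ (d + 2))
    (h1 : s =O[atTop] T) (h2 : T =o[atTop] fun k => s k ^ 2) :
    (fun k => s k ^ d) =o[atTop] n ∧ n =O[atTop] fun k => s k ^ (d + 1) := by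
  constructor
  · rw [isLittleO_iff_tendsto (fun k hk => absurd hk (pow_pos (hs k) 2).ne')] at h2
    rw [isLittleO_iff_tendsto (fun k hk => absurd hk (hn k).ne')]
    refine h2.congr fun k => ?_
    rw [div_eq_div_iff (pow_pos (hs k) 2).ne' (hn k).ne', mul_comm, hb, pow_add]
  · obtain ⟨C, hC⟩ := h1.bound
    refine IsBigO.of_bound C (hC.mono fun k hk => ?_)
    have p1 := hn k
    have p3 := hs k
    have p4 := hT k
    rw [Real.norm_of_nonneg p3.le, Real.norm_of_nonneg p4.le] at hk
    rw [Real.norm_of_nonneg p1.le, Real.norm_of_nonneg (by positivity)]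
    refine le_of_mul_le_mul_right ?_ p3
    calc n k * s k ≤ n k * (C * T k) := by gcongr
      _ = C * (n k * T k) := by ring
      _ = C * s k ^ (d + 1) * s k := by rw [hb]; ring

theorem rpow_div_natCast_add_two {Γ : ℝ} (hΓ : 0 < Γ) (m : ℕ) :
    Γ ^ ((m : ℝ) / ((d : ℝ) + 2)) = (Γ ^ (1 / ((d : ℝ) + 2))) ^ m := by
  rw [← Real.rpow_natCast, ← Real.rpow_mul hΓ.le]
  ring_nf

theorem rpow_one_div_pow {Γ : ℝ} (hΓ : 0 < Γ) :
    Γ = (Γ ^ (1 / ((d : ℝ) + 2))) ^ (d + 2) := by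
  rw [← rpow_div_natCast_add_two hΓ]
  push_cast
  rw [div_self (by positivity), Real.rpow_one]

theorem optimalRules (hd : 1 ≤ d) {Γ : ℕ → ℝ} (hpos : ∀ k, 0 < Γ k)
    (hlim : Tendsto Γ atTop atTop) :
    (∃ n T h : ℕ → ℝ, IsOptimalRule d Γ n T h) ∧
      ∀ n T h : ℕ → ℝ, (∀ k, 0 < n k) → (∀ k, 0 < T k) → (∀ k, 0 < h k) →
        (∀ k, n k * T k = Γ k) →
        ((IsOptimalRule d Γ n T h ↔
          h =Θ[atTop] (fun k => Γ k ^ (-(1 / ((d : ℝ) + 2)))) ∧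
          (fun k => Γ k ^ (1 / ((d : ℝ) + 2))) =O[atTop] T ∧
          T =o[atTop] (fun k => Γ k ^ (2 / ((d : ℝ) + 2)))) ∧
        (IsOptimalRule d Γ n T h →
          (fun k => Γ k ^ ((d : ℝ) / ((d : ℝ) + 2))) =o[atTop] n ∧
          n =O[atTop] (fun k => Γ k ^ (((d : ℝ) + 1) / ((d : ℝ) + 2))) ∧
          mseOrder d n T h =Θ[atTop] fun k => Γ k ^ (-(2 / ((d : ℝ) + 2))))) := by
  -- In terms of this root of the budget all exponents become natural powers.
  set s : ℕ → ℝ := fun k => Γ k ^ (1 / ((d : ℝ) + 2)) with hs_def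
  have hs : ∀ k, 0 < s k := fun k => Real.rpow_pos_of_pos (hpos k) _
  have hΓ : ∀ k, Γ k = s k ^ (d + 2) := fun k => rpow_one_div_pow (hpos k)
  have hslim : Tendsto s atTop atTop :=
    (tendsto_rpow_atTop (by positivity : 0 < 1 / ((d : ℝ) + 2))).comp hlim
  have e1 : (fun k => Γ k ^ (-(1 / ((d : ℝ) + 2)))) = fun k => (s k)⁻¹ :=
    funext fun k => Real.rpow_neg (hpos k).le _
  have e2 : (fun k => Γ k ^ (2 / ((d : ℝ) + 2))) = fun k => s k ^ 2 :=
    funext fun k => by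
      have := rpow_div_natCast_add_two (d := d) (hpos k) 2
      push_cast at this
      exact this
  have e3 : (fun k => Γ k ^ (-(2 / ((d : ℝ) + 2)))) = fun k => (s k ^ 2)⁻¹ :=
    funext fun k => by rw [Real.rpow_neg (hpos k).le, ← congrFun e2 k]
  have e4 : (fun k => Γ k ^ ((d : ℝ) / ((d : ℝ) + 2))) = fun k => s k ^ d :=
    funext fun k => rpow_div_natCast_add_two (hpos k) d
  have e5 : (fun k => Γ k ^ (((d : ℝ) + 1) / ((d : ℝ) + 2))) = fun k => s k ^ (d + 1) :=
    funext fun k => by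
      have := rpow_div_natCast_add_two (d := d) (hpos k) (d + 1)
      push_cast at this
      exact this
  rw [e1, e2, e3, e4, e5]
  refine ⟨⟨_, _, _, isOptimalRule_of_isBigO hs hΓ (isFeasibleRule_reference hs hΓ hslim) ?_⟩,
    fun n T h hn hT hh hb => ?_⟩
  · rw [funext (mseOrder_reference (d := d) hs)]
    exact (isBigO_refl _ _).const_mul_left 3
  · have hiff := isOptimalRule_iff hd hs hΓ hslim hn hT hh hb
    refine ⟨hiff, fun ho => ?_⟩
    obtain ⟨-, h2, h3⟩ := hiff.1 ho
    obtain ⟨h4, h5⟩ := order_of_isOptimalRule hs hn hT (fun k => by rw [hb, hΓ]) h2 h3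
    exact ⟨h4, h5, ho.mseOrder_isTheta hs hΓ hslim⟩

end Rules

/-! ### First-order characterization of convexity -/

section Gradient

variable {E : Type*} [NormedAddCommGroup E] [NormedSpace ℝ E]

/-- On the segment from `a` to `b` this is the one-variable fact that the derivative at 0 is at most
the slope over `[0, 1]`. The derivative is taken within `s` because SGD iterates may lie on the
boundary of `Θ`. -/
theorem ConvexOn.add_fderivWithin_le {s : Set E} {φ : E → ℝ} (hφ : ConvexOn ℝ s φ) {a b : E}
    (ha : a ∈ s) (hb : b ∈ s) {φ' : E →L[ℝ] ℝ} (h : HasFDerivWithinAt φ φ' s a) :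
    φ a + φ' (b - a) ≤ φ b := by
  have hmaps : Set.MapsTo (AffineMap.lineMap a b : ℝ →ᵃ[ℝ] E) (Set.Icc 0 1) s :=
    fun t ht => hφ.1.lineMap_mem ha hb ht
  have hconv : ConvexOn ℝ (Set.Icc (0 : ℝ) 1) (φ ∘ (AffineMap.lineMap a b : ℝ →ᵃ[ℝ] E)) :=
    (hφ.comp_affineMap _).subset hmaps (convex_Icc 0 1)
  have hline : HasDerivWithinAt (AffineMap.lineMap a b : ℝ → E) (b - a) (Set.Icc 0 1) 0 :=
    AffineMap.hasDerivWithinAt_lineMap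
  have hder : HasDerivWithinAt (φ ∘ (AffineMap.lineMap a b : ℝ →ᵃ[ℝ] E)) (φ' (b - a))
      (Set.Icc 0 1) 0 := by
    refine HasFDerivWithinAt.comp_hasDerivWithinAt (t := s) (0 : ℝ) ?_ hline hmaps
    simpa using h
  have := hconv.le_slope_of_hasDerivWithinAt (x := 0) (y := 1) (by simp) (by simp) one_pos hder
  simp [slope_def_field] at this
  have e : φ' (b - a) = φ' b - φ' a := map_sub _ _ _
  linarith

end Gradient

/-! ### Regularity of the gradient and of the solution map -/

namespace IsRegularProblem

variable {d q : ℕ} {Θ : Set (Vec q)} {X : Set (Vec d)} {f : Vec q → Vec d → ℝ}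

theorem optSol_mem (hp : IsRegularProblem Θ X f) {x : Vec d} (hx : x ∈ X) : optSol Θ f x ∈ Θ :=
  interior_subset (hp.interior_solution x hx)

theorem interior_nonempty (hp : IsRegularProblem Θ X f) : (interior Θ).Nonempty := by
  obtain ⟨x, hx⟩ := hp.covariates_interior
  exact ⟨_, hp.interior_solution x (interior_subset hx)⟩

theorem nonempty (hp : IsRegularProblem Θ X f) : Θ.Nonempty :=
  hp.interior_nonempty.mono interior_subset

theorem contDiffOn_two (hp : IsRegularProblem Θ X f) :
    ContDiffOn ℝ 2 (fun p : Vec q × Vec d => f p.1 p.2) (Θ ×ˢ X) := by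
  obtain ⟨m, hm, h⟩ := hp.smooth
  refine h.of_le ?_
  exact_mod_cast Nat.succ_le_succ hm

theorem uniqueDiffOn_prod (hp : IsRegularProblem Θ X f) : UniqueDiffOn ℝ (Θ ×ˢ X) :=
  (uniqueDiffOn_convex hp.convex_feasible hp.interior_nonempty).prod
    (uniqueDiffOn_convex hp.convex_covariates hp.covariates_interior)

theorem hasFDerivWithinAt_left (hp : IsRegularProblem Θ X f) {x : Vec d} (hx : x ∈ X) {θ : Vec q}
    (hθ : θ ∈ Θ) : HasFDerivWithinAt (fun θ' => f θ' x)
      ((fderivWithin ℝ (fun p : Vec q × Vec d => f p.1 p.2) (Θ ×ˢ X) (θ, x)).comp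
        (ContinuousLinearMap.inl ℝ (Vec q) (Vec d))) Θ θ := by
  have h1 : HasFDerivWithinAt (fun p : Vec q × Vec d => f p.1 p.2) _ (Θ ×ˢ X) (θ, x) :=
    ((hp.contDiffOn_two.differentiableOn (by norm_num)) (θ, x) ⟨hθ, hx⟩).hasFDerivWithinAt
  have h2 : HasFDerivWithinAt (fun θ' : Vec q => (θ', x))
      (ContinuousLinearMap.inl ℝ (Vec q) (Vec d)) Θ θ :=
    (hasFDerivAt_prodMk_left θ x).hasFDerivWithinAt
  exact HasFDerivWithinAt.comp (t := Θ ×ˢ X) θ h1 h2 fun θ' h' => ⟨h', hx⟩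

theorem hasGradientWithinAt (hp : IsRegularProblem Θ X f) {x : Vec d} (hx : x ∈ X) {θ : Vec q}
    (hθ : θ ∈ Θ) : HasGradientWithinAt (fun θ' => f θ' x) (gradθ Θ f x θ) Θ θ :=
  (hp.hasFDerivWithinAt_left hx hθ).differentiableWithinAt.hasGradientWithinAt

theorem isMinOn_optSol (hp : IsRegularProblem Θ X f) {x : Vec d} (hx : x ∈ X) :
    IsMinOn (fun θ => f θ x) Θ (optSol Θ f x) := by
  have hc : ContinuousOn (fun θ => f θ x) Θ := fun θ hθ =>
    (hp.hasGradientWithinAt hx hθ).hasFDerivWithinAt.continuousWithinAt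
  obtain ⟨θ, hθ, hmin⟩ := hp.compact_feasible.exists_isMinOn hp.nonempty hc
  exact (Classical.epsilon_spec (p := fun θ => θ ∈ Θ ∧ IsMinOn (fun θ' => f θ' x) Θ θ)
    ⟨θ, hθ, hmin⟩).2

theorem gradθ_optSol (hp : IsRegularProblem Θ X f) {x : Vec d} (hx : x ∈ X) :
    gradθ Θ f x (optSol Θ f x) = 0 := by
  have hn : Θ ∈ 𝓝 (optSol Θ f x) := mem_interior_iff_mem_nhds.1 (hp.interior_solution x hx)
  have hmin : IsLocalMin (fun θ => f θ x) (optSol Θ f x) := (hp.isMinOn_optSol hx).isLocalMin hn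
  rw [gradθ, gradientWithin, fderivWithin_of_mem_nhds hn, hmin.fderiv_eq_zero, map_zero]

/-- The gradient is a component of the joint derivative, which is `C¹` on the compact convex set `Θ
×ˢ X` and hence Lipschitz there. -/
theorem exists_lipschitz_gradθ (hp : IsRegularProblem Θ X f) : ∃ L : ℝ, 0 < L ∧
    ∀ x ∈ X, ∀ y ∈ X, ∀ θ ∈ Θ, ∀ θ' ∈ Θ,
      ‖gradθ Θ f x θ - gradθ Θ f y θ'‖ ≤ L * (‖θ - θ'‖ + ‖x - y‖) := by
  have h1 : ContDiffOn ℝ 1 (fderivWithin ℝ (fun p : Vec q × Vec d => f p.1 p.2) (Θ ×ˢ X))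
      (Θ ×ˢ X) := hp.contDiffOn_two.fderivWithin hp.uniqueDiffOn_prod (by norm_num)
  obtain ⟨K, hK⟩ := h1.exists_lipschitzOnWith one_ne_zero
    (hp.convex_feasible.prod hp.convex_covariates) (hp.compact_feasible.prod hp.compact_covariates)
  refine ⟨K + 1, by positivity, fun x hx y hy θ hθ θ' hθ' => ?_⟩
  have hu := uniqueDiffOn_convex hp.convex_feasible hp.interior_nonempty
  have e : ∀ {z : Vec d} {η : Vec q}, z ∈ X → η ∈ Θ → gradθ Θ f z η =
      (InnerProductSpace.toDual ℝ (Vec q)).symm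
        ((fderivWithin ℝ (fun p : Vec q × Vec d => f p.1 p.2) (Θ ×ˢ X) (η, z)).comp
        (ContinuousLinearMap.inl ℝ (Vec q) (Vec d))) := fun {z η} hz hη => by
    rw [gradθ, gradientWithin, (hp.hasFDerivWithinAt_left hz hη).fderivWithin (hu η hη)]
  rw [e hx hθ, e hy hθ', ← map_sub, LinearIsometryEquiv.norm_map, ← ContinuousLinearMap.sub_comp]
  have h2 := hK.dist_le_mul (θ, x) ⟨hθ, hx⟩ (θ', y) ⟨hθ', hy⟩
  rw [dist_eq_norm, dist_eq_norm] at h2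
  have h3 : ‖((θ, x) : Vec q × Vec d) - (θ', y)‖ ≤ ‖θ - θ'‖ + ‖x - y‖ := by
    rw [Prod.mk_sub_mk, Prod.norm_mk]
    exact max_le (le_add_of_nonneg_right (norm_nonneg _)) (le_add_of_nonneg_left (norm_nonneg _))
  refine (ContinuousLinearMap.opNorm_comp_le _ _).trans ?_
  refine (mul_le_of_le_one_right (norm_nonneg _) (ContinuousLinearMap.norm_inl_le_one ..)).trans ?_
  refine h2.trans ((mul_le_mul_of_nonneg_left h3 K.2).trans ?_)
  exact mul_le_mul_of_nonneg_right (le_add_of_nonneg_right zero_le_one) (by positivity)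

theorem convexOn (hp : IsRegularProblem Θ X f) {x : Vec d} (hx : x ∈ X) :
    ConvexOn ℝ Θ fun θ => f θ x := by
  obtain ⟨μ, hμ, h⟩ := hp.strongly_convex x hx
  exact UniformConvexOn.convexOn h fun r => by simp only [Pi.zero_apply]; positivity

theorem add_inner_gradθ_le (hp : IsRegularProblem Θ X f) {x : Vec d} (hx : x ∈ X) {θ θ' : Vec q}
    (hθ : θ ∈ Θ) (hθ' : θ' ∈ Θ) : f θ x + inner ℝ (gradθ Θ f x θ) (θ' - θ) ≤ f θ' x := by
  have := ConvexOn.add_fderivWithin_le (hp.convexOn hx) hθ hθ'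
    (hp.hasGradientWithinAt hx hθ).hasFDerivWithinAt
  simpa using this

theorem inner_gradθ_sub_nonneg (hp : IsRegularProblem Θ X f) {x : Vec d} (hx : x ∈ X)
    {θ θ' : Vec q} (hθ : θ ∈ Θ) (hθ' : θ' ∈ Θ) :
    0 ≤ inner ℝ (gradθ Θ f x θ - gradθ Θ f x θ') (θ - θ') := by
  have h1 := hp.add_inner_gradθ_le hx hθ hθ'
  have h2 := hp.add_inner_gradθ_le hx hθ' hθ
  rw [inner_sub_left]
  rw [← neg_sub θ θ', inner_neg_right] at h1
  linarith

/-- Strong monotonicity of the gradient around the solution, for a fixed covariate. -/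
theorem exists_inner_gradθ_ge (hp : IsRegularProblem Θ X f) {x : Vec d} (hx : x ∈ X) :
    ∃ m : ℝ, 0 < m ∧ ∀ θ ∈ Θ,
      m * ‖θ - optSol Θ f x‖ ^ 2 ≤ inner ℝ (gradθ Θ f x θ) (θ - optSol Θ f x) := by
  obtain ⟨μ, hμ, h⟩ := hp.strongly_convex x hx
  -- Strong convexity at the midpoint of `θ` and the minimizer, whose value is at least the minimum,
  -- yields a gap of at least `μ/4` times the squared distance; the tangent inequality bounds the
  -- gap by the inner product.
  refine ⟨μ / 4, by positivity, fun θ hθ => ?_⟩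
  have hm := hp.optSol_mem hx
  have h1 := hp.add_inner_gradθ_le hx hθ hm
  rw [← neg_sub θ, inner_neg_right] at h1
  obtain ⟨hc, h⟩ := h
  have h2 := h hθ hm (a := 1 / 2) (b := 1 / 2) (by norm_num) (by norm_num) (by norm_num)
  have h3 : f (optSol Θ f x) x ≤ _ := hp.isMinOn_optSol hx
    (hc hθ hm (a := 1 / 2) (b := 1 / 2) (by norm_num) (by norm_num) (by norm_num))
  simp only [smul_eq_mul] at h2
  linarith

/-- The gradient at covariate `y` vanishes at the solution for `y`, so the gradient at covariate `x`
has norm at most `L ‖y - x‖` there; strong monotonicity at `x` converts this into a distance. Only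
the modulus at `x` enters, so continuity of the solution is available before a uniform modulus is.
-/
theorem norm_optSol_sub_le (hp : IsRegularProblem Θ X f) {L : ℝ}
    (hL : ∀ x ∈ X, ∀ y ∈ X, ∀ θ ∈ Θ, ∀ θ' ∈ Θ,
      ‖gradθ Θ f x θ - gradθ Θ f y θ'‖ ≤ L * (‖θ - θ'‖ + ‖x - y‖))
    {x : Vec d} (hx : x ∈ X) {m : ℝ} (hm : 0 < m)
    (h : ∀ θ ∈ Θ, m * ‖θ - optSol Θ f x‖ ^ 2 ≤ inner ℝ (gradθ Θ f x θ) (θ - optSol Θ f x))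
    {y : Vec d} (hy : y ∈ X) : ‖optSol Θ f y - optSol Θ f x‖ ≤ L / m * ‖y - x‖ := by
  have h1 := h _ (hp.optSol_mem hy)
  have h2 := hL x hx y hy _ (hp.optSol_mem hy) _ (hp.optSol_mem hy)
  rw [hp.gradθ_optSol hy, sub_zero, sub_self, norm_zero, zero_add, norm_sub_rev] at h2
  have h3 := real_inner_le_norm (gradθ Θ f x (optSol Θ f y)) (optSol Θ f y - optSol Θ f x)
  rcases (norm_nonneg (optSol Θ f y - optSol Θ f x)).eq_or_lt with h0 | h0
  · have : 0 ≤ L * ‖y - x‖ := (norm_nonneg _).trans h2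
    rw [← h0, div_mul_eq_mul_div]
    positivity
  · rw [div_mul_eq_mul_div, le_div_iff₀ hm]
    refine le_of_mul_le_mul_right ?_ h0
    nlinarith

theorem continuousOn_optSol (hp : IsRegularProblem Θ X f) : ContinuousOn (optSol Θ f) X := by
  obtain ⟨L, hL0, hL⟩ := hp.exists_lipschitz_gradθ
  intro x hx
  obtain ⟨m, hm, h⟩ := hp.exists_inner_gradθ_ge hx
  rw [ContinuousWithinAt, tendsto_iff_norm_sub_tendsto_zero]
  have h0 : Tendsto (fun y => L / m * ‖y - x‖) (𝓝[X] x) (𝓝 0) := by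
    have : Continuous fun y : Vec d => L / m * ‖y - x‖ := by fun_prop
    simpa using (this.tendsto x).mono_left nhdsWithin_le_nhds
  refine squeeze_zero' (Eventually.of_forall fun y => norm_nonneg _) ?_ h0
  filter_upwards [self_mem_nhdsWithin] with y hy
  exact hp.norm_optSol_sub_le hL hx hm h hy

/-- The solutions form a compact subset of the open set `interior Θ`, so one thickening radius fits
all of them. -/
theorem exists_closedBall_subset (hp : IsRegularProblem Θ X f) : ∃ ρ : ℝ, 0 < ρ ∧
    ∀ x ∈ X, Metric.closedBall (optSol Θ f x) ρ ⊆ Θ := by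
  have hc : IsCompact (optSol Θ f '' X) :=
    hp.compact_covariates.image_of_continuousOn hp.continuousOn_optSol
  obtain ⟨ρ, hρ, h⟩ := hc.exists_cthickening_subset_open isOpen_interior
    (Set.image_subset_iff.2 fun x hx => hp.interior_solution x hx)
  exact ⟨ρ, hρ, fun x hx => (Metric.closedBall_subset_cthickening
    (Set.mem_image_of_mem _ hx) ρ).trans (h.trans interior_subset)⟩

end IsRegularProblem

/-! ### Constants uniform in the covariate -/

section Uniform

variable {d q : ℕ}

/-- Quantitative regularity of the problem with constants that do not depend on the covariate. -/
structure UniformRegularity (Θ : Set (Vec q)) (X : Set (Vec d)) (f : Vec q → Vec d → ℝ)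
    (μ L K ρ B : ℝ) : Prop where
  mu_pos : 0 < μ
  lip_pos : 0 < L
  quad_pos : 0 < K
  rho_pos : 0 < ρ
  bound_pos : 0 < B
  norm_le : ∀ θ ∈ Θ, ‖θ‖ ≤ B
  closedBall_subset : ∀ x ∈ X, Metric.closedBall (optSol Θ f x) ρ ⊆ Θ
  norm_gradθ_le : ∀ x ∈ X, ∀ θ ∈ Θ, ‖gradθ Θ f x θ‖ ≤ L * ‖θ - optSol Θ f x‖
  le_inner_gradθ : ∀ x ∈ X, ∀ θ ∈ Θ,
    μ * ‖θ - optSol Θ f x‖ ^ 2 ≤ inner ℝ (gradθ Θ f x θ) (θ - optSol Θ f x)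
  norm_optSol_sub_le : ∀ x ∈ X, ∀ y ∈ X, ‖optSol Θ f y - optSol Θ f x‖ ≤ L / μ * ‖y - x‖
  exists_linear : ∀ x ∈ X, ∃ G : Vec q →L[ℝ] Vec q,
    (∀ v, μ * ‖v‖ ^ 2 ≤ inner ℝ (G v) v) ∧ (∀ v, ‖G v‖ ≤ L * ‖v‖) ∧
    ∀ θ ∈ Θ, ‖gradθ Θ f x θ - G (θ - optSol Θ f x)‖ ≤ K * ‖θ - optSol Θ f x‖ ^ 2

namespace IsRegularProblem

variable {Θ : Set (Vec q)} {X : Set (Vec d)} {f : Vec q → Vec d → ℝ}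

theorem add_mem_of_closedBall_subset {ρ : ℝ} {a w : Vec q}
    (hρ : Metric.closedBall a ρ ⊆ Θ) (hw : ‖w‖ ≤ ρ) : a + w ∈ Θ :=
  hρ (by simpa [dist_eq_norm] using hw)

/-- The linearization matrix is the directional derivative of the gradient at the solution, so
bounds on the gradient pass to `G` in the limit. -/
theorem tendsto_inv_smul_gradθ {ρ δ K : ℝ} (hρ0 : 0 < ρ) (hδ : 0 < δ) {x : Vec d}
    (hρ : Metric.closedBall (optSol Θ f x) ρ ⊆ Θ) {G : Vec q →L[ℝ] Vec q}
    (hG : ∀ θ ∈ Θ, ‖θ - optSol Θ f x‖ ≤ δ →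
      ‖gradθ Θ f x θ - G (θ - optSol Θ f x)‖ ≤ K * ‖θ - optSol Θ f x‖ ^ 2) (v : Vec q) :
    (∀ᶠ s : ℝ in 𝓝[>] 0, 0 < s ∧ optSol Θ f x + s • v ∈ Θ) ∧
    Tendsto (fun s : ℝ => s⁻¹ • gradθ Θ f x (optSol Θ f x + s • v)) (𝓝[>] 0) (𝓝 (G v)) := by
  have hc : Tendsto (fun s : ℝ => ‖s • v‖) (𝓝[>] 0) (𝓝 0) := by
    have : Continuous fun s : ℝ => ‖s • v‖ := by fun_prop
    simpa using (this.tendsto 0).mono_left nhdsWithin_le_nhds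
  have hev : ∀ᶠ s : ℝ in 𝓝[>] 0, 0 < s ∧ ‖s • v‖ ≤ ρ ∧ ‖s • v‖ ≤ δ := by
    filter_upwards [self_mem_nhdsWithin, hc.eventually_le_const hρ0, hc.eventually_le_const hδ]
      with s h1 h2 h3
    exact ⟨h1, h2, h3⟩
  refine ⟨hev.mono fun s hs => ⟨hs.1, add_mem_of_closedBall_subset hρ hs.2.1⟩, ?_⟩
  rw [tendsto_iff_norm_sub_tendsto_zero]
  have h0 : Tendsto (fun s : ℝ => K * s * ‖v‖ ^ 2) (𝓝[>] 0) (𝓝 0) := by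
    have : Continuous fun s : ℝ => K * s * ‖v‖ ^ 2 := by fun_prop
    simpa using (this.tendsto 0).mono_left nhdsWithin_le_nhds
  refine squeeze_zero' (Eventually.of_forall fun s => norm_nonneg _) (hev.mono fun s hs => ?_) h0
  have h1 := hG _ (add_mem_of_closedBall_subset hρ hs.2.1) (by simpa using hs.2.2)
  rw [add_sub_cancel_left, map_smul, norm_smul, Real.norm_of_nonneg hs.1.le] at h1
  have h2 : s⁻¹ • gradθ Θ f x (optSol Θ f x + s • v) - G v
      = s⁻¹ • (gradθ Θ f x (optSol Θ f x + s • v) - s • G v) := by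
    rw [smul_sub, inv_smul_smul₀ hs.1.ne']
  rw [h2, norm_smul, norm_inv, Real.norm_of_nonneg hs.1.le, inv_mul_le_iff₀ hs.1]
  linarith

theorem norm_linear_le {ρ δ K L : ℝ} (hρ0 : 0 < ρ) (hδ : 0 < δ) {x : Vec d}
    (hρ : Metric.closedBall (optSol Θ f x) ρ ⊆ Θ) {G : Vec q →L[ℝ] Vec q}
    (hG : ∀ θ ∈ Θ, ‖θ - optSol Θ f x‖ ≤ δ →
      ‖gradθ Θ f x θ - G (θ - optSol Θ f x)‖ ≤ K * ‖θ - optSol Θ f x‖ ^ 2)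
    (hL : ∀ θ ∈ Θ, ‖gradθ Θ f x θ‖ ≤ L * ‖θ - optSol Θ f x‖) (v : Vec q) :
    ‖G v‖ ≤ L * ‖v‖ := by
  obtain ⟨h1, h2⟩ := tendsto_inv_smul_gradθ hρ0 hδ hρ hG v
  refine le_of_tendsto h2.norm (h1.mono fun s hs => ?_)
  have := hL _ hs.2
  rw [add_sub_cancel_left, norm_smul, Real.norm_of_nonneg hs.1.le] at this
  rw [norm_smul, norm_inv, Real.norm_of_nonneg hs.1.le, inv_mul_le_iff₀ hs.1]
  linarith

theorem le_inner_linear {ρ δ K μ : ℝ} (hρ0 : 0 < ρ) (hδ : 0 < δ) {x : Vec d}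
    (hρ : Metric.closedBall (optSol Θ f x) ρ ⊆ Θ) {G : Vec q →L[ℝ] Vec q}
    (hG : ∀ θ ∈ Θ, ‖θ - optSol Θ f x‖ ≤ δ →
      ‖gradθ Θ f x θ - G (θ - optSol Θ f x)‖ ≤ K * ‖θ - optSol Θ f x‖ ^ 2)
    (hμ : ∀ θ ∈ Θ, μ * ‖θ - optSol Θ f x‖ ^ 2 ≤ inner ℝ (gradθ Θ f x θ) (θ - optSol Θ f x))
    (v : Vec q) : μ * ‖v‖ ^ 2 ≤ inner ℝ (G v) v := by
  obtain ⟨h1, h2⟩ := tendsto_inv_smul_gradθ hρ0 hδ hρ hG v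
  refine ge_of_tendsto (h2.inner tendsto_const_nhds) (h1.mono fun s hs => ?_)
  have := hμ _ hs.2
  rw [add_sub_cancel_left, norm_smul, Real.norm_of_nonneg hs.1.le, inner_smul_right] at this
  rw [real_inner_smul_left, le_inv_mul_iff₀ hs.1]
  refine le_of_mul_le_mul_left ?_ hs.1
  nlinarith

/-- Strong monotonicity inside and outside a sphere around the solution, from the value on the
sphere and the linearization of the gradient. -/
theorem le_inner_gradθ_of_sphere (hp : IsRegularProblem Θ X f) {ρ δ K m r B : ℝ} {x : Vec d}
    (hx : x ∈ X) (hK : 0 < K) (hm : 0 < m) (hr : 0 < r) (hB0 : 0 < B) (hB : ∀ θ ∈ Θ, ‖θ‖ ≤ B)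
    (hρ : Metric.closedBall (optSol Θ f x) ρ ⊆ Θ) (hrρ : r ≤ ρ) (hrδ : r ≤ δ)
    (hrK : K * r ≤ m / 4) {G : Vec q →L[ℝ] Vec q}
    (hG : ∀ θ ∈ Θ, ‖θ - optSol Θ f x‖ ≤ δ →
      ‖gradθ Θ f x θ - G (θ - optSol Θ f x)‖ ≤ K * ‖θ - optSol Θ f x‖ ^ 2)
    (hs : ∀ w : Vec q, ‖w‖ = r →
      3 / 4 * m * r ^ 2 ≤ inner ℝ (gradθ Θ f x (optSol Θ f x + w)) w)
    {θ : Vec q} (hθ : θ ∈ Θ) :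
    min (m / 4) (3 / 4 * m * r / (2 * B)) * ‖θ - optSol Θ f x‖ ^ 2 ≤
      inner ℝ (gradθ Θ f x θ) (θ - optSol Θ f x) := by
  rcases (norm_nonneg (θ - optSol Θ f x)).eq_or_lt with h0 | h0
  · have : θ - optSol Θ f x = 0 := norm_eq_zero.1 h0.symm
    simp [this]
  set v := θ - optSol Θ f x with hv
  -- The factor `c` moves `v` onto the sphere of radius `r`, where a lower bound is known.
  set c := r / ‖v‖ with hc
  have hc0 : 0 < c := by positivity
  have hw : ‖c • v‖ = r := by
    rw [norm_smul, Real.norm_of_nonneg hc0.le, hc, div_mul_cancel₀ _ h0.ne']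
  have hmem : optSol Θ f x + c • v ∈ Θ := add_mem_of_closedBall_subset hρ (hw.le.trans hrρ)
  have h1 := hs _ hw
  rw [inner_smul_right] at h1
  have hcv : c * ‖v‖ = r := by rw [hc, div_mul_cancel₀ _ h0.ne']
  rcases le_total ‖v‖ r with hvr | hvr
  -- Inside the sphere: linearizing at the sphere point costs `K r³ ≤ (m/4) r²`, so `G` has modulus
  -- `m/2`; linearizing again at `θ` costs another `m/4`.
  · refine (mul_le_mul_of_nonneg_right (min_le_left _ _) (by positivity)).trans ?_
    have h2 := hG _ hmem (by rw [add_sub_cancel_left, hw]; exact hrδ)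
    rw [add_sub_cancel_left, hw] at h2
    have h3 := hG _ hθ (hvr.trans hrδ)
    have h4 := (abs_le.1 (abs_real_inner_le_norm
      (gradθ Θ f x (optSol Θ f x + c • v) - G (c • v)) v)).2
    have h5 := (abs_le.1 (abs_real_inner_le_norm (gradθ Θ f x θ - G v) v)).1
    rw [inner_sub_left, map_smul, real_inner_smul_left] at h4
    rw [map_smul] at h2
    rw [inner_sub_left] at h5
    have h6 : ‖gradθ Θ f x (optSol Θ f x + c • v) - c • G v‖ * ‖v‖ ≤ K * r ^ 2 * ‖v‖ :=
      mul_le_mul_of_nonneg_right h2 h0.le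
    have h7 : ‖gradθ Θ f x θ - G v‖ * ‖v‖ ≤ K * ‖v‖ ^ 2 * ‖v‖ :=
      mul_le_mul_of_nonneg_right h3 h0.le
    have h8 : K * ‖v‖ ≤ m / 4 := (mul_le_mul_of_nonneg_left hvr hK.le).trans hrK
    have h9 : 3 / 4 * m * r ^ 2 ≤ c ^ 2 * inner ℝ (G v) v + c * (K * r ^ 2 * ‖v‖) := by
      nlinarith
    have h10 : m / 2 * ‖v‖ ^ 2 ≤ inner ℝ (G v) v := by
      refine le_of_mul_le_mul_left ?_ (pow_pos hc0 2)
      have e1 : c ^ 2 * (m / 2 * ‖v‖ ^ 2) = m / 2 * r ^ 2 := by rw [← hcv]; ring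
      have e2 : c * (K * r ^ 2 * ‖v‖) = K * r * r ^ 2 := by rw [← hcv]; ring
      have e3 : K * r * r ^ 2 ≤ m / 4 * r ^ 2 := by gcongr
      rw [e1]
      linarith
    have h11 : K * ‖v‖ ^ 2 * ‖v‖ ≤ m / 4 * ‖v‖ ^ 2 := by
      have : K * ‖v‖ ^ 2 * ‖v‖ = K * ‖v‖ * ‖v‖ ^ 2 := by ring
      rw [this]
      gcongr
    linarith
  -- Outside the sphere: by monotonicity the inner product with `v` does not decrease from the
  -- sphere point to `θ`. This gives linear growth in `‖v‖`, and `‖v‖ ≤ 2 * B` makes it quadratic.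
  · refine (mul_le_mul_of_nonneg_right (min_le_right _ _) (by positivity)).trans ?_
    have hvB : ‖v‖ ≤ 2 * B := by
      have := norm_sub_le θ (optSol Θ f x)
      have := hB _ hθ
      have := hB _ (hp.optSol_mem hx)
      linarith
    have hc1 : c ≤ 1 := (div_le_one h0).2 hvr
    have h2 := hp.inner_gradθ_sub_nonneg hx hθ hmem
    have e : θ - (optSol Θ f x + c • v) = (1 - c) • v := by
      rw [sub_smul, one_smul, hv]; abel
    rw [e, inner_smul_right, inner_sub_left] at h2
    have h3 : inner ℝ (gradθ Θ f x (optSol Θ f x + c • v)) v ≤ inner ℝ (gradθ Θ f x θ) v := by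
      rcases hc1.eq_or_lt with h4 | h4
      · rw [h4, one_smul, hv, add_sub_cancel]
      · have := nonneg_of_mul_nonneg_right h2 (sub_pos.2 h4)
        linarith
    refine le_trans ?_ h3
    refine le_of_mul_le_mul_left (le_trans ?_ h1) hc0
    have e2 : c * (3 / 4 * m * r / (2 * B) * ‖v‖ ^ 2) = 3 / 4 * m * r ^ 2 * (‖v‖ / (2 * B)) := by
      have : c * (3 / 4 * m * r / (2 * B) * ‖v‖ ^ 2)
        = (c * ‖v‖) * (3 / 4 * m * r / (2 * B) * ‖v‖) := by ring
      rw [this, hcv]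
      ring
    rw [e2]
    exact mul_le_of_le_one_right (by positivity) ((div_le_one (by positivity)).2 hvB)

/-- The strong convexity modulus may vary arbitrarily with the covariate. On a small sphere around
the solution, however, the lower bound at `x₀` persists for nearby covariates by the Lipschitz
estimates, and `le_inner_gradθ_of_sphere` spreads it over `Θ`. Compactness of `X` then leaves
finitely many moduli. -/
theorem exists_uniform_inner_gradθ_ge (hp : IsRegularProblem Θ X f) {L ρ B : ℝ}
    (hL : ∀ x ∈ X, ∀ y ∈ X, ∀ θ ∈ Θ, ∀ θ' ∈ Θ,
      ‖gradθ Θ f x θ - gradθ Θ f y θ'‖ ≤ L * (‖θ - θ'‖ + ‖x - y‖))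
    (hρ0 : 0 < ρ) (hρ : ∀ x ∈ X, Metric.closedBall (optSol Θ f x) ρ ⊆ Θ)
    (hB0 : 0 < B) (hB : ∀ θ ∈ Θ, ‖θ‖ ≤ B) : ∃ μ : ℝ, 0 < μ ∧ ∀ x ∈ X, ∀ θ ∈ Θ,
      μ * ‖θ - optSol Θ f x‖ ^ 2 ≤ inner ℝ (gradθ Θ f x θ) (θ - optSol Θ f x) := by
  obtain ⟨K, δ, hK, hδ, hlin⟩ := hp.linearization
  let p : Set (Vec d) → Prop := fun t => ∃ μ : ℝ, 0 < μ ∧ ∀ x ∈ X, x ∈ t → ∀ θ ∈ Θ,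
      μ * ‖θ - optSol Θ f x‖ ^ 2 ≤ inner ℝ (gradθ Θ f x θ) (θ - optSol Θ f x)
  suffices h : p X by
    obtain ⟨μ, hμ, h⟩ := h
    exact ⟨μ, hμ, fun x hx => h x hx hx⟩
  refine hp.compact_covariates.induction_on (p := p) ⟨1, one_pos, fun x _ h => h.elim⟩
    ?_ ?_ ?_
  · rintro s t hst ⟨μ, hμ, h⟩
    exact ⟨μ, hμ, fun x hx hxs => h x hx (hst hxs)⟩
  · rintro s t ⟨μ, hμ, h⟩ ⟨μ', hμ', h'⟩
    refine ⟨min μ μ', lt_min hμ hμ', fun x hx hxs θ hθ => ?_⟩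
    rcases hxs with hxs | hxs
    · exact (mul_le_mul_of_nonneg_right (min_le_left _ _) (by positivity)).trans (h x hx hxs θ hθ)
    · exact (mul_le_mul_of_nonneg_right (min_le_right _ _) (by positivity)).trans
        (h' x hx hxs θ hθ)
  · intro x₀ hx₀
    obtain ⟨m, hm, hmono⟩ := hp.exists_inner_gradθ_ge hx₀
    set r := min (min ρ δ) (m / (4 * K)) with hr
    have hr0 : 0 < r := lt_min (lt_min hρ0 hδ) (by positivity)
    have hrK : K * r ≤ m / 4 := by
      have : r ≤ m / (4 * K) := min_le_right _ _
      rw [le_div_iff₀ (by positivity)] at this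
      linarith
    have hcont : Tendsto (fun x => L * (‖optSol Θ f x - optSol Θ f x₀‖ + ‖x - x₀‖)) (𝓝[X] x₀)
        (𝓝 0) := by
      have h1 := tendsto_iff_norm_sub_tendsto_zero.1 (hp.continuousOn_optSol x₀ hx₀)
      have h2 : Tendsto (fun x => ‖x - x₀‖) (𝓝[X] x₀) (𝓝 0) :=
        tendsto_iff_norm_sub_tendsto_zero.1 (tendsto_id'.2 nhdsWithin_le_nhds)
      simpa using (h1.add h2).const_mul L
    -- A gradient perturbation of `m r / 4`, paired with a vector of norm `r`, costs `m r² / 4` and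
    -- leaves the `3/4 * m * r ^ 2` required on the sphere.
    refine ⟨_, hcont.eventually_le_const (show 0 < m * r / 4 by positivity),
      min (m / 4) (3 / 4 * m * r / (2 * B)), by positivity, fun x hx hxs θ hθ => ?_⟩
    have hxs : L * (‖optSol Θ f x - optSol Θ f x₀‖ + ‖x - x₀‖) ≤ m * r / 4 := hxs
    obtain ⟨G, hG⟩ := hlin x hx
    refine hp.le_inner_gradθ_of_sphere hx hK hm hr0 hB0 hB (hρ x hx)
      ((min_le_left _ _).trans (min_le_left _ _)) ((min_le_left _ _).trans (min_le_right _ _))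
      hrK hG (fun w hw => ?_) hθ
    have hwρ : ‖w‖ ≤ ρ := hw.le.trans ((min_le_left _ _).trans (min_le_left _ _))
    have m1 := add_mem_of_closedBall_subset (hρ x hx) hwρ
    have m0 := add_mem_of_closedBall_subset (hρ x₀ hx₀) hwρ
    have h1 := hL x hx x₀ hx₀ _ m1 _ m0
    rw [add_sub_add_right_eq_sub] at h1
    have h2 := hmono _ m0
    rw [add_sub_cancel_left, hw] at h2
    have h3 := (abs_le.1 (abs_real_inner_le_norm (gradθ Θ f x (optSol Θ f x + w)
      - gradθ Θ f x₀ (optSol Θ f x₀ + w)) w)).1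
    rw [inner_sub_left, hw] at h3
    have h4 := mul_le_mul_of_nonneg_right (h1.trans hxs) hr0.le
    nlinarith

theorem exists_uniformRegularity (hp : IsRegularProblem Θ X f) :
    ∃ μ L K ρ B : ℝ, UniformRegularity Θ X f μ L K ρ B := by
  obtain ⟨L, hL0, hL⟩ := hp.exists_lipschitz_gradθ
  obtain ⟨ρ, hρ0, hρ⟩ := hp.exists_closedBall_subset
  obtain ⟨B, hB0, hB⟩ := hp.compact_feasible.isBounded.exists_pos_norm_le
  obtain ⟨μ, hμ0, hμ⟩ := hp.exists_uniform_inner_gradθ_ge hL hρ0 hρ hB0 hB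
  obtain ⟨K, δ, hK, hδ, hlin⟩ := hp.linearization
  have hgrad : ∀ x ∈ X, ∀ θ ∈ Θ, ‖gradθ Θ f x θ‖ ≤ L * ‖θ - optSol Θ f x‖ := fun x hx θ hθ => by
    have := hL x hx x hx θ hθ _ (hp.optSol_mem hx)
    simpa [hp.gradθ_optSol hx] using this
  -- The extra `2 L / δ` extends the linearization to all of `Θ`: beyond distance `δ` the remainder
  -- is at most `2 L` times the distance, which is at most `2 L / δ` times its square.
  refine ⟨μ, L, K + 2 * L / δ, ρ, B, ⟨hμ0, hL0, by positivity, hρ0, hB0, hB, hρ, hgrad, hμ,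
    fun x hx y hy => hp.norm_optSol_sub_le hL hx hμ0 (hμ x hx) hy, fun x hx => ?_⟩⟩
  obtain ⟨G, hG⟩ := hlin x hx
  have hGL := norm_linear_le hρ0 hδ (hρ x hx) hG (hgrad x hx)
  refine ⟨G, le_inner_linear hρ0 hδ (hρ x hx) hG (hμ x hx), hGL, fun θ hθ => ?_⟩
  rw [add_mul]
  rcases le_total ‖θ - optSol Θ f x‖ δ with h | h
  · exact (hG θ hθ h).trans (le_add_of_nonneg_right (by positivity))
  · have h1 := norm_sub_le (gradθ Θ f x θ) (G (θ - optSol Θ f x))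
    have h2 := hgrad x hx θ hθ
    have h3 := hGL (θ - optSol Θ f x)
    have h4 : 2 * L * ‖θ - optSol Θ f x‖ ≤ 2 * L / δ * ‖θ - optSol Θ f x‖ ^ 2 := by
      rw [div_mul_eq_mul_div, le_div_iff₀ hδ, pow_two, ← mul_assoc]
      exact mul_le_mul_of_nonneg_left h (by positivity)
    have h5 : 0 ≤ K * ‖θ - optSol Θ f x‖ ^ 2 := by positivity
    linarith

theorem gap_nonneg (hp : IsRegularProblem Θ X f) {x : Vec d} (hx : x ∈ X) {θ : Vec q}
    (hθ : θ ∈ Θ) : 0 ≤ f θ x - f (optSol Θ f x) x :=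
  sub_nonneg.2 (hp.isMinOn_optSol hx hθ)

/-- The tangent inequality at `θ` bounds the gap by the pairing of the gradient with `θ - θ_*`, and
both factors are of the order of the distance. -/
theorem gap_le (hp : IsRegularProblem Θ X f) {μ L K ρ B : ℝ}
    (hu : UniformRegularity Θ X f μ L K ρ B) {x : Vec d} (hx : x ∈ X) {θ : Vec q} (hθ : θ ∈ Θ) :
    f θ x - f (optSol Θ f x) x ≤ L * ‖θ - optSol Θ f x‖ ^ 2 := by
  have h1 := hp.add_inner_gradθ_le hx hθ (hp.optSol_mem hx)
  rw [← neg_sub θ, inner_neg_right] at h1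
  have h2 := real_inner_le_norm (gradθ Θ f x θ) (θ - optSol Θ f x)
  have h3 := mul_le_mul_of_nonneg_right (hu.norm_gradθ_le x hx θ hθ)
    (norm_nonneg (θ - optSol Θ f x))
  nlinarith

end IsRegularProblem

end Uniform

/-! ### Metric projection onto a compact convex set -/

section Projection

variable {q : ℕ} {Θ : Set (Vec q)}

theorem proj_spec (hc : IsCompact Θ) (hne : Θ.Nonempty) (z : Vec q) :
    proj Θ z ∈ Θ ∧ dist z (proj Θ z) = Metric.infDist z Θ := by
  obtain ⟨y, hy, h⟩ := hc.exists_infDist_eq_dist hne z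
  exact Classical.epsilon_spec (p := fun p => p ∈ Θ ∧ dist z p = Metric.infDist z Θ)
    ⟨y, hy, h.symm⟩

theorem proj_mem (hc : IsCompact Θ) (hne : Θ.Nonempty) (z : Vec q) : proj Θ z ∈ Θ :=
  (proj_spec hc hne z).1

theorem inner_sub_proj_le (hc : IsCompact Θ) (hne : Θ.Nonempty) (hconv : Convex ℝ Θ) (z : Vec q)
    {w : Vec q} (hw : w ∈ Θ) : inner ℝ (z - proj Θ z) (w - proj Θ z) ≤ 0 := by
  refine (norm_eq_iInf_iff_real_inner_le_zero hconv (proj_mem hc hne z)).1 ?_ w hw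
  rw [← dist_eq_norm, (proj_spec hc hne z).2, Metric.infDist_eq_iInf]
  simp only [dist_eq_norm]

theorem norm_proj_sub_proj_le (hc : IsCompact Θ) (hne : Θ.Nonempty) (hconv : Convex ℝ Θ)
    (z w : Vec q) : ‖proj Θ z - proj Θ w‖ ≤ ‖z - w‖ := by
  have h1 := inner_sub_proj_le hc hne hconv z (proj_mem hc hne w)
  have h2 := inner_sub_proj_le hc hne hconv w (proj_mem hc hne z)
  have h3 := real_inner_le_norm (z - w) (proj Θ z - proj Θ w)
  rw [← neg_sub (proj Θ z) (proj Θ w), inner_neg_right] at h1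
  have e : inner ℝ (z - w) (proj Θ z - proj Θ w) = ‖proj Θ z - proj Θ w‖ ^ 2 +
      inner ℝ (z - proj Θ z) (proj Θ z - proj Θ w) -
      inner ℝ (w - proj Θ w) (proj Θ z - proj Θ w) := by
    rw [← real_inner_self_eq_norm_sq, ← inner_add_left, ← inner_sub_left]
    congr 1
    abel
  rcases (norm_nonneg (proj Θ z - proj Θ w)).eq_or_lt with h0 | h0
  · rw [← h0]; exact norm_nonneg _
  · refine le_of_mul_le_mul_right ?_ h0
    nlinarith

theorem proj_eq_self (hc : IsCompact Θ) {z : Vec q} (hz : z ∈ Θ) : proj Θ z = z := by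
  have h := (proj_spec hc ⟨z, hz⟩ z).2
  rw [Metric.infDist_zero_of_mem hz] at h
  exact (dist_eq_zero.1 h).symm

theorem norm_sub_proj_le (hc : IsCompact Θ) (z : Vec q) {w : Vec q} (hw : w ∈ Θ) :
    ‖z - proj Θ z‖ ≤ ‖z - w‖ := by
  rw [← dist_eq_norm, ← dist_eq_norm, (proj_spec hc ⟨w, hw⟩ z).2]
  exact Metric.infDist_le_dist_of_mem hw

theorem measurable_proj (hc : IsCompact Θ) (hne : Θ.Nonempty) (hconv : Convex ℝ Θ) :
    Measurable (proj Θ) := by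
  have : LipschitzWith 1 (proj Θ) := LipschitzWith.of_dist_le_mul fun z w => by
    simpa [dist_eq_norm] using norm_proj_sub_proj_le hc hne hconv z w
  exact this.continuous.measurable

end Projection

/-! ### Measurability and feasibility of the iterates -/

section Iterates

variable {d q : ℕ} {S : Type*} {Θ : Set (Vec q)}
  {gradF : Vec q → Vec d → S → Vec q} {γ : ℕ → ℝ} {θ₀ : Vec d → Vec q} {x : Vec d}

theorem sgd_mem (hc : IsCompact Θ) (h0 : θ₀ x ∈ Θ) (ζ : ℕ → S) (t : ℕ) :
    sgd Θ gradF γ θ₀ x ζ t ∈ Θ := by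
  cases t with
  | zero => exact h0
  | succ t => exact proj_mem hc ⟨_, h0⟩ _

/-- An arbitrary increasing family of σ-algebras covers adaptedness (a filtration) as well as plain
measurability (a constant family). -/
theorem measurable_sgd [MeasurableSpace S] (hc : IsCompact Θ) (hne : Θ.Nonempty) (hconv : Convex ℝ Θ)
    (hg : Measurable fun p : Vec q × S => gradF p.1 x p.2) {Ω : Type*}
    {m : ℕ → MeasurableSpace Ω} (hm : Monotone m) {ζ : ℕ → Ω → S}
    (hζ : ∀ t, Measurable[m (t + 1)] (ζ t)) (t : ℕ) :
    Measurable[m t] fun ω => sgd Θ gradF γ θ₀ x (fun s => ζ s ω) t := by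
  induction t with
  | zero => exact measurable_const
  | succ t ih =>
    have h1 : Measurable[m (t + 1)] fun ω => sgd Θ gradF γ θ₀ x (fun s => ζ s ω) t :=
      ih.mono (hm t.le_succ) le_rfl
    have h2 : Measurable[m (t + 1)] fun ω =>
        gradF (sgd Θ gradF γ θ₀ x (fun s => ζ s ω) t) x (ζ t ω) :=
      hg.comp (h1.prodMk (hζ t))
    exact (measurable_proj hc hne hconv).comp (h1.sub (h2.const_smul (γ (t + 1))))

/-- Measurability on path space makes the output of a run a measurable function of its noise path,
which transfers independence of the paths to the outputs. -/
theorem measurable_sgd_path [MeasurableSpace S] (hc : IsCompact Θ) (hne : Θ.Nonempty) (hconv : Convex ℝ Θ)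
    (hg : Measurable fun p : Vec q × S => gradF p.1 x p.2) (t : ℕ) :
    Measurable fun ζ : ℕ → S => sgd Θ gradF γ θ₀ x ζ t :=
  measurable_sgd (m := fun _ => inferInstance) (ζ := fun s (p : ℕ → S) => p s) hc hne hconv hg
    (fun _ _ _ => le_rfl) (fun s => measurable_pi_apply s) t

theorem measurable_prSGD [MeasurableSpace S] (hc : IsCompact Θ) (hne : Θ.Nonempty) (hconv : Convex ℝ Θ)
    (hg : Measurable fun p : Vec q × S => gradF p.1 x p.2) (T : ℕ) :
    Measurable fun ζ : ℕ → S => prSGD Θ gradF γ θ₀ x ζ T := by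
  unfold prSGD
  exact Measurable.const_smul (Finset.measurable_fun_sum _ fun t _ =>
    measurable_sgd_path hc hne hconv hg t) (((T : ℝ) + 1)⁻¹)

theorem prSGD_mem (hc : IsCompact Θ) (hconv : Convex ℝ Θ) (h0 : θ₀ x ∈ Θ) (ζ : ℕ → S) (T : ℕ) :
    prSGD Θ gradF γ θ₀ x ζ T ∈ Θ := by
  unfold prSGD
  rw [Finset.smul_sum]
  refine hconv.sum_mem (fun _ _ => by positivity) ?_ fun t _ => sgd_mem hc h0 ζ t
  rw [Finset.sum_const, Finset.card_range, nsmul_eq_mul]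
  push_cast
  exact mul_inv_cancel₀ (by positivity)

end Iterates

/-! ### Pathwise estimates for one SGD step -/

section Step

variable {q : ℕ} {Θ : Set (Vec q)}

theorem norm_add_sq_le_two_mul (a b : Vec q) : ‖a + b‖ ^ 2 ≤ 2 * ‖a‖ ^ 2 + 2 * ‖b‖ ^ 2 := by
  have h := norm_add_le a b
  have := pow_le_pow_left₀ (norm_nonneg _) h 2
  nlinarith [sq_nonneg (‖a‖ - ‖b‖)]

/-- The squared factor is at most `1 - 2 s μ + s² L² ≤ 1 - s μ ≤ (1 - s μ / 2)²`. This contraction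
drives the bias recursion. -/
theorem norm_sub_smul_linear_le {G : Vec q →L[ℝ] Vec q} {μ L s : ℝ}
    (hG : ∀ v, μ * ‖v‖ ^ 2 ≤ inner ℝ (G v) v) (hL : ∀ v, ‖G v‖ ≤ L * ‖v‖)
    (hs : 0 ≤ s) (hsL : s * L ^ 2 ≤ μ) (hsμ : s * μ ≤ 1) (v : Vec q) :
    ‖v - s • G v‖ ≤ (1 - μ / 2 * s) * ‖v‖ := by
  have h1 : ‖v - s • G v‖ ^ 2 = ‖v‖ ^ 2 - 2 * s * inner ℝ (G v) v + s ^ 2 * ‖G v‖ ^ 2 := by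
    rw [norm_sub_sq_real, inner_smul_right, norm_smul, mul_pow, Real.norm_of_nonneg hs,
      real_inner_comm]
    ring
  have h2 : ‖G v‖ ^ 2 ≤ L ^ 2 * ‖v‖ ^ 2 := by
    rw [← mul_pow]
    exact pow_le_pow_left₀ (norm_nonneg _) (hL v) 2
  refine le_of_sq_le_sq ?_ (mul_nonneg (by linarith) (norm_nonneg _))
  rw [h1]
  have h3 := mul_le_mul_of_nonneg_left (hG v) (by linarith : 0 ≤ 2 * s)
  have h4 := mul_le_mul_of_nonneg_left h2 (sq_nonneg s)
  have h5 : s ^ 2 * (L ^ 2 * ‖v‖ ^ 2) ≤ s * μ * ‖v‖ ^ 2 := by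
    have : s ^ 2 * (L ^ 2 * ‖v‖ ^ 2) = s * (s * L ^ 2) * ‖v‖ ^ 2 := by ring
    rw [this]
    gcongr
  have h6 : 0 ≤ (μ / 2 * s) ^ 2 * ‖v‖ ^ 2 := by positivity
  nlinarith

theorem norm_proj_step_sq_le (hc : IsCompact Θ) (hconv : Convex ℝ Θ) {θ θs g ξ : Vec q}
    {s μ : ℝ} (hs : 0 ≤ s) (hθs : θs ∈ Θ) (hg : μ * ‖θ - θs‖ ^ 2 ≤ inner ℝ g (θ - θs)) :
    ‖proj Θ (θ - s • (g + ξ)) - θs‖ ^ 2 ≤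
      (1 - 2 * μ * s) * ‖θ - θs‖ ^ 2 - 2 * s * inner ℝ (θ - θs) ξ +
        s ^ 2 * (2 * ‖g‖ ^ 2 + 2 * ‖ξ‖ ^ 2) := by
  have h1 := norm_proj_sub_proj_le hc ⟨_, hθs⟩ hconv (θ - s • (g + ξ)) θs
  rw [proj_eq_self hc hθs] at h1
  have h2 := pow_le_pow_left₀ (norm_nonneg _) h1 2
  have e : θ - s • (g + ξ) - θs = (θ - θs) - s • (g + ξ) := by abel
  have h3 : ‖(θ - θs) - s • (g + ξ)‖ ^ 2 = ‖θ - θs‖ ^ 2 - 2 * s * inner ℝ g (θ - θs)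
      - 2 * s * inner ℝ (θ - θs) ξ + s ^ 2 * ‖g + ξ‖ ^ 2 := by
    rw [norm_sub_sq_real, inner_smul_right, inner_add_right, norm_smul, mul_pow,
      Real.norm_of_nonneg hs, real_inner_comm g]
    ring
  rw [e, h3] at h2
  have h4 := mul_le_mul_of_nonneg_left hg (by linarith : 0 ≤ 2 * s)
  have h5 := mul_le_mul_of_nonneg_left (norm_add_sq_le_two_mul g ξ) (sq_nonneg s)
  linarith

/-- The correction made by the projection vanishes unless the iterate or the increment is large. -/
theorem norm_proj_correction_le (hc : IsCompact Θ) {θ θs u : Vec q} {s ρ : ℝ} (hs : 0 ≤ s)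
    (hρ : 0 < ρ) (hθ : θ ∈ Θ) (hball : Metric.closedBall θs ρ ⊆ Θ) :
    ‖proj Θ (θ - s • u) - (θ - s • u)‖ ≤
      2 / ρ * s ^ 2 * ‖u‖ ^ 2 + 2 / ρ ^ 2 * s * (‖θ - θs‖ ^ 2 * (1 + ‖u‖ ^ 2)) := by
  by_cases hz : θ - s • u ∈ Θ
  · rw [proj_eq_self hc hz, sub_self, norm_zero]
    positivity
  have h1 := norm_sub_proj_le hc (θ - s • u) hθ
  rw [norm_sub_rev, sub_sub_cancel_left, norm_neg, norm_smul, Real.norm_of_nonneg hs] at h1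
  refine h1.trans ?_
  have h2 : ρ < ‖θ - s • u - θs‖ := by
    by_contra h
    exact hz (hball (by simpa [dist_eq_norm] using not_lt.1 h))
  have h3 : ‖θ - s • u - θs‖ ≤ ‖θ - θs‖ + s * ‖u‖ := by
    have e : θ - s • u - θs = (θ - θs) - s • u := by abel
    rw [e]
    refine (norm_sub_le _ _).trans ?_
    rw [norm_smul, Real.norm_of_nonneg hs]
  -- A point outside the ball forces one of the two distances to be at least `ρ/2`. Multiplying `s *
  -- ‖u‖` by `2 s ‖u‖ / ρ` or by `4 ‖θ - θs‖² / ρ²`, whichever is at least 1, yields terms whose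
  -- expectations are `O(s²)` once the mean squared error is `O(s)`.
  rcases le_total (ρ / 2) (s * ‖u‖) with h4 | h4
  · refine le_add_of_le_of_nonneg ?_ (by positivity)
    have : 2 / ρ * s ^ 2 * ‖u‖ ^ 2 = (s * ‖u‖ / (ρ / 2)) * (s * ‖u‖) := by
      field_simp
    rw [this]
    exact le_mul_of_one_le_left (by positivity) ((one_le_div (by positivity)).2 h4)
  · refine le_add_of_nonneg_of_le (by positivity) ?_
    have h5 : ρ / 2 ≤ ‖θ - θs‖ := by linarith
    have h6 : (ρ / 2) ^ 2 ≤ ‖θ - θs‖ ^ 2 := pow_le_pow_left₀ (by positivity) h5 2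
    have h7 : 2 * ‖u‖ ≤ 1 + ‖u‖ ^ 2 := by nlinarith [sq_nonneg (1 - ‖u‖)]
    calc s * ‖u‖ ≤ s * ((1 + ‖u‖ ^ 2) / 2) := by gcongr; linarith
      _ = 2 / ρ ^ 2 * s * ((ρ / 2) ^ 2 * (1 + ‖u‖ ^ 2)) := by field_simp
      _ ≤ _ := by gcongr

end Step

/-! ### Expected effect of one SGD step -/

section Noise

variable {q : ℕ} {Ω : Type*} {m mΩ : MeasurableSpace Ω} {P : Measure Ω} [IsProbabilityMeasure P]

/-- The weight is the squared error of the current iterate. Being measurable for the past, it can be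
pulled out of the conditional expectation, so no fourth moment of the noise is needed. -/
theorem integral_mul_norm_sq_le (hm : m ≤ mΩ) {ξ : Ω → Vec q} (hξ : MemLp ξ 2 P) {V : ℝ}
    (hV : ∀ᵐ ω ∂P, (P[fun ω => ‖ξ ω‖ ^ 2 | m]) ω ≤ V) {W : Ω → ℝ} (hW : Measurable[m] W)
    (hW0 : ∀ ω, 0 ≤ W ω) {c : ℝ} (hWc : ∀ ω, W ω ≤ c) :
    Integrable (fun ω => W ω * ‖ξ ω‖ ^ 2) P ∧ ∫ ω, W ω * ‖ξ ω‖ ^ 2 ∂P ≤ V * ∫ ω, W ω ∂P := by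
  have hint : Integrable (fun ω => ‖ξ ω‖ ^ 2) P := hξ.integrable_norm_pow two_ne_zero
  have hWm : AEStronglyMeasurable W P := (hW.mono hm le_rfl).aestronglyMeasurable
  have hbd : ∀ᵐ ω ∂P, ‖W ω‖ ≤ c := ae_of_all _ fun ω => by
    rw [Real.norm_of_nonneg (hW0 ω)]; exact hWc ω
  have h1 : Integrable (fun ω => W ω * ‖ξ ω‖ ^ 2) P := hint.bdd_mul hWm hbd
  refine ⟨h1, ?_⟩
  have h2 : P[W * fun ω => ‖ξ ω‖ ^ 2 | m] =ᵐ[P] W * P[fun ω => ‖ξ ω‖ ^ 2 | m] :=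
    condExp_mul_of_stronglyMeasurable_left hW.stronglyMeasurable h1 hint
  have h3 : ∫ ω, W ω * ‖ξ ω‖ ^ 2 ∂P = ∫ ω, (P[W * fun ω => ‖ξ ω‖ ^ 2 | m]) ω ∂P :=
    (integral_condExp hm).symm
  rw [h3, integral_congr_ae h2, ← integral_const_mul]
  refine integral_mono_ae (integrable_condExp.congr h2)
    ((Integrable.of_bound hWm c hbd).const_mul V) (hV.mono fun ω hω => ?_)
  simp only [Pi.mul_apply]
  rw [mul_comm V]
  exact mul_le_mul_of_nonneg_left hω (hW0 ω)

theorem integral_inner_eq_zero (hm : m ≤ mΩ) {ξ : Ω → Vec q} (hξ : Integrable ξ P)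
    (h0 : P[ξ | m] =ᵐ[P] 0) {v : Ω → Vec q} (hv : Measurable[m] v) {c : ℝ}
    (hvc : ∀ ω, ‖v ω‖ ≤ c) :
    Integrable (fun ω => inner ℝ (v ω) (ξ ω)) P ∧ ∫ ω, inner ℝ (v ω) (ξ ω) ∂P = 0 := by
  have hvm : AEStronglyMeasurable v P := (hv.mono hm le_rfl).aestronglyMeasurable
  have h1 : Integrable (fun ω => inner ℝ (v ω) (ξ ω)) P := by
    refine (hξ.norm.const_mul c).mono' (hvm.inner hξ.1) (ae_of_all _ fun ω => ?_)
    exact (norm_inner_le_norm _ _).trans (mul_le_mul_of_nonneg_right (hvc ω) (norm_nonneg _))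
  refine ⟨h1, ?_⟩
  have h2 := condExp_bilin_of_stronglyMeasurable_left (m := m) (μ := P) (innerSL ℝ)
    hv.stronglyMeasurable h1 hξ
  have h3 : ∫ ω, inner ℝ (v ω) (ξ ω) ∂P
      = ∫ ω, (P[fun ω => innerSL ℝ (v ω) (ξ ω) | m]) ω ∂P := (integral_condExp hm).symm
  rw [h3, integral_congr_ae h2]
  refine integral_eq_zero_of_ae (h0.mono fun ω hω => ?_)
  simp [hω]

theorem integral_eq_zero_of_condExp (hm : m ≤ mΩ) {ξ : Ω → Vec q}
    (h0 : P[ξ | m] =ᵐ[P] 0) : ∫ ω, ξ ω ∂P = 0 := by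
  rw [← integral_condExp hm, integral_congr_ae h0]
  simp

theorem integral_const_add_two_mul {φ : Ω → ℝ} (hφ : Integrable φ P) (a : ℝ) :
    ∫ ω, (a + 2 * φ ω) ∂P = a + 2 * ∫ ω, φ ω ∂P := by
  rw [integral_add (integrable_const _) (hφ.const_mul 2), integral_const_mul]
  simp

variable {Θ : Set (Vec q)}

theorem integral_norm_proj_step_sq_le (hm : m ≤ mΩ) (hc : IsCompact Θ) (hconv : Convex ℝ Θ)
    {θs : Vec q} (hθs : θs ∈ Θ) {θ g ξ : Ω → Vec q} {s μ V c C : ℝ} (hs : 0 ≤ s)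
    (hθ : Measurable[m] θ) (hθb : ∀ ω, ‖θ ω - θs‖ ≤ c) (hgC : ∀ ω, ‖g ω‖ ≤ C)
    (hg : ∀ ω, μ * ‖θ ω - θs‖ ^ 2 ≤ inner ℝ (g ω) (θ ω - θs))
    (hξ : MemLp ξ 2 P) (h0 : P[ξ | m] =ᵐ[P] 0)
    (hV : ∀ᵐ ω ∂P, (P[fun ω => ‖ξ ω‖ ^ 2 | m]) ω ≤ V) :
    ∫ ω, ‖proj Θ (θ ω - s • (g ω + ξ ω)) - θs‖ ^ 2 ∂P ≤
      (1 - 2 * μ * s) * ∫ ω, ‖θ ω - θs‖ ^ 2 ∂P + (2 * C ^ 2 + 2 * V) * s ^ 2 := by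
  have hΔ : Measurable[m] fun ω => θ ω - θs := hθ.sub_const θs
  obtain ⟨hi1, he1⟩ := integral_inner_eq_zero hm (hξ.integrable one_le_two) h0 hΔ hθb
  have hi2 : Integrable (fun ω => ‖ξ ω‖ ^ 2) P := hξ.integrable_norm_pow two_ne_zero
  have he2 : ∫ ω, ‖ξ ω‖ ^ 2 ∂P ≤ V := by
    have := (integral_mul_norm_sq_le hm hξ hV (W := fun _ => 1) measurable_const
      (fun _ => zero_le_one) (fun _ => le_refl 1)).2
    simpa using this
  have hi3 : Integrable (fun ω => ‖θ ω - θs‖ ^ 2) P := by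
    refine Integrable.of_bound ((hΔ.mono hm le_rfl).norm.pow_const 2).aestronglyMeasurable (c ^ 2)
      (ae_of_all _ fun ω => ?_)
    rw [Real.norm_of_nonneg (by positivity)]
    exact pow_le_pow_left₀ (norm_nonneg _) (hθb ω) 2
  have hi4 : Integrable (fun ω => (1 - 2 * μ * s) * ‖θ ω - θs‖ ^ 2
      - 2 * s * inner ℝ (θ ω - θs) (ξ ω)) P := (hi3.const_mul _).sub (hi1.const_mul _)
  have hi5 : Integrable (fun ω => s ^ 2 * (2 * C ^ 2 + 2 * ‖ξ ω‖ ^ 2)) P :=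
    ((integrable_const _).add (hi2.const_mul 2)).const_mul _
  calc ∫ ω, ‖proj Θ (θ ω - s • (g ω + ξ ω)) - θs‖ ^ 2 ∂P
      ≤ ∫ ω, (((1 - 2 * μ * s) * ‖θ ω - θs‖ ^ 2 - 2 * s * inner ℝ (θ ω - θs) (ξ ω)) +
        s ^ 2 * (2 * C ^ 2 + 2 * ‖ξ ω‖ ^ 2)) ∂P := by
        refine integral_mono_of_nonneg (ae_of_all _ fun ω => by positivity) (hi4.add hi5)
          (ae_of_all _ fun ω => ?_)
        refine (norm_proj_step_sq_le hc hconv hs hθs (hg ω)).trans ?_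
        have : ‖g ω‖ ^ 2 ≤ C ^ 2 := pow_le_pow_left₀ (norm_nonneg _) (hgC ω) 2
        dsimp only
        gcongr
    _ = (1 - 2 * μ * s) * ∫ ω, ‖θ ω - θs‖ ^ 2 ∂P
        + s ^ 2 * (2 * C ^ 2 + 2 * ∫ ω, ‖ξ ω‖ ^ 2 ∂P) := by
        rw [integral_add hi4 hi5, integral_sub (hi3.const_mul _) (hi1.const_mul _),
          integral_const_mul, integral_const_mul, integral_const_mul, he1,
          integral_const_add_two_mul hi2]
        ring
    _ ≤ _ := by
        have : s ^ 2 * (2 * C ^ 2 + 2 * ∫ ω, ‖ξ ω‖ ^ 2 ∂P) ≤ s ^ 2 * (2 * C ^ 2 + 2 * V) := by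
          gcongr
        linarith

/-- The next mean error is the current one contracted by `1 - s G`, minus `s` times the mean
linearization remainder, plus the mean projection correction; the noise has mean zero. The two error
terms are controlled by the mean squared error and `s²`. -/
theorem norm_integral_proj_step_le (hm : m ≤ mΩ) (hc : IsCompact Θ)
    (hconv : Convex ℝ Θ) {θs : Vec q} (hθs : θs ∈ Θ) {θ g ξ : Ω → Vec q} {s μ L K V c C ρ : ℝ}
    (hs : 0 ≤ s) (hsL : s * L ^ 2 ≤ μ) (hsμ : s * μ ≤ 1) (hρ : 0 < ρ)
    (hball : Metric.closedBall θs ρ ⊆ Θ)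
    (hθ : Measurable[m] θ) (hθΘ : ∀ ω, θ ω ∈ Θ) (hθb : ∀ ω, ‖θ ω - θs‖ ≤ c)
    (hgm : AEStronglyMeasurable g P) (hgC : ∀ ω, ‖g ω‖ ≤ C)
    {G : Vec q →L[ℝ] Vec q} (hG : ∀ v, μ * ‖v‖ ^ 2 ≤ inner ℝ (G v) v)
    (hGL : ∀ v, ‖G v‖ ≤ L * ‖v‖) (hgG : ∀ ω, ‖g ω - G (θ ω - θs)‖ ≤ K * ‖θ ω - θs‖ ^ 2)
    (hξ : MemLp ξ 2 P) (h0 : P[ξ | m] =ᵐ[P] 0)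
    (hV : ∀ᵐ ω ∂P, (P[fun ω => ‖ξ ω‖ ^ 2 | m]) ω ≤ V) :
    ‖∫ ω, (proj Θ (θ ω - s • (g ω + ξ ω)) - θs) ∂P‖ ≤
      (1 - μ / 2 * s) * ‖∫ ω, (θ ω - θs) ∂P‖ +
      (K + 2 / ρ ^ 2 * (1 + 2 * C ^ 2 + 2 * V)) * s * ∫ ω, ‖θ ω - θs‖ ^ 2 ∂P +
      2 / ρ * (2 * C ^ 2 + 2 * V) * s ^ 2 := by
  have hΔ : Measurable[m] fun ω => θ ω - θs := hθ.sub_const θs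
  have hΔm : AEStronglyMeasurable (fun ω => θ ω - θs) P :=
    (hΔ.mono hm le_rfl).aestronglyMeasurable
  have hΔi : Integrable (fun ω => θ ω - θs) P :=
    Integrable.of_bound hΔm c (ae_of_all _ hθb)
  have hξi : Integrable ξ P := hξ.integrable one_le_two
  have hgi : Integrable g P := Integrable.of_bound hgm C (ae_of_all _ hgC)
  have hi2 : Integrable (fun ω => ‖ξ ω‖ ^ 2) P := hξ.integrable_norm_pow two_ne_zero
  have he2 : ∫ ω, ‖ξ ω‖ ^ 2 ∂P ≤ V := by
    have := (integral_mul_norm_sq_le hm hξ hV (W := fun _ => 1) measurable_const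
      (fun _ => zero_le_one) (fun _ => le_refl 1)).2
    simpa using this
  have hsqc : ∀ ω, ‖θ ω - θs‖ ^ 2 ≤ c ^ 2 := fun ω =>
    pow_le_pow_left₀ (norm_nonneg _) (hθb ω) 2
  have hsqm : Measurable[m] fun ω => ‖θ ω - θs‖ ^ 2 :=
    (measurable_norm.pow_const 2).comp hΔ
  have hi3 : Integrable (fun ω => ‖θ ω - θs‖ ^ 2) P := by
    refine Integrable.of_bound (hsqm.mono hm le_rfl).aestronglyMeasurable (c ^ 2)
      (ae_of_all _ fun ω => ?_)
    rw [Real.norm_of_nonneg (by positivity)]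
    exact hsqc ω
  obtain ⟨hi4, he4⟩ := integral_mul_norm_sq_le hm hξ hV hsqm (fun ω => by positivity) hsqc
  set r : Ω → Vec q := fun ω => proj Θ (θ ω - s • (g ω + ξ ω)) - (θ ω - s • (g ω + ξ ω)) with hr
  set bd : Ω → ℝ := fun ω => 2 / ρ * s ^ 2 * (2 * C ^ 2 + 2 * ‖ξ ω‖ ^ 2) +
      2 / ρ ^ 2 * s * ((1 + 2 * C ^ 2) * ‖θ ω - θs‖ ^ 2 + 2 * (‖θ ω - θs‖ ^ 2 * ‖ξ ω‖ ^ 2))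
    with hbd
  have hi5 : Integrable (fun ω => 2 / ρ * s ^ 2 * (2 * C ^ 2 + 2 * ‖ξ ω‖ ^ 2)) P :=
    ((integrable_const _).add (hi2.const_mul 2)).const_mul _
  have hi6 : Integrable (fun ω => 2 / ρ ^ 2 * s * ((1 + 2 * C ^ 2) * ‖θ ω - θs‖ ^ 2
      + 2 * (‖θ ω - θs‖ ^ 2 * ‖ξ ω‖ ^ 2))) P :=
    ((hi3.const_mul _).add (hi4.const_mul 2)).const_mul _
  have hrbd : ∀ ω, ‖r ω‖ ≤ bd ω := fun ω => by
    refine (norm_proj_correction_le hc hs hρ (hθΘ ω) hball).trans ?_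
    have h1 := norm_add_sq_le_two_mul (g ω) (ξ ω)
    have h2 : ‖g ω‖ ^ 2 ≤ C ^ 2 := pow_le_pow_left₀ (norm_nonneg _) (hgC ω) 2
    have h3 : ‖g ω + ξ ω‖ ^ 2 ≤ 2 * C ^ 2 + 2 * ‖ξ ω‖ ^ 2 := by linarith
    have h4 : ‖θ ω - θs‖ ^ 2 * (1 + ‖g ω + ξ ω‖ ^ 2) ≤
        (1 + 2 * C ^ 2) * ‖θ ω - θs‖ ^ 2 + 2 * (‖θ ω - θs‖ ^ 2 * ‖ξ ω‖ ^ 2) := by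
      nlinarith [mul_le_mul_of_nonneg_left h3 (sq_nonneg ‖θ ω - θs‖)]
    simp only [hbd]
    gcongr
  have hrm : AEStronglyMeasurable r P := by
    have h1 : AEStronglyMeasurable (fun ω => θ ω - s • (g ω + ξ ω)) P :=
      (hθ.mono hm le_rfl).aestronglyMeasurable.sub ((hgm.add hξ.1).const_smul s)
    refine AEStronglyMeasurable.sub ?_ h1
    exact ((measurable_proj hc ⟨_, hθs⟩ hconv).comp_aemeasurable h1.aemeasurable).aestronglyMeasurable
  have hri : Integrable r P := (hi5.add hi6).mono' hrm (ae_of_all _ hrbd)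
  have hrI : ‖∫ ω, r ω ∂P‖ ≤ 2 / ρ * s ^ 2 * (2 * C ^ 2 + 2 * V) +
      2 / ρ ^ 2 * s * ((1 + 2 * C ^ 2 + 2 * V) * ∫ ω, ‖θ ω - θs‖ ^ 2 ∂P) := by
    refine (norm_integral_le_of_norm_le (hi5.add hi6) (ae_of_all _ hrbd)).trans ?_
    rw [integral_add' hi5 hi6, integral_const_mul, integral_const_mul,
      integral_const_add_two_mul hi2,
      integral_add (hi3.const_mul _) (hi4.const_mul 2), integral_const_mul, integral_const_mul]
    have e : (1 + 2 * C ^ 2 + 2 * V) * ∫ ω, ‖θ ω - θs‖ ^ 2 ∂P =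
      (1 + 2 * C ^ 2) * ∫ ω, ‖θ ω - θs‖ ^ 2 ∂P + 2 * (V * ∫ ω, ‖θ ω - θs‖ ^ 2 ∂P) := by ring
    rw [e]
    gcongr
  have hGi : Integrable (fun ω => G (θ ω - θs)) P := G.integrable_comp hΔi
  have hGe : ∫ ω, G (θ ω - θs) ∂P = G (∫ ω, (θ ω - θs) ∂P) := G.integral_comp_comm hΔi
  have hnl : ‖∫ ω, (g ω - G (θ ω - θs)) ∂P‖ ≤ K * ∫ ω, ‖θ ω - θs‖ ^ 2 ∂P := by
    rw [← integral_const_mul]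
    exact norm_integral_le_of_norm_le (hi3.const_mul K) (ae_of_all _ hgG)
  have hsplit : ∫ ω, (proj Θ (θ ω - s • (g ω + ξ ω)) - θs) ∂P =
      ((∫ ω, (θ ω - θs) ∂P) - s • G (∫ ω, (θ ω - θs) ∂P)) -
      s • (∫ ω, (g ω - G (θ ω - θs)) ∂P) + ∫ ω, r ω ∂P := by
    have e : (fun ω => proj Θ (θ ω - s • (g ω + ξ ω)) - θs) = fun ω =>
        (((θ ω - θs) - s • G (θ ω - θs)) - s • (g ω - G (θ ω - θs)) - s • ξ ω) + r ω := by
      funext ω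
      simp only [hr, smul_sub, smul_add]
      abel
    have i1 : Integrable (fun ω => s • G (θ ω - θs)) P := hGi.smul s
    have i2 : Integrable (fun ω => θ ω - θs - s • G (θ ω - θs)) P := hΔi.sub i1
    have i3 : Integrable (fun ω => s • (g ω - G (θ ω - θs))) P := (hgi.sub hGi).smul s
    have i4 : Integrable (fun ω => θ ω - θs - s • G (θ ω - θs) - s • (g ω - G (θ ω - θs))) P :=
      i2.sub i3
    have i5 : Integrable (fun ω => s • ξ ω) P := hξi.smul s
    have i6 : Integrable (fun ω => θ ω - θs - s • G (θ ω - θs) - s • (g ω - G (θ ω - θs))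
      - s • ξ ω) P := i4.sub i5
    rw [e, integral_add i6 hri, integral_sub i4 i5, integral_sub i2 i3,
      integral_sub hΔi i1, integral_smul, integral_smul, integral_smul, hGe,
      integral_eq_zero_of_condExp hm h0, smul_zero, sub_zero]
  rw [hsplit]
  have h1 := norm_sub_smul_linear_le hG hGL hs hsL hsμ (∫ ω, (θ ω - θs) ∂P)
  have h2 : ‖s • (∫ ω, (g ω - G (θ ω - θs)) ∂P)‖ ≤ s * (K * ∫ ω, ‖θ ω - θs‖ ^ 2 ∂P) := by
    rw [norm_smul, Real.norm_of_nonneg hs]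
    gcongr
  have h3 := norm_add_le (((∫ ω, (θ ω - θs) ∂P) - s • G (∫ ω, (θ ω - θs) ∂P)) -
      s • (∫ ω, (g ω - G (θ ω - θs)) ∂P)) (∫ ω, r ω ∂P)
  have h4 := norm_sub_le ((∫ ω, (θ ω - θs) ∂P) - s • G (∫ ω, (θ ω - θs) ∂P))
      (s • (∫ ω, (g ω - G (θ ω - θs)) ∂P))
  linarith

end Noise

/-! ### Recursions and sums driven by the step sizes -/

namespace IsStepSize

variable {γ : ℕ → ℝ}

theorem tendsto_zero (hγ : IsStepSize γ) : Tendsto γ atTop (𝓝 0) := by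
  refine hγ.order.1.trans_tendsto ?_
  have h : Tendsto (fun x : ℝ => Real.log x / x) atTop (𝓝 0) :=
    Real.isLittleO_log_id_atTop.tendsto_div_nhds_zero
  exact h.comp tendsto_natCast_atTop_atTop

theorem eventually_abs_sub_le (hγ : IsStepSize γ) {ε : ℝ} (hε : 0 < ε) :
    ∀ᶠ t in atTop, |γ t - γ (t + 1)| ≤ ε * γ t ^ 2 := by
  filter_upwards [hγ.slow.def hε, eventually_ge_atTop 1] with t h1 h2
  have hp := hγ.pos t h2
  rw [Real.norm_eq_abs, abs_div, Real.norm_of_nonneg hp.le, abs_of_pos hp, div_le_iff₀ hp] at h1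
  linarith

theorem eventually_comparable (hγ : IsStepSize γ) :
    ∀ᶠ t in atTop, γ t ≤ 2 * γ (t + 1) ∧ γ (t + 1) ≤ 2 * γ t := by
  filter_upwards [hγ.eventually_abs_sub_le one_half_pos, eventually_ge_atTop 1,
    hγ.tendsto_zero.eventually_le_const one_pos] with t h1 h2 h3
  have hp := hγ.pos t h2
  rw [abs_le] at h1
  constructor <;> nlinarith

/-- Induction on `a t ≤ M * γ t`. The contraction gains `M μ γ_t γ_{t+1}`; slow variation of the
steps uses up half of it through `M (γ_t - γ_{t+1})`, and `M ≥ 4 C / μ` lets the other half absorb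
`C γ_{t+1}²`. The summand `D / γ t₁` starts the induction. `M` and `t₁` precede `a`, so they serve
all runs at once. -/
theorem exists_forall_le_mul (hγ : IsStepSize γ) {μ C D : ℝ} (hμ : 0 < μ) (hC : 0 ≤ C)
    (hD : 0 ≤ D) (t₀ : ℕ) : ∃ M : ℝ, 0 ≤ M ∧ ∃ t₁ : ℕ, ∀ a : ℕ → ℝ, (∀ t, a t ≤ D) →
      (∀ t, t₀ ≤ t → a (t + 1) ≤ (1 - μ * γ (t + 1)) * a t + C * γ (t + 1) ^ 2) →
      ∀ t, t₁ ≤ t → a t ≤ M * γ t := by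
  have hsmall : ∀ᶠ t in atTop, μ * γ (t + 1) ≤ 1 := by
    have h : Tendsto (fun t => μ * γ (t + 1)) atTop (𝓝 (μ * 0)) :=
      ((tendsto_add_atTop_iff_nat 1).2 hγ.tendsto_zero).const_mul μ
    rw [mul_zero] at h
    exact h.eventually_le_const one_pos
  obtain ⟨t₁, ht₁⟩ := eventually_atTop.1 ((((hγ.eventually_abs_sub_le
    (show 0 < μ / 4 by positivity)).and hγ.eventually_comparable).and hsmall).and
    ((eventually_ge_atTop t₀).and (eventually_ge_atTop 1)))
  have hγ₁ : 0 < γ t₁ := hγ.pos _ (ht₁ t₁ le_rfl).2.2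
  refine ⟨4 * C / μ + D / γ t₁, by positivity, t₁, fun a haD hrec t ht => ?_⟩
  have hM : 4 * C / μ ≤ 4 * C / μ + D / γ t₁ := le_add_of_nonneg_right (by positivity)
  have hM' : D / γ t₁ ≤ 4 * C / μ + D / γ t₁ := le_add_of_nonneg_left (by positivity)
  generalize 4 * C / μ + D / γ t₁ = M at hM hM'
  rw [div_le_iff₀ hμ] at hM
  rw [div_le_iff₀ hγ₁] at hM'
  induction t, ht using Nat.le_induction with
  | base => exact (haD _).trans hM'
  | succ t ht ih =>
    obtain ⟨⟨⟨h1, h2, h3⟩, h4⟩, h5, h6⟩ := ht₁ t ht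
    have hp := hγ.pos t h6
    have hp' := hγ.pos (t + 1) (by omega)
    have hr := hrec t h5
    have h7 : (1 - μ * γ (t + 1)) * a t ≤ (1 - μ * γ (t + 1)) * (M * γ t) :=
      mul_le_mul_of_nonneg_left ih (by linarith)
    have hM0 : 0 ≤ M := by nlinarith
    have h8 : M * (γ t - γ (t + 1)) ≤ M * (μ / 4 * γ t ^ 2) :=
      mul_le_mul_of_nonneg_left ((le_abs_self _).trans h1) hM0
    have h9 : γ t ^ 2 ≤ 2 * (γ t * γ (t + 1)) := by nlinarith
    have h10 : γ (t + 1) ^ 2 ≤ 2 * (γ t * γ (t + 1)) := by nlinarith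
    have h11 : M * (μ / 4 * γ t ^ 2) ≤ M * (μ / 4 * (2 * (γ t * γ (t + 1)))) := by gcongr
    have h12 : C * γ (t + 1) ^ 2 ≤ C * (2 * (γ t * γ (t + 1))) := by gcongr
    have h13 : 4 * C * (γ t * γ (t + 1)) ≤ M * μ * (γ t * γ (t + 1)) := by gcongr
    linarith

theorem sum_range_inv_le (T : ℕ) :
    ∑ t ∈ Finset.range (T + 1), ((t : ℝ))⁻¹ ≤ 1 + Real.log T := by
  -- The term `t = 0` is `0⁻¹ = 0`, so the rest is the harmonic sum.
  rw [Finset.sum_range_succ']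
  have h := harmonic_le_one_add_log T
  rw [harmonic] at h
  push_cast at h ⊢
  simpa using h

theorem exists_sum_le (hγ : IsStepSize γ) {M D : ℝ} (hM : 0 ≤ M) (hD : 0 ≤ D) (t₁ : ℕ) :
    ∃ C : ℝ, 0 ≤ C ∧ ∃ T₀ : ℕ, ∀ a : ℕ → ℝ, (∀ t, a t ≤ D) → (∀ t, t₁ ≤ t → a t ≤ M * γ t) →
      ∀ T, T₀ ≤ T → ∑ t ∈ Finset.range (T + 1), a t ≤ C * Real.log T ^ 2 := by
  obtain ⟨c, hc, h⟩ := hγ.order.1.exists_pos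
  obtain ⟨t₂, ht₂⟩ := eventually_atTop.1 h.bound
  -- The early terms cost at most `D` each; the later ones are at most `M c log T / t`, with
  -- harmonic sum at most `1 + log T`. The threshold 3 ensures `log T ≥ 1`, so everything fits under
  -- `(log T)²`.
  refine ⟨(max t₁ t₂ + 1 : ℕ) * D + 2 * (M * c), by positivity, 3, fun a haD ha T hT => ?_⟩
  have hlog : 1 ≤ Real.log T := by
    rw [Real.le_log_iff_exp_le (by positivity)]
    have : (3 : ℝ) ≤ T := by exact_mod_cast hT
    linarith [Real.exp_one_lt_d9]
  have hterm : ∀ t ∈ Finset.range (T + 1), a t ≤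
      (if t < max t₁ t₂ + 1 then D else 0) + M * c * Real.log T * ((t : ℝ))⁻¹ := fun t ht => by
    split_ifs with h1
    · exact (haD t).trans (le_add_of_nonneg_right (by positivity))
    · have h2 : t₁ ≤ t := by omega
      have h3 : t₂ ≤ t := by omega
      have h4 : (1 : ℝ) ≤ t := by exact_mod_cast (show 1 ≤ t by omega)
      have h5 : γ t ≤ c * (Real.log T / t) := by
        refine (le_abs_self _).trans ((ht₂ t h3).trans ?_)
        have h6 : 0 ≤ Real.log t := Real.log_nonneg h4
        rw [Real.norm_of_nonneg (by positivity)]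
        have h7 : (t : ℝ) ≤ T := by exact_mod_cast Finset.mem_range_succ_iff.1 ht
        gcongr
      calc a t ≤ M * γ t := ha t h2
        _ ≤ M * (c * (Real.log T / t)) := by gcongr
        _ = 0 + M * c * Real.log T * (t : ℝ)⁻¹ := by ring
  refine (Finset.sum_le_sum hterm).trans ?_
  rw [Finset.sum_add_distrib, ← Finset.mul_sum, ← Finset.sum_filter, Finset.sum_const,
    nsmul_eq_mul]
  have hcard : ((((Finset.range (T + 1)).filter fun t => t < max t₁ t₂ + 1).card : ℕ) : ℝ)
      ≤ ((max t₁ t₂ + 1 : ℕ) : ℝ) := by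
    have : (Finset.range (T + 1)).filter (fun t => t < max t₁ t₂ + 1) ⊆
        Finset.range (max t₁ t₂ + 1) := fun t ht => by simpa using (Finset.mem_filter.1 ht).2
    have := Finset.card_le_card this
    rw [Finset.card_range] at this
    exact_mod_cast this
  have hsum := sum_range_inv_le T
  have h1 : M * c * Real.log T * ∑ t ∈ Finset.range (T + 1), ((t : ℝ))⁻¹ ≤
      M * c * Real.log T * (2 * Real.log T) := by
    gcongr
    linarith
  have h2 : 1 ≤ Real.log T ^ 2 := one_le_pow₀ hlog
  have h3 := mul_le_mul_of_nonneg_right hcard hD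
  have h4 : ((max t₁ t₂ + 1 : ℕ) : ℝ) * D ≤ ((max t₁ t₂ + 1 : ℕ) : ℝ) * D * Real.log T ^ 2 :=
    le_mul_of_one_le_right (by positivity) h2
  rw [add_mul]
  nlinarith

end IsStepSize

/-! ### The Polyak–Ruppert average in terms of the iterates -/

section Average

variable {d q : ℕ} {S Ω : Type*} {Θ : Set (Vec q)} {f : Vec q → Vec d → ℝ}
  {gradF : Vec q → Vec d → S → Vec q} {γ : ℕ → ℝ} {θ₀ : Vec d → Vec q}

theorem sgd_succ_eq_noise (x : Vec d) (ζ : ℕ → Ω → S) (t : ℕ) (ω : Ω) :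
    sgd Θ gradF γ θ₀ x (fun s => ζ s ω) (t + 1) =
      proj Θ (sgd Θ gradF γ θ₀ x (fun s => ζ s ω) t - γ (t + 1) •
        (gradθ Θ f x (sgd Θ gradF γ θ₀ x (fun s => ζ s ω) t) +
          noise Θ f gradF γ θ₀ x ζ t ω)) := by
  rw [noise, add_sub_cancel]
  rfl

theorem prSGD_sub (x : Vec d) (ζ : ℕ → S) (T : ℕ) (v : Vec q) :
    prSGD Θ gradF γ θ₀ x ζ T - v =
      ((T : ℝ) + 1)⁻¹ • ∑ t ∈ Finset.range (T + 1), (sgd Θ gradF γ θ₀ x ζ t - v) := by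
  rw [prSGD, Finset.sum_sub_distrib, smul_sub, Finset.sum_const, Finset.card_range,
    ← Nat.cast_smul_eq_nsmul ℝ, smul_smul]
  push_cast
  rw [inv_mul_cancel₀ (by positivity), one_smul]

theorem norm_smul_sum_sq_le (T : ℕ) (v : ℕ → Vec q) :
    ‖((T : ℝ) + 1)⁻¹ • ∑ t ∈ Finset.range (T + 1), v t‖ ^ 2 ≤
      ((T : ℝ) + 1)⁻¹ * ∑ t ∈ Finset.range (T + 1), ‖v t‖ ^ 2 := by
  have hT : (0 : ℝ) < (T : ℝ) + 1 := by positivity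
  have h1 := norm_sum_le (Finset.range (T + 1)) v
  have h2 := sq_sum_le_card_mul_sum_sq (s := Finset.range (T + 1)) (f := fun t => ‖v t‖)
  rw [Finset.card_range] at h2
  push_cast at h2
  have h3 := (pow_le_pow_left₀ (norm_nonneg _) h1 2).trans h2
  rw [norm_smul, mul_pow, norm_inv, Real.norm_of_nonneg hT.le, pow_two, mul_assoc]
  refine mul_le_mul_of_nonneg_left ?_ (by positivity)
  rwa [inv_mul_le_iff₀ hT]

end Average

/-! ### Error and bias of a single run -/

section Run

variable {d q : ℕ} {S : Type*} [MeasurableSpace S] {Ω : Type*} [mΩ : MeasurableSpace Ω]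
  {P : Measure Ω} [IsProbabilityMeasure P] {Θ : Set (Vec q)} {X : Set (Vec d)}
  {f : Vec q → Vec d → ℝ} {gradF : Vec q → Vec d → S → Vec q} {γ : ℕ → ℝ} {θ₀ : Vec d → Vec q}
  {K₂ : ℝ} {μ L K ρ B : ℝ}

theorem norm_sub_optSol_le (hp : IsRegularProblem Θ X f) (hu : UniformRegularity Θ X f μ L K ρ B)
    {x : Vec d} (hx : x ∈ X) {θ : Vec q} (hθ : θ ∈ Θ) : ‖θ - optSol Θ f x‖ ≤ 2 * B := by
  have h1 := norm_sub_le θ (optSol Θ f x)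
  have h2 := hu.norm_le θ hθ
  have h3 := hu.norm_le _ (hp.optSol_mem hx)
  linarith

/-- The constants involve only the uniform ones and `K₂`, so the recursions are the same for every
covariate and every run. The absolute value `|K₂|` keeps them nonnegative whatever the sign of `K₂`.
-/
theorem run_recursion (hp : IsRegularProblem Θ X f) (hu : UniformRegularity Θ X f μ L K ρ B)
    (hγ : IsStepSize γ) (hθ₀ : ∀ x ∈ X, θ₀ x ∈ Θ) {x : Vec d} (hx : x ∈ X)
    (hg : Measurable fun p : Vec q × S => gradF p.1 x p.2) {ζ : ℕ → Ω → S}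
    (hζ : IsMartingaleNoise P Θ f gradF γ θ₀ K₂ x ζ) (t : ℕ) :
    ∫ ω, ‖sgd Θ gradF γ θ₀ x (fun s => ζ s ω) (t + 1) - optSol Θ f x‖ ^ 2 ∂P ≤
      (1 - 2 * μ * γ (t + 1)) *
        ∫ ω, ‖sgd Θ gradF γ θ₀ x (fun s => ζ s ω) t - optSol Θ f x‖ ^ 2 ∂P +
      (2 * (L * (2 * B)) ^ 2 + 2 * (|K₂| * (1 + B ^ 2))) * γ (t + 1) ^ 2 ∧
    (γ (t + 1) * L ^ 2 ≤ μ → γ (t + 1) * μ ≤ 1 →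
      ‖∫ ω, (sgd Θ gradF γ θ₀ x (fun s => ζ s ω) (t + 1) - optSol Θ f x) ∂P‖ ≤
      (1 - μ / 2 * γ (t + 1)) *
        ‖∫ ω, (sgd Θ gradF γ θ₀ x (fun s => ζ s ω) t - optSol Θ f x) ∂P‖ +
      (K + 2 / ρ ^ 2 * (1 + 2 * (L * (2 * B)) ^ 2 + 2 * (|K₂| * (1 + B ^ 2)))) * γ (t + 1) *
        ∫ ω, ‖sgd Θ gradF γ θ₀ x (fun s => ζ s ω) t - optSol Θ f x‖ ^ 2 ∂P +
      2 / ρ * (2 * (L * (2 * B)) ^ 2 + 2 * (|K₂| * (1 + B ^ 2))) * γ (t + 1) ^ 2) := by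
  obtain ⟨ℱ, hℱ⟩ := hζ
  obtain ⟨-, hξ, h0, hV⟩ := hℱ t
  have hs : 0 ≤ γ (t + 1) := (hγ.pos _ (by omega)).le
  have hθ : Measurable[ℱ t] fun ω => sgd Θ gradF γ θ₀ x (fun s => ζ s ω) t :=
    measurable_sgd (m := fun t => ℱ t) hp.compact_feasible hp.nonempty hp.convex_feasible hg
      (fun _ _ h => ℱ.mono h) (fun s => (hℱ s).1) t
  have hmem : ∀ ω, sgd Θ gradF γ θ₀ x (fun s => ζ s ω) t ∈ Θ := fun ω =>
    sgd_mem hp.compact_feasible (hθ₀ x hx) _ t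
  have hb : ∀ ω, ‖sgd Θ gradF γ θ₀ x (fun s => ζ s ω) t - optSol Θ f x‖ ≤ 2 * B := fun ω =>
    norm_sub_optSol_le hp hu hx (hmem ω)
  have hgC : ∀ ω, ‖gradθ Θ f x (sgd Θ gradF γ θ₀ x (fun s => ζ s ω) t)‖ ≤ L * (2 * B) := fun ω =>
    (hu.norm_gradθ_le x hx _ (hmem ω)).trans
      (mul_le_mul_of_nonneg_left (hb ω) hu.lip_pos.le)
  -- Measurability of the true gradient along the run is read off from its being the estimator minus
  -- the noise.
  have hgm : AEStronglyMeasurable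
      (fun ω => gradθ Θ f x (sgd Θ gradF γ θ₀ x (fun s => ζ s ω) t)) P := by
    have h1 : Measurable fun ω => gradF (sgd Θ gradF γ θ₀ x (fun s => ζ s ω) t) x (ζ t ω) :=
      hg.comp ((hθ.mono (ℱ.le t) le_rfl).prodMk ((hℱ t).1.mono (ℱ.le (t + 1)) le_rfl))
    refine (h1.aestronglyMeasurable.sub hξ.1).congr (ae_of_all _ fun ω => ?_)
    simp [noise]
  have hV' : ∀ᵐ ω ∂P, (P[fun ω' => ‖noise Θ f gradF γ θ₀ x ζ t ω'‖ ^ 2 | ℱ t]) ω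
      ≤ |K₂| * (1 + B ^ 2) := hV.mono fun ω hω => by
    have h1 : ‖sgd Θ gradF γ θ₀ x (fun s => ζ s ω) t‖ ^ 2 ≤ B ^ 2 :=
      pow_le_pow_left₀ (norm_nonneg _) (hu.norm_le _ (hmem ω)) 2
    have h2 : K₂ * (1 + ‖sgd Θ gradF γ θ₀ x (fun s => ζ s ω) t‖ ^ 2) ≤ |K₂| * (1 + B ^ 2) :=
      mul_le_mul (le_abs_self _) (by linarith) (by positivity) (abs_nonneg _)
    have h3 : 0 ≤ ‖gradθ Θ f x (sgd Θ gradF γ θ₀ x (fun s => ζ s ω) t)‖ ^ 2 := by positivity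
    linarith
  simp only [sgd_succ_eq_noise (f := f) x ζ t]
  refine ⟨integral_norm_proj_step_sq_le (ℱ.le t) hp.compact_feasible hp.convex_feasible
    (hp.optSol_mem hx) hs hθ hb hgC (fun ω => hu.le_inner_gradθ x hx _ (hmem ω)) hξ h0 hV',
    fun hsL hsμ => ?_⟩
  obtain ⟨G, hG1, hG2, hG3⟩ := hu.exists_linear x hx
  exact norm_integral_proj_step_le (ℱ.le t) hp.compact_feasible hp.convex_feasible
    (hp.optSol_mem hx) hs hsL hsμ hu.rho_pos (hu.closedBall_subset x hx) hθ hmem hb hgm hgC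
    hG1 hG2 (fun ω => hG3 _ (hmem ω)) hξ h0 hV'

/-- The mean squared error and the bias of the SGD iterates are both of the order of the step
size, uniformly over the runs. -/
theorem exists_iterate_bounds (hp : IsRegularProblem Θ X f)
    (hu : UniformRegularity Θ X f μ L K ρ B) (hγ : IsStepSize γ) (hθ₀ : ∀ x ∈ X, θ₀ x ∈ Θ)
    (hg : ∀ x ∈ X, Measurable fun p : Vec q × S => gradF p.1 x p.2) (K₂ : ℝ) :
    ∃ M : ℝ, 0 ≤ M ∧ ∃ t₁ : ℕ, ∀ x ∈ X, ∀ ζ : ℕ → Ω → S,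
      IsMartingaleNoise P Θ f gradF γ θ₀ K₂ x ζ → ∀ t, t₁ ≤ t →
        ∫ ω, ‖sgd Θ gradF γ θ₀ x (fun s => ζ s ω) t - optSol Θ f x‖ ^ 2 ∂P ≤ M * γ t ∧
        ‖∫ ω, (sgd Θ gradF γ θ₀ x (fun s => ζ s ω) t - optSol Θ f x) ∂P‖ ≤ M * γ t := by
  have hB := hu.bound_pos
  have hρ := hu.rho_pos
  have hK := hu.quad_pos
  have hμ := hu.mu_pos
  set V := 2 * (L * (2 * B)) ^ 2 + 2 * (|K₂| * (1 + B ^ 2)) with hV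
  have hV0 : 0 ≤ V := by positivity
  have hbd : ∀ x ∈ X, ∀ ζ : ℕ → Ω → S, ∀ t ω,
      ‖sgd Θ gradF γ θ₀ x (fun s => ζ s ω) t - optSol Θ f x‖ ≤ 2 * B := fun x hx ζ t ω =>
    norm_sub_optSol_le hp hu hx (sgd_mem hp.compact_feasible (hθ₀ x hx) _ t)
  obtain ⟨M₁, hM₁, t₁, h₁⟩ := hγ.exists_forall_le_mul (show 0 < 2 * μ by positivity) hV0
    (show 0 ≤ (2 * B) ^ 2 by positivity) 0
  set A := K + 2 / ρ ^ 2 * (1 + V) with hA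
  have hA0 : 0 ≤ A := by positivity
  have hz : Tendsto (fun t => γ (t + 1)) atTop (𝓝 0) :=
    (tendsto_add_atTop_iff_nat 1).2 hγ.tendsto_zero
  have hz1 : ∀ᶠ t in atTop, γ (t + 1) * L ^ 2 ≤ μ := by
    have := hz.mul_const (L ^ 2)
    rw [zero_mul] at this
    exact this.eventually_le_const hμ
  have hz2 : ∀ᶠ t in atTop, γ (t + 1) * μ ≤ 1 := by
    have := hz.mul_const μ
    rw [zero_mul] at this
    exact this.eventually_le_const one_pos
  obtain ⟨t₂, ht₂⟩ := eventually_atTop.1 (((hz1.and hz2).and hγ.eventually_comparable).and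
    (eventually_ge_atTop t₁))
  -- The squared error is at most `M₁ γ_t ≤ 2 M₁ γ_{t+1}`, so its contribution to the bias recursion
  -- is `2 A M₁ γ_{t+1}²` and the same recursion lemma applies.
  obtain ⟨M₂, hM₂, t₃, h₃⟩ := hγ.exists_forall_le_mul (show 0 < μ / 2 by positivity)
    (show 0 ≤ 2 * A * M₁ + 2 / ρ * V by positivity) (show 0 ≤ 2 * B by positivity) t₂
  refine ⟨max M₁ M₂, le_max_of_le_left hM₁, max (max t₁ t₃) 1, fun x hx ζ hζ => ?_⟩
  have ha : ∀ t, t₁ ≤ t →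
      ∫ ω, ‖sgd Θ gradF γ θ₀ x (fun s => ζ s ω) t - optSol Θ f x‖ ^ 2 ∂P ≤ M₁ * γ t := by
    refine h₁ (fun t => ∫ ω, ‖sgd Θ gradF γ θ₀ x (fun s => ζ s ω) t - optSol Θ f x‖ ^ 2 ∂P)
      (fun t => ?_) fun t _ => (run_recursion hp hu hγ hθ₀ hx (hg x hx) hζ t).1
    refine (Real.le_norm_self _).trans ?_
    refine (norm_integral_le_of_norm_le_const (C := (2 * B) ^ 2)
      (ae_of_all _ fun ω => ?_)).trans (by simp)
    rw [Real.norm_of_nonneg (by positivity)]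
    exact pow_le_pow_left₀ (norm_nonneg _) (hbd x hx ζ t ω) 2
  have hb : ∀ t, t₃ ≤ t →
      ‖∫ ω, (sgd Θ gradF γ θ₀ x (fun s => ζ s ω) t - optSol Θ f x) ∂P‖ ≤ M₂ * γ t := by
    refine h₃ (fun t => ‖∫ ω, (sgd Θ gradF γ θ₀ x (fun s => ζ s ω) t - optSol Θ f x) ∂P‖)
      (fun t => ?_) fun t ht => ?_
    · exact (norm_integral_le_of_norm_le_const (ae_of_all _ fun ω => hbd x hx ζ t ω)).trans
        (by simp)
    · obtain ⟨⟨⟨h4, h5⟩, h6, -⟩, h7⟩ := ht₂ t ht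
      refine ((run_recursion hp hu hγ hθ₀ hx (hg x hx) hζ t).2 h4 h5).trans ?_
      have h8 : 0 < γ (t + 1) := hγ.pos _ (by omega)
      have h9 := ha t h7
      have h10 : M₁ * γ t ≤ M₁ * (2 * γ (t + 1)) := by gcongr
      have h11 : A * γ (t + 1) *
          ∫ ω, ‖sgd Θ gradF γ θ₀ x (fun s => ζ s ω) t - optSol Θ f x‖ ^ 2 ∂P ≤
          A * γ (t + 1) * (M₁ * (2 * γ (t + 1))) := by
        gcongr
        exact h9.trans h10
      have e : K + 2 / ρ ^ 2 * (1 + 2 * (L * (2 * B)) ^ 2 + 2 * (|K₂| * (1 + B ^ 2))) = A := by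
        rw [hA, hV]; ring
      rw [e]
      linarith
  refine fun t ht => ?_
  have hpos : 0 ≤ γ t := (hγ.pos t (by omega)).le
  exact ⟨(ha t (by omega)).trans (mul_le_mul_of_nonneg_right (le_max_left _ _) hpos),
    (hb t (by omega)).trans (mul_le_mul_of_nonneg_right (le_max_right _ _) hpos)⟩

/-- The mean squared error and the bias of the PR-SGD solution are both of the order
`(log T)² / T`, uniformly over the runs. -/
theorem exists_prSGD_bounds (hp : IsRegularProblem Θ X f)
    (hu : UniformRegularity Θ X f μ L K ρ B) (hγ : IsStepSize γ) (hθ₀ : ∀ x ∈ X, θ₀ x ∈ Θ)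
    (hg : ∀ x ∈ X, Measurable fun p : Vec q × S => gradF p.1 x p.2) (K₂ : ℝ) :
    ∃ M : ℝ, 0 ≤ M ∧ ∃ T₀ : ℕ, ∀ x ∈ X, ∀ ζ : ℕ → Ω → S,
      IsMartingaleNoise P Θ f gradF γ θ₀ K₂ x ζ → ∀ T, T₀ ≤ T →
        ∫ ω, ‖prSGD Θ gradF γ θ₀ x (fun s => ζ s ω) T - optSol Θ f x‖ ^ 2 ∂P
          ≤ M * Real.log T ^ 2 / T ∧
        ‖∫ ω, (prSGD Θ gradF γ θ₀ x (fun s => ζ s ω) T - optSol Θ f x) ∂P‖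
          ≤ M * Real.log T ^ 2 / T := by
  have hB := hu.bound_pos
  obtain ⟨M, hM, t₁, h⟩ := exists_iterate_bounds (P := P) (gradF := gradF) hp hu hγ hθ₀ hg K₂
  obtain ⟨C, hC, T₀, hsum⟩ := hγ.exists_sum_le hM
    (show 0 ≤ max ((2 * B) ^ 2) (2 * B) by positivity) t₁
  refine ⟨C, hC, max T₀ 1, fun x hx ζ hζ T hT => ?_⟩
  have hbd : ∀ t ω, ‖sgd Θ gradF γ θ₀ x (fun s => ζ s ω) t - optSol Θ f x‖ ≤ 2 * B := fun t ω =>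
    norm_sub_optSol_le hp hu hx (sgd_mem hp.compact_feasible (hθ₀ x hx) _ t)
  have hsqb : ∀ t ω, ‖sgd Θ gradF γ θ₀ x (fun s => ζ s ω) t - optSol Θ f x‖ ^ 2 ≤ (2 * B) ^ 2 :=
    fun t ω => pow_le_pow_left₀ (norm_nonneg _) (hbd t ω) 2
  have hmeas : ∀ t, Measurable fun ω => sgd Θ gradF γ θ₀ x (fun s => ζ s ω) t := fun t => by
    obtain ⟨ℱ, hℱ⟩ := hζ
    exact measurable_sgd (m := fun _ => mΩ) hp.compact_feasible hp.nonempty hp.convex_feasible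
      (hg x hx) monotone_const (fun s => (hℱ s).1.mono (ℱ.le _) le_rfl) t
  have hi1 : ∀ t, Integrable (fun ω => sgd Θ gradF γ θ₀ x (fun s => ζ s ω) t - optSol Θ f x) P :=
    fun t => Integrable.of_bound ((hmeas t).sub_const _).aestronglyMeasurable (2 * B)
      (ae_of_all _ (hbd t))
  have hi2 : ∀ t, Integrable
      (fun ω => ‖sgd Θ gradF γ θ₀ x (fun s => ζ s ω) t - optSol Θ f x‖ ^ 2) P := fun t => by
    refine Integrable.of_bound (((hmeas t).sub_const _).norm.pow_const 2).aestronglyMeasurable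
      ((2 * B) ^ 2) (ae_of_all _ fun ω => ?_)
    rw [Real.norm_of_nonneg (by positivity)]
    exact hsqb t ω
  have hT1 : (1 : ℝ) ≤ T := by exact_mod_cast (le_max_right _ _).trans hT
  have hfin : ∀ {s : ℝ}, 0 ≤ s → s ≤ C * Real.log T ^ 2 →
      ((T : ℝ) + 1)⁻¹ * s ≤ C * Real.log T ^ 2 / T := fun {s} hs0 hs => by
    rw [inv_mul_eq_div]
    exact div_le_div₀ (by positivity) hs (by positivity) (by linarith)
  have hs1 : ∑ t ∈ Finset.range (T + 1),
      ∫ ω, ‖sgd Θ gradF γ θ₀ x (fun s => ζ s ω) t - optSol Θ f x‖ ^ 2 ∂P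
        ≤ C * Real.log T ^ 2 := by
    refine hsum (fun t => ∫ ω, ‖sgd Θ gradF γ θ₀ x (fun s => ζ s ω) t - optSol Θ f x‖ ^ 2 ∂P)
      (fun t => ?_) (fun t ht => (h x hx ζ hζ t ht).1) T ((le_max_left _ _).trans hT)
    refine le_max_of_le_left ((integral_mono (hi2 t) (integrable_const _) (hsqb t)).trans ?_)
    simp
  have hs2 : ∑ t ∈ Finset.range (T + 1),
      ‖∫ ω, (sgd Θ gradF γ θ₀ x (fun s => ζ s ω) t - optSol Θ f x) ∂P‖
        ≤ C * Real.log T ^ 2 := by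
    refine hsum (fun t => ‖∫ ω, (sgd Θ gradF γ θ₀ x (fun s => ζ s ω) t - optSol Θ f x) ∂P‖)
      (fun t => ?_) (fun t ht => (h x hx ζ hζ t ht).2) T ((le_max_left _ _).trans hT)
    exact le_max_of_le_right ((norm_integral_le_of_norm_le_const (ae_of_all _ (hbd t))).trans
      (by simp))
  simp only [prSGD_sub]
  constructor
  · refine le_trans ?_ (hfin (Finset.sum_nonneg fun t _ => integral_nonneg fun ω => by positivity)
      hs1)
    rw [← integral_finsetSum _ fun t _ => hi2 t, ← integral_const_mul]
    exact integral_mono_of_nonneg (ae_of_all _ fun ω => by positivity)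
      ((integrable_finsetSum _ fun t _ => hi2 t).const_mul _)
      (ae_of_all _ fun ω => norm_smul_sum_sq_le T _)
  · refine le_trans ?_ (hfin (Finset.sum_nonneg fun t _ => norm_nonneg _) hs2)
    rw [integral_smul, integral_finsetSum _ fun t _ => hi1 t, norm_smul, norm_inv,
      Real.norm_of_nonneg (by positivity)]
    gcongr
    exact norm_sum_le _ _

end Run

/-! ### Counting design points in a kernel window -/

section DesignCount

variable {d : ℕ} {X : Set (Vec d)}

/-- The design points that the sphere kernel with bandwidth `h` uses at `x`. -/
def neighbors {n : ℕ} (pts : Fin n → Vec d) (h : ℝ) (x : Vec d) : Finset (Fin n) :=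
  Finset.univ.filter fun i => ‖x - pts i‖ ≤ h

theorem mem_neighbors {n : ℕ} {pts : Fin n → Vec d} {h : ℝ} {x : Vec d} {i : Fin n} :
    i ∈ neighbors pts h x ↔ ‖x - pts i‖ ≤ h := by
  simp [neighbors]

theorem scaledKernel_eq {h : ℝ} (hh : 0 < h) (u : Vec d) :
    scaledKernel h u = (1 / h ^ d) * if ‖u‖ ≤ h then 1 else 0 := by
  have : ‖h⁻¹ • u‖ ≤ 1 ↔ ‖u‖ ≤ h := by
    rw [norm_smul, norm_inv, Real.norm_of_nonneg hh.le, inv_mul_le_iff₀ hh, mul_one]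
  simp only [scaledKernel, sphereKernel, this]

theorem nadarayaWatson_eq {n q : ℕ} {h : ℝ} (hh : 0 < h) (pts : Fin n → Vec d)
    (y : Fin n → Vec q) (x : Vec d) :
    nadarayaWatson h pts y x =
      ((neighbors pts h x).card : ℝ)⁻¹ • ∑ i ∈ neighbors pts h x, y i := by
  have hp : (1 / h ^ d : ℝ) ≠ 0 := by positivity
  simp only [nadarayaWatson, scaledKernel_eq hh, mul_ite, mul_one, mul_zero, ite_smul, zero_smul]
  rw [← Finset.sum_filter, ← Finset.sum_filter, ← Finset.smul_sum, Finset.sum_const, smul_smul,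
    nsmul_eq_mul, mul_inv, inv_mul_cancel_right₀ hp]
  rfl

/-- A fixed ball inside `X` is shrunk towards `x` by the factor `l * h`: convexity keeps the image
in `X`, and `l` is small enough to keep it within `h / 2` of `x`. This covers boundary covariates
too. -/
theorem exists_closedBall_subset_inter (hc : IsCompact X) (hconv : Convex ℝ X)
    (hi : (interior X).Nonempty) : ∃ c : ℝ, 0 < c ∧ ∀ x ∈ X, ∀ h : ℝ, 0 < h → h ≤ 1 →
      ∃ z, Metric.closedBall z (c * h) ⊆ X ∩ Metric.closedBall x (h / 2) := by
  obtain ⟨p, hp⟩ := hi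
  obtain ⟨r, hr, hball⟩ := Metric.nhds_basis_closedBall.mem_iff.1 (mem_interior_iff_mem_nhds.1 hp)
  obtain ⟨D, hD, hXD⟩ := hc.isBounded.exists_pos_norm_le
  have hpD : ‖p‖ ≤ D := hXD _ (interior_subset hp)
  set l := 1 / (2 * (2 * D + r) + 1) with hl
  have hl0 : 0 < l := by positivity
  have hl1 : l ≤ 1 := by
    rw [hl, div_le_one (by positivity)]
    linarith
  have hlD : l * (2 * D + r) ≤ 1 / 2 := by
    rw [hl, div_mul_eq_mul_div, div_le_div_iff₀ (by positivity) two_pos]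
    linarith
  refine ⟨l * r, by positivity, fun x hx h hh hh1 => ⟨x + (l * h) • (p - x), fun y hy => ?_⟩⟩
  have hlh : 0 < l * h := by positivity
  set w := y - (x + (l * h) • (p - x)) with hw
  have hwn : ‖w‖ ≤ l * r * h := by rwa [Metric.mem_closedBall, dist_eq_norm] at hy
  have hq : p + (l * h)⁻¹ • w ∈ X := by
    refine hball ?_
    rw [Metric.mem_closedBall, dist_eq_norm, add_sub_cancel_left, norm_smul, norm_inv,
      Real.norm_of_nonneg hlh.le, inv_mul_le_iff₀ hlh]
    linarith
  have hy1 : y = x + (l * h) • ((p + (l * h)⁻¹ • w) - x) := by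
    rw [add_sub_right_comm, smul_add, smul_inv_smul₀ hlh.ne', hw]
    abel
  constructor
  · rw [hy1]
    exact hconv.add_smul_sub_mem hx hq ⟨hlh.le, mul_le_one₀ hl1 hh.le hh1⟩
  · have hy2 : y - x = (l * h) • (p - x) + w := by rw [hw]; abel
    rw [Metric.mem_closedBall, dist_eq_norm, hy2]
    refine (norm_add_le _ _).trans ?_
    rw [norm_smul, Real.norm_of_nonneg hlh.le]
    have h1 : ‖p - x‖ ≤ 2 * D := (norm_sub_le _ _).trans (by linarith [hXD x hx])
    have h2 : l * h * ‖p - x‖ ≤ l * h * (2 * D) := by gcongr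
    nlinarith

theorem pow_le_card_mul_pow_of_cover {ι : Type*} {I : Finset ι} {p : ι → Vec d} {z : Vec d}
    {r η : ℝ} (hr : 0 ≤ r) (hη : 0 ≤ η)
    (h : Metric.closedBall z r ⊆ ⋃ i ∈ I, Metric.closedBall (p i) η) :
    r ^ d ≤ I.card * η ^ d := by
  have h1 : volume (Metric.closedBall z r) ≤ ∑ i ∈ I, volume (Metric.closedBall (p i) η) :=
    (measure_mono h).trans (measure_biUnion_finset_le I _)
  simp only [Measure.addHaar_closedBall _ _ hr, Measure.addHaar_closedBall _ _ hη,
    finrank_euclideanSpace_fin, Finset.sum_const, nsmul_eq_mul] at h1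
  rw [← mul_assoc, ENNReal.mul_le_mul_iff_left (Metric.measure_ball_pos _ _ one_pos).ne'
    measure_ball_lt_top.ne, ← ENNReal.ofReal_natCast, ← ENNReal.ofReal_mul (by positivity),
    ENNReal.ofReal_le_ofReal_iff (by positivity)] at h1
  exact h1

theorem exists_norm_sub_le_fillDist {n : ℕ} [NeZero n] (hX : IsCompact X) {pts : Fin n → Vec d}
    (hpts : ∀ i, pts i ∈ X) {y : Vec d} (hy : y ∈ X) : ∃ i, ‖y - pts i‖ ≤ fillDist X pts := by
  obtain ⟨D, hD, hXD⟩ := hX.isBounded.exists_pos_norm_le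
  obtain ⟨i, hi⟩ := exists_eq_ciInf_of_finite (f := fun i => ‖y - pts i‖)
  refine ⟨i, ?_⟩
  have hbdd : BddAbove (Set.range fun x : X => ⨅ i, ‖(x : Vec d) - pts i‖) := by
    refine ⟨2 * D, ?_⟩
    rintro _ ⟨x, rfl⟩
    refine (ciInf_le (Set.finite_range _).bddBelow i).trans ((norm_sub_le _ _).trans ?_)
    linarith [hXD x x.2, hXD _ (hpts i)]
  rw [hi]
  exact le_ciSup hbdd (⟨y, hy⟩ : X)

/-- The number of design points in a ball around a covariate is at least of the order `n h^d`. -/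
theorem IsQuasiUniform.exists_le_card_neighbors (hd : 1 ≤ d) {n : ℕ → ℕ}
    {pts : ∀ k, Fin (n k) → Vec d} (hq : IsQuasiUniform X n pts) (hc : IsCompact X)
    (hconv : Convex ℝ X) (hi : (interior X).Nonempty) {h : ℕ → ℝ} (hn : ∀ k, 0 < n k)
    (hh : ∀ k, 0 < h k) (hlim : Tendsto h atTop (𝓝 0))
    (hcov : Tendsto (fun k => ((n k : ℝ) * h k ^ d)⁻¹) atTop (𝓝 0)) :
    ∃ c : ℝ, 0 < c ∧ ∀ᶠ k in atTop, ∀ x ∈ X,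
      c * (n k * h k ^ d) ≤ (neighbors (pts k) (h k) x).card := by
  obtain ⟨b, hb, hball⟩ := exists_closedBall_subset_inter hc hconv hi
  obtain ⟨C, hC, hfill⟩ := hq.fill.1.exists_pos
  refine ⟨(b / C) ^ d, by positivity, ?_⟩
  filter_upwards [hfill.bound, hlim.eventually_le_const one_pos,
    hcov.eventually_le_const (show 0 < (1 / (2 * C)) ^ d by positivity)] with k h1 h2 h3 x hx
  have hnk : (0 : ℝ) < n k := by exact_mod_cast hn k
  have hhk := hh k
  have : NeZero (n k) := ⟨(hn k).ne'⟩
  set η := C * (n k : ℝ) ^ (-(1 / (d : ℝ))) with hη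
  have hη0 : 0 < η := by positivity
  have hηd : η ^ d = C ^ d / n k := by
    rw [hη, mul_pow, ← Real.rpow_natCast ((n k : ℝ) ^ _), ← Real.rpow_mul hnk.le]
    have : -(1 / (d : ℝ)) * d = -1 := by
      have : (d : ℝ) ≠ 0 := by positivity
      field_simp
    rw [this, Real.rpow_neg_one, div_eq_mul_inv]
  -- Coverage makes `n h^d ≥ (2 C)^d` eventually, so the fill radius is at most half the bandwidth.
  have hηh : η ≤ h k / 2 := by
    refine le_of_pow_le_pow_left₀ (by omega : d ≠ 0) (by positivity) ?_
    rw [hηd, div_le_iff₀ hnk]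
    rw [inv_le_iff_one_le_mul₀ (by positivity)] at h3
    calc C ^ d = C ^ d * 1 := (mul_one _).symm
      _ ≤ C ^ d * ((1 / (2 * C)) ^ d * (n k * h k ^ d)) := by gcongr
      _ = (C * (1 / (2 * C)) * h k) ^ d * n k := by rw [mul_pow, mul_pow]; ring
      _ = (h k / 2) ^ d * n k := by
        congr 2
        field_simp
  have hnear : ∀ y ∈ X, ∃ i, ‖y - pts k i‖ ≤ η := fun y hy => by
    obtain ⟨i, hi⟩ := exists_norm_sub_le_fillDist hc (hq.mem k) hy
    refine ⟨i, hi.trans ((Real.le_norm_self _).trans (h1.trans ?_))⟩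
    rw [Real.norm_of_nonneg (by positivity)]
  obtain ⟨z, hz⟩ := hball x hx (h k) hhk h2
  -- A point of the inscribed ball is within `h / 2` of `x` and within `η ≤ h / 2` of a design
  -- point, which is then a neighbor. Comparing volumes gives at least `(b h / η)^d = (b / C)^d n
  -- h^d` neighbors.
  have hcover : Metric.closedBall z (b * h k) ⊆
      ⋃ i ∈ neighbors (pts k) (h k) x, Metric.closedBall (pts k i) η := fun y hy => by
    obtain ⟨hyX, hyx⟩ := hz hy
    obtain ⟨i, hi⟩ := hnear y hyX
    rw [Metric.mem_closedBall, dist_eq_norm, norm_sub_rev] at hyx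
    simp only [Set.mem_iUnion, mem_neighbors, Metric.mem_closedBall, dist_eq_norm]
    refine ⟨i, ?_, hi⟩
    have e : x - pts k i = (x - y) + (y - pts k i) := by abel
    rw [e]
    exact (norm_add_le _ _).trans (by linarith)
  have h4 := pow_le_card_mul_pow_of_cover (by positivity) hη0.le hcover
  rw [hηd, mul_pow] at h4
  have h5 : (b / C) ^ d * (n k * h k ^ d) = b ^ d * h k ^ d / (C ^ d / n k) := by
    rw [div_pow]
    field_simp
  rw [h5, div_le_iff₀ (by positivity)]
  exact h4

end DesignCount

/-! ### Absorbing logarithms in the soft-O -/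

section SoftO

/-- With `a = e⁻ᵘ` this is the decrease of `e⁻ᵘ u⁴` for `u ≥ 4`, which lets a single summand of the
error order be compared with the whole. The exponent 4 is that of `log T` in the squared bias `((log
T)² / T)²`. -/
theorem mul_abs_log_pow_four_mono {a b : ℝ} (ha : 0 < a) (hab : a ≤ b) (hb : b ≤ Real.exp (-4)) :
    a * |Real.log a| ^ 4 ≤ b * |Real.log b| ^ 4 := by
  have hb0 : 0 < b := ha.trans_le hab
  have hw : Real.log b ≤ -4 := by simpa using Real.log_le_log hb0 hb
  have hu : Real.log a ≤ Real.log b := Real.log_le_log ha hab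
  rw [abs_of_neg (by linarith), abs_of_neg (by linarith)]
  obtain ⟨w, hw'⟩ : ∃ w, w = -Real.log b := ⟨_, rfl⟩
  obtain ⟨u, hu'⟩ : ∃ u, u = -Real.log a := ⟨_, rfl⟩
  have h1 : b = Real.exp (-w) := by rw [hw', neg_neg, Real.exp_log hb0]
  have h2 : a = Real.exp (-u) := by rw [hu', neg_neg, Real.exp_log ha]
  rw [← hw', ← hu', h1, h2]
  have hw4 : 4 ≤ w := by linarith
  have huw : w ≤ u := by linarith
  have h3 : u ≤ w * Real.exp ((u - w) / 4) := by
    have h4 := Real.add_one_le_exp ((u - w) / 4)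
    have h5 : w * ((u - w) / 4 + 1) ≤ w * Real.exp ((u - w) / 4) := by gcongr
    nlinarith
  have h6 : u ^ 4 ≤ w ^ 4 * Real.exp (u - w) := by
    refine (pow_le_pow_left₀ (by linarith) h3 4).trans_eq ?_
    rw [mul_pow, ← Real.exp_nat_mul]
    congr 2
    push_cast
    ring
  calc Real.exp (-u) * u ^ 4 ≤ Real.exp (-u) * (w ^ 4 * Real.exp (u - w)) := by gcongr
    _ = Real.exp (-u) * Real.exp (u - w) * w ^ 4 := by ring
    _ = Real.exp (-w) * w ^ 4 := by
      rw [← Real.exp_add]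
      congr 2
      ring

theorem mul_abs_log_pow_four_le_mul {b C : ℝ} (hb : 0 < b) (hC : 1 ≤ C)
    (hCb : C * b ≤ 1) : C * b * |Real.log (C * b)| ^ 4 ≤ C * (b * |Real.log b| ^ 4) := by
  have h0 : 0 < C * b := by positivity
  have h1 : b ≤ C * b := le_mul_of_one_le_left hb.le hC
  have h2 : Real.log b ≤ Real.log (C * b) := Real.log_le_log hb h1
  have h3 : Real.log (C * b) ≤ 0 := Real.log_nonpos h0.le hCb
  have h4 : |Real.log (C * b)| ≤ |Real.log b| := by
    rw [abs_of_nonpos h3, abs_of_nonpos (h2.trans h3)]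
    linarith
  rw [mul_assoc]
  exact mul_le_mul_of_nonneg_left (mul_le_mul_of_nonneg_left
    (pow_le_pow_left₀ (abs_nonneg _) h4 4) hb.le) (by linarith)

theorem tendsto_mul_abs_log_pow_four {a : ℕ → ℝ} (ha : ∀ k, 0 < a k)
    (hlim : Tendsto a atTop (𝓝 0)) :
    Tendsto (fun k => a k * |Real.log (a k)| ^ 4) atTop (𝓝 0) := by
  have h1 : Tendsto a atTop (𝓝[>] 0) := tendsto_nhdsWithin_iff.2 ⟨hlim, Eventually.of_forall ha⟩
  have h2 := (((tendsto_log_mul_rpow_nhdsGT_zero (show (0 : ℝ) < 1 / 4 by norm_num)).comp h1).pow 4)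
  rw [zero_pow (by norm_num)] at h2
  refine h2.congr fun k => ?_
  simp only [Function.comp]
  rw [mul_pow, ← Real.rpow_natCast (a k ^ (1 / 4 : ℝ)), ← Real.rpow_mul (ha k).le,
    Even.pow_abs (by decide)]
  norm_num
  ring

theorem isSoftO_of_le {u a : ℕ → ℝ} {A : ℝ} (hu : ∀ k, 0 ≤ u k) (ha : ∀ k, 0 ≤ a k)
    (h : ∀ᶠ k in atTop, u k ≤ A * (a k * |Real.log (a k)| ^ 4)) : IsSoftO u a := by
  refine ⟨4, by norm_num, IsBigO.of_bound A (h.mono fun k hk => ?_)⟩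
  have e : |Real.log (a k)| ^ (4 : ℝ) = |Real.log (a k)| ^ 4 := by
    exact_mod_cast Real.rpow_natCast |Real.log (a k)| 4
  rw [e, Real.norm_of_nonneg (hu k), Real.norm_of_nonneg (mul_nonneg (ha k) (by positivity))]
  exact hk

variable {d : ℕ}

theorem mseOrder_pos {Γ n T h : ℕ → ℝ} (hf : IsFeasibleRule d Γ n T h) (k : ℕ) :
    0 < mseOrder d n T h k := by
  have h1 := hf.pos_n k
  have h2 := hf.pos_T k
  have h3 := hf.pos_h k
  unfold mseOrder
  positivity

theorem tendsto_mseOrder {Γ n T h : ℕ → ℝ} (hf : IsFeasibleRule d Γ n T h)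
    (hT : Tendsto T atTop atTop) : Tendsto (mseOrder d n T h) atTop (𝓝 0) := by
  have h1 : Tendsto (fun k => (T k)⁻¹) atTop (𝓝 0) := tendsto_inv_atTop_zero.comp hT
  have h2 := ((hf.bandwidth.pow 2).add (h1.pow 2)).add (hf.coverage.mul h1)
  simp only [ne_eq, OfNat.ofNat_ne_zero, not_false_eq_true, zero_pow, mul_zero, add_zero] at h2
  refine h2.congr fun k => ?_
  unfold mseOrder
  rw [one_div, one_div, inv_pow, ← mul_inv]
  congr 2
  ring

/-- The logarithmic factors in `T` are absorbed by the soft-O of the order of the error. -/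
theorem eventually_log_le_softO {Γ n T h : ℕ → ℝ} (hf : IsFeasibleRule d Γ n T h)
    (hT : Tendsto T atTop atTop) : ∀ᶠ k in atTop,
      Real.log (T k) ^ 2 / T k / (n k * h k ^ d) ≤
        mseOrder d n T h k * |Real.log (mseOrder d n T h k)| ^ 4 ∧
      (Real.log (T k) ^ 2 / T k) ^ 2 ≤
        mseOrder d n T h k * |Real.log (mseOrder d n T h k)| ^ 4 ∧
      h k ^ 2 ≤ mseOrder d n T h k * |Real.log (mseOrder d n T h k)| ^ 4 := by
  filter_upwards [(tendsto_mseOrder hf hT).eventually_le_const (Real.exp_pos (-4)),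
    hT.eventually_ge_atTop (Real.exp 1), hf.coverage.eventually_le_const one_pos] with k h1 h2 h3
  have pn := hf.pos_n k
  have pT := hf.pos_T k
  have ph := hf.pos_h k
  have pR := mseOrder_pos hf k
  have hlog : 1 ≤ Real.log (T k) := (Real.le_log_iff_exp_le pT).2 h2
  have hR : mseOrder d n T h k = h k ^ 2 + 1 / T k ^ 2 + 1 / (n k * T k * h k ^ d) := rfl
  have p1 : 0 < h k ^ 2 := by positivity
  have p2 : 0 < 1 / T k ^ 2 := by positivity
  have p3 : 0 < 1 / (n k * T k * h k ^ d) := by positivity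
  have hlogR : Real.log (mseOrder d n T h k) ≤ -4 := by simpa using Real.log_le_log pR h1
  refine ⟨?_, ?_, ?_⟩
  · refine le_trans ?_ (mul_abs_log_pow_four_mono p3 (by linarith) h1)
    -- Eventually `n h^d ≥ 1`, so `log T` is bounded by the logarithm of the inverse of the third
    -- summand.
    have h4 : T k ≤ n k * T k * h k ^ d := by
      rw [inv_le_one_iff₀] at h3
      rcases h3 with h3 | h3
      · exact absurd h3 (not_le.2 (by positivity))
      · nlinarith
    have h5 : Real.log (T k) ≤ |Real.log (1 / (n k * T k * h k ^ d))| := by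
      rw [one_div, Real.log_inv, abs_neg]
      exact (Real.log_le_log pT h4).trans (le_abs_self _)
    have h6 : Real.log (T k) ^ 2 ≤ |Real.log (1 / (n k * T k * h k ^ d))| ^ 4 :=
      (pow_le_pow_right₀ hlog (by norm_num)).trans (pow_le_pow_left₀ (by linarith) h5 4)
    calc Real.log (T k) ^ 2 / T k / (n k * h k ^ d)
        = 1 / (n k * T k * h k ^ d) * Real.log (T k) ^ 2 := by field_simp
      _ ≤ _ := by gcongr
  · refine le_trans ?_ (mul_abs_log_pow_four_mono p2 (by linarith) h1)
    have h5 : Real.log (T k) ≤ |Real.log (1 / T k ^ 2)| := by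
      rw [one_div, Real.log_inv, abs_neg, Real.log_pow]
      refine le_trans ?_ (le_abs_self _)
      push_cast
      linarith
    calc (Real.log (T k) ^ 2 / T k) ^ 2 = 1 / T k ^ 2 * Real.log (T k) ^ 4 := by ring
      _ ≤ _ := by gcongr
  · refine le_trans (b := mseOrder d n T h k) (by linarith) (le_mul_of_one_le_right pR.le ?_)
    refine one_le_pow₀ ?_
    rw [abs_of_neg (by linarith)]
    linarith

end SoftO

/-! ### Bias and variance of averages of independent errors -/

section Average

variable {Ω : Type*} [MeasurableSpace Ω] {P : Measure Ω} [IsProbabilityMeasure P]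

/-- Bias–variance bound for an average of independent errors plus a deterministic error. -/
theorem integral_sq_average_le {ι : Type*} {I : Finset ι} (hI : I.Nonempty) {U : ι → Ω → ℝ}
    (hU : ∀ i ∈ I, MemLp (U i) 2 P)
    (hind : (I : Set ι).Pairwise fun i j => IndepFun (U i) (U j) P) {v β b : ℝ}
    (h1 : ∀ i ∈ I, ∫ ω, U i ω ^ 2 ∂P ≤ v) (h2 : ∀ i ∈ I, |∫ ω, U i ω ∂P| ≤ v) (hβ : |β| ≤ b) :
    ∫ ω, ((I.card : ℝ)⁻¹ * ∑ i ∈ I, U i ω + β) ^ 2 ∂P ≤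
      2 * (v / I.card + v ^ 2) + 2 * b ^ 2 := by
  have hN : (0 : ℝ) < I.card := by exact_mod_cast hI.card_pos
  set Z : Ω → ℝ := fun ω => (I.card : ℝ)⁻¹ * (∑ i ∈ I, U i) ω with hZ
  have hsum : MemLp (∑ i ∈ I, U i) 2 P := memLp_finsetSum' I hU
  have hZL : MemLp Z 2 P := hsum.const_mul _
  have hvar : Var[Z; P] ≤ v / I.card := by
    rw [hZ, variance_const_mul, IndepFun.variance_sum hU hind]
    have h3 : ∑ i ∈ I, Var[U i; P] ≤ I.card * v := by
      rw [← nsmul_eq_mul, ← Finset.sum_const]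
      exact Finset.sum_le_sum fun i hi =>
        (variance_le_expectation_sq (hU i hi).1).trans (h1 i hi)
    calc (I.card : ℝ)⁻¹ ^ 2 * ∑ i ∈ I, Var[U i; P] ≤ (I.card : ℝ)⁻¹ ^ 2 * (I.card * v) := by gcongr
      _ = v / I.card := by field_simp
  have hmean : |∫ ω, Z ω ∂P| ≤ v := by
    have e : ∫ ω, Z ω ∂P = (I.card : ℝ)⁻¹ * ∑ i ∈ I, ∫ ω, U i ω ∂P := by
      simp only [hZ, Finset.sum_apply]
      rw [integral_const_mul, integral_finsetSum _ fun i hi => (hU i hi).integrable one_le_two]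
    rw [e, abs_mul, abs_of_pos (inv_pos.2 hN), inv_mul_le_iff₀ hN]
    refine (Finset.abs_sum_le_sum_abs _ _).trans ?_
    rw [← nsmul_eq_mul, ← Finset.sum_const]
    exact Finset.sum_le_sum h2
  have hZ2 : ∫ ω, Z ω ^ 2 ∂P ≤ v / I.card + v ^ 2 := by
    have h3 := variance_eq_sub hZL
    simp only [Pi.pow_apply] at h3
    have h4 : (∫ ω, Z ω ∂P) ^ 2 ≤ v ^ 2 := by
      rw [← sq_abs]
      exact pow_le_pow_left₀ (abs_nonneg _) hmean 2
    linarith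
  have hi : Integrable (fun ω => Z ω ^ 2) P := hZL.integrable_sq
  have hβ2 : β ^ 2 ≤ b ^ 2 := by
    rw [← sq_abs]
    exact pow_le_pow_left₀ (abs_nonneg _) hβ 2
  calc ∫ ω, ((I.card : ℝ)⁻¹ * ∑ i ∈ I, U i ω + β) ^ 2 ∂P
      ≤ ∫ ω, (2 * b ^ 2 + 2 * Z ω ^ 2) ∂P := by
        refine integral_mono_of_nonneg (ae_of_all _ fun ω => by positivity)
          ((integrable_const _).add (hi.const_mul 2)) (ae_of_all _ fun ω => ?_)
        simp only [hZ, Finset.sum_apply]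
        nlinarith [sq_nonneg ((I.card : ℝ)⁻¹ * ∑ i ∈ I, U i ω - β)]
    _ = 2 * b ^ 2 + 2 * ∫ ω, Z ω ^ 2 ∂P := integral_const_add_two_mul hi _
    _ ≤ _ := by linarith

end Average

/-! ### The predictor as a local average -/

section Prediction

variable {d q : ℕ} {S : Type*} {Θ : Set (Vec q)} {X : Set (Vec d)}
  {gradF : Vec q → Vec d → S → Vec q} {γ : ℕ → ℝ} {θ₀ : Vec d → Vec q} {n : ℕ}
  {pts : Fin n → Vec d} {h : ℝ} {x : Vec d}

theorem predict_mem (hc : IsCompact Θ) (hconv : Convex ℝ Θ) (h0 : ∀ i, θ₀ (pts i) ∈ Θ)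
    (hh : 0 < h) (hN : (neighbors pts h x).Nonempty) (T : ℕ) (ζ : Fin n → ℕ → S) :
    predict Θ gradF γ θ₀ T h pts ζ x ∈ Θ := by
  rw [predict, nadarayaWatson_eq hh, Finset.smul_sum]
  refine hconv.sum_mem (fun _ _ => by positivity) ?_ fun i _ => prSGD_mem hc hconv (h0 i) _ T
  rw [Finset.sum_const, nsmul_eq_mul]
  exact mul_inv_cancel₀ (by exact_mod_cast hN.card_pos.ne')

/-- With `s i` the solution at the `i`-th design point, the first average is the error of the runs
and the second one is the deterministic smoothing error. -/
theorem predict_sub_apply (hh : 0 < h) (hN : (neighbors pts h x).Nonempty) (T : ℕ)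
    (ζ : Fin n → ℕ → S) (c : Vec q) (s : Fin n → Vec q) (j : Fin q) :
    predict Θ gradF γ θ₀ T h pts ζ x j - c j =
      ((neighbors pts h x).card : ℝ)⁻¹ *
        ∑ i ∈ neighbors pts h x, (prSGD Θ gradF γ θ₀ (pts i) (ζ i) T j - s i j) +
      ((neighbors pts h x).card : ℝ)⁻¹ * ∑ i ∈ neighbors pts h x, (s i j - c j) := by
  have hN' : ((neighbors pts h x).card : ℝ) ≠ 0 := by exact_mod_cast hN.card_pos.ne'
  rw [predict, nadarayaWatson_eq hh, ← mul_add, ← Finset.sum_add_distrib]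
  simp only [sub_add_sub_cancel, Finset.sum_sub_distrib, Finset.sum_const, nsmul_eq_mul, mul_sub,
    inv_mul_cancel_left₀ hN', PiLp.smul_apply, smul_eq_mul, WithLp.ofLp_sum, Finset.sum_apply]

variable [MeasurableSpace S]

theorem measurable_predict (hc : IsCompact Θ) (hne : Θ.Nonempty) (hconv : Convex ℝ Θ)
    (hg : ∀ i, Measurable fun p : Vec q × S => gradF p.1 (pts i) p.2) (hh : 0 < h) (T : ℕ) :
    Measurable fun ζ : Fin n → ℕ → S => predict Θ gradF γ θ₀ T h pts ζ x := by
  simp only [predict, nadarayaWatson_eq hh]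
  exact Measurable.const_smul (Finset.measurable_fun_sum _ fun i _ =>
    (measurable_prSGD hc hne hconv (hg i) T).comp (measurable_pi_apply i))
    (((neighbors pts h x).card : ℝ)⁻¹)

end Prediction

/-! ### Mean squared error of the prediction -/

section MeanSquaredError

theorem IsOfflineStage.measurable_path {d q : ℕ} {S Ω : Type*} [MeasurableSpace S]
    [MeasurableSpace Ω] {P : Measure Ω} {Θ : Set (Vec q)} {X : Set (Vec d)}
    {f : Vec q → Vec d → ℝ} {gradF : Vec q → Vec d → S → Vec q} {γ : ℕ → ℝ}
    {θ₀ : Vec d → Vec q} {K₂ : ℝ} {n : ℕ → ℕ} {pts : ∀ k, Fin (n k) → Vec d}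
    {ζ : ∀ k, Fin (n k) → ℕ → Ω → S}
    (hO : IsOfflineStage P Θ X f gradF γ θ₀ K₂ n pts ζ) (k : ℕ) (i : Fin (n k)) :
    Measurable fun ω t => ζ k i t ω := by
  obtain ⟨ℱ, hℱ⟩ := hO.runs k i
  exact measurable_pi_iff.2 fun t => (hℱ t).1.mono (ℱ.le _) le_rfl

variable {d q : ℕ} {S : Type*} [MeasurableSpace S] {Ω : Type*} [mΩ : MeasurableSpace Ω]
  {P : Measure Ω} [IsProbabilityMeasure P] {Θ : Set (Vec q)} {X : Set (Vec d)}
  {f : Vec q → Vec d → ℝ} {gradF : Vec q → Vec d → S → Vec q} {γ : ℕ → ℝ} {θ₀ : Vec d → Vec q}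
  {K₂ : ℝ} {μ L K ρ B : ℝ} {n T : ℕ → ℕ} {h : ℕ → ℝ} {pts : ∀ k, Fin (n k) → Vec d}
  {ζ : ∀ k, Fin (n k) → ℕ → Ω → S} {x : Vec d}

/-- Nonasymptotic bound of the mean squared error of a component of the predicted solution. -/
theorem integral_sq_predict_sub_le (hp : IsRegularProblem Θ X f)
    (hu : UniformRegularity Θ X f μ L K ρ B) (hθ₀ : ∀ x ∈ X, θ₀ x ∈ Θ)
    (hg : ∀ x ∈ X, Measurable fun p : Vec q × S => gradF p.1 x p.2)
    (hO : IsOfflineStage P Θ X f gradF γ θ₀ K₂ n pts ζ) (hx : x ∈ X) {k : ℕ} (hh : 0 < h k)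
    (hN : (neighbors (pts k) (h k) x).Nonempty) {v : ℝ}
    (h1 : ∀ i, ∫ ω, ‖prSGD Θ gradF γ θ₀ (pts k i) (fun s => ζ k i s ω) (T k) -
      optSol Θ f (pts k i)‖ ^ 2 ∂P ≤ v)
    (h2 : ∀ i, ‖∫ ω, (prSGD Θ gradF γ θ₀ (pts k i) (fun s => ζ k i s ω) (T k) -
      optSol Θ f (pts k i)) ∂P‖ ≤ v) (j : Fin q) :
    ∫ ω, (predict Θ gradF γ θ₀ (T k) (h k) (pts k) (fun i t => ζ k i t ω) x j -
        optSol Θ f x j) ^ 2 ∂P ≤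
      2 * (v / (neighbors (pts k) (h k) x).card + v ^ 2) + 2 * (L / μ * h k) ^ 2 := by
  have hN' : (0 : ℝ) < (neighbors (pts k) (h k) x).card := by exact_mod_cast hN.card_pos
  have hX := hO.design.mem k
  set V : Fin (n k) → Ω → Vec q := fun i ω =>
    prSGD Θ gradF γ θ₀ (pts k i) (fun s => ζ k i s ω) (T k) - optSol Θ f (pts k i) with hV
  have hVm : ∀ i, Measurable (V i) := fun i =>
    ((measurable_prSGD hp.compact_feasible hp.nonempty hp.convex_feasible (hg _ (hX i)) (T k)).comp
      (hO.measurable_path k i)).sub_const _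
  have hVb : ∀ i ω, ‖V i ω‖ ≤ 2 * B := fun i ω => norm_sub_optSol_le hp hu (hX i)
    (prSGD_mem hp.compact_feasible hp.convex_feasible (hθ₀ _ (hX i)) _ _)
  have hVi : ∀ i, Integrable (V i) P := fun i =>
    Integrable.of_bound (hVm i).aestronglyMeasurable (2 * B) (ae_of_all _ (hVb i))
  have hVsq : ∀ i, Integrable (fun ω => ‖V i ω‖ ^ 2) P := fun i =>
    (MemLp.of_bound (hVm i).aestronglyMeasurable (2 * B)
      (ae_of_all _ (hVb i))).integrable_norm_pow two_ne_zero
  have happ : Measurable fun w : Vec q => w j :=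
    (EuclideanSpace.proj j : Vec q →L[ℝ] ℝ).continuous.measurable
  simp only [predict_sub_apply hh hN (T k) _ (optSol Θ f x) (fun i => optSol Θ f (pts k i)) j]
  refine integral_sq_average_le (U := fun i ω => V i ω j) hN (fun i _ => ?_) (fun i _ i' _ hii => ?_)
    (fun i _ => ?_) (fun i _ => ?_) ?_
  · refine MemLp.of_bound (happ.comp (hVm i)).aestronglyMeasurable (2 * B) (ae_of_all _ fun ω => ?_)
    exact (PiLp.norm_apply_le (V i ω) j).trans (hVb i ω)
  · have hm : ∀ i, Measurable fun p : ℕ → S =>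
        (prSGD Θ gradF γ θ₀ (pts k i) p (T k) - optSol Θ f (pts k i)) j := fun i =>
      happ.comp ((measurable_prSGD hp.compact_feasible hp.nonempty hp.convex_feasible
        (hg _ (hX i)) (T k)).sub_const _)
    exact ((hO.indep k).comp _ hm).indepFun hii
  · refine le_trans (integral_mono_of_nonneg (ae_of_all _ fun ω => sq_nonneg _) (hVsq i)
      (ae_of_all _ fun ω => ?_)) (h1 i)
    have := pow_le_pow_left₀ (norm_nonneg _) (PiLp.norm_apply_le (V i ω) j) 2
    rwa [Real.norm_eq_abs, sq_abs] at this
  · have e : ∫ ω, V i ω j ∂P = (∫ ω, V i ω ∂P) j :=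
      (EuclideanSpace.proj j : Vec q →L[ℝ] ℝ).integral_comp_comm (hVi i)
    rw [e]
    exact (PiLp.norm_apply_le (∫ ω, V i ω ∂P) j).trans (h2 i)
  · rw [abs_mul, abs_of_pos (inv_pos.2 hN'), inv_mul_le_iff₀ hN']
    refine (Finset.abs_sum_le_sum_abs _ _).trans ?_
    rw [← nsmul_eq_mul, ← Finset.sum_const]
    refine Finset.sum_le_sum fun i hi => ?_
    have h3 := PiLp.norm_apply_le (optSol Θ f (pts k i) - optSol Θ f x) j
    have h4 := hu.norm_optSol_sub_le x hx (pts k i) (hX i)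
    rw [norm_sub_rev (pts k i)] at h4
    have h5 := mem_neighbors.1 hi
    have := hu.lip_pos
    have := hu.mu_pos
    exact h3.trans (h4.trans (by gcongr))

/-- The mean squared error of every component of the predicted solution. -/
theorem exists_mse_le (hd : 1 ≤ d) (hp : IsRegularProblem Θ X f) (hγ : IsStepSize γ)
    (hθ₀ : ∀ x ∈ X, θ₀ x ∈ Θ) (hg : ∀ x ∈ X, Measurable fun p : Vec q × S => gradF p.1 x p.2)
    (hO : IsOfflineStage P Θ X f gradF γ θ₀ K₂ n pts ζ) (hx : x ∈ X) {Γ : ℕ → ℝ}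
    (hf : IsFeasibleRule d Γ (fun k => (n k : ℝ)) (fun k => (T k : ℝ)) h)
    (hT : Tendsto T atTop atTop) :
    ∃ A : ℝ, 0 ≤ A ∧ ∀ᶠ k in atTop, (neighbors (pts k) (h k) x).Nonempty ∧ ∀ j,
      ∫ ω, (predict Θ gradF γ θ₀ (T k) (h k) (pts k) (fun i t => ζ k i t ω) x j -
        optSol Θ f x j) ^ 2 ∂P ≤
      A * (mseOrder d (fun k => (n k : ℝ)) (fun k => (T k : ℝ)) h k *
        |Real.log (mseOrder d (fun k => (n k : ℝ)) (fun k => (T k : ℝ)) h k)| ^ 4) := by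
  obtain ⟨μ, L, K, ρ, B, hu⟩ := hp.exists_uniformRegularity
  obtain ⟨M, hM, T₀, hrun⟩ := exists_prSGD_bounds (P := P) (gradF := gradF) hp hu hγ hθ₀ hg K₂
  obtain ⟨c, hc, hcard⟩ := hO.design.exists_le_card_neighbors hd hp.compact_covariates
    hp.convex_covariates hp.covariates_interior (fun k => by exact_mod_cast hf.pos_n k) hf.pos_h
    hf.bandwidth hf.coverage
  have hTr : Tendsto (fun k => (T k : ℝ)) atTop atTop := tendsto_natCast_atTop_atTop.comp hT
  -- The summands come from the variance divided by at least `c n h^d` neighbors, the squared bias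
  -- of the runs, and the squared Lipschitz smoothing error.
  refine ⟨2 * (M / c + M ^ 2) + 2 * (L / μ) ^ 2, by positivity, ?_⟩
  filter_upwards [hcard, hT.eventually_ge_atTop T₀, eventually_log_le_softO hf hTr]
    with k k1 k2 ⟨k3, k4, k5⟩
  have pn := hf.pos_n k
  have pT := hf.pos_T k
  have ph := hf.pos_h k
  have hcN := k1 x hx
  have hN0 : (0 : ℝ) < (neighbors (pts k) (h k) x).card := lt_of_lt_of_le (by positivity) hcN
  have hN : (neighbors (pts k) (h k) x).Nonempty := Finset.card_pos.1 (by exact_mod_cast hN0)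
  refine ⟨hN, fun j => ?_⟩
  set R := mseOrder d (fun k => (n k : ℝ)) (fun k => (T k : ℝ)) h k *
        |Real.log (mseOrder d (fun k => (n k : ℝ)) (fun k => (T k : ℝ)) h k)| ^ 4
  refine (integral_sq_predict_sub_le hp hu hθ₀ hg hO hx ph hN
    (fun i => (hrun _ (hO.design.mem k i) _ (hO.runs k i) _ k2).1)
    (fun i => (hrun _ (hO.design.mem k i) _ (hO.runs k i) _ k2).2) j).trans ?_
  have h1 : M * Real.log (T k) ^ 2 / T k / (neighbors (pts k) (h k) x).card ≤ M / c * R := by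
    calc M * Real.log (T k) ^ 2 / T k / (neighbors (pts k) (h k) x).card
        ≤ M * Real.log (T k) ^ 2 / T k / (c * (n k * h k ^ d)) := by gcongr
      _ = M / c * (Real.log (T k) ^ 2 / T k / (n k * h k ^ d)) := by field_simp
      _ ≤ M / c * R := by gcongr
  have h2 : (M * Real.log (T k) ^ 2 / T k) ^ 2 ≤ M ^ 2 * R := by
    calc (M * Real.log (T k) ^ 2 / T k) ^ 2 = M ^ 2 * (Real.log (T k) ^ 2 / T k) ^ 2 := by ring
      _ ≤ _ := by gcongr
  have h3 : (L / μ * h k) ^ 2 ≤ (L / μ) ^ 2 * R := by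
    rw [mul_pow]
    gcongr
  linarith

end MeanSquaredError

/-! ### Optimality gap -/

section OptimalityGap

variable {d q : ℕ} {S : Type*} [MeasurableSpace S] {Ω : Type*} [mΩ : MeasurableSpace Ω]
  {P : Measure Ω} [IsProbabilityMeasure P] {Θ : Set (Vec q)} {X : Set (Vec d)}
  {f : Vec q → Vec d → ℝ} {gradF : Vec q → Vec d → S → Vec q} {γ : ℕ → ℝ} {θ₀ : Vec d → Vec q}
  {K₂ : ℝ} {n T : ℕ → ℕ} {h : ℕ → ℝ} {pts : ∀ k, Fin (n k) → Vec d}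
  {ζ : ∀ k, Fin (n k) → ℕ → Ω → S} {x : Vec d}

/-- Tail bound of the optimality gap from the mean squared error of the components. -/
theorem exists_gap_tail_le (hd : 1 ≤ d) (hp : IsRegularProblem Θ X f) (hγ : IsStepSize γ)
    (hθ₀ : ∀ x ∈ X, θ₀ x ∈ Θ) (hg : ∀ x ∈ X, Measurable fun p : Vec q × S => gradF p.1 x p.2)
    (hO : IsOfflineStage P Θ X f gradF γ θ₀ K₂ n pts ζ) (hx : x ∈ X) {Γ : ℕ → ℝ}
    (hf : IsFeasibleRule d Γ (fun k => (n k : ℝ)) (fun k => (T k : ℝ)) h)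
    (hT : Tendsto T atTop atTop) :
    ∃ A : ℝ, 0 ≤ A ∧ ∀ᶠ k in atTop, ∀ ε : ℝ, 0 < ε →
      P.real {ω | ε ≤ |f (predict Θ gradF γ θ₀ (T k) (h k) (pts k) (fun i t => ζ k i t ω) x) x -
        f (optSol Θ f x) x|} ≤
      A * (mseOrder d (fun k => (n k : ℝ)) (fun k => (T k : ℝ)) h k *
        |Real.log (mseOrder d (fun k => (n k : ℝ)) (fun k => (T k : ℝ)) h k)| ^ 4) / ε := by
  obtain ⟨μ, L, K, ρ, B, hu⟩ := hp.exists_uniformRegularity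
  obtain ⟨A, hA, hmse⟩ := exists_mse_le hd hp hγ hθ₀ hg hO hx hf hT
  have hL := hu.lip_pos
  refine ⟨L * (q * A), by positivity, hmse.mono fun k ⟨hN, hk⟩ ε hε => ?_⟩
  set V : Ω → Vec q := fun ω =>
    predict Θ gradF γ θ₀ (T k) (h k) (pts k) (fun i t => ζ k i t ω) x - optSol Θ f x with hV
  set R := mseOrder d (fun k => (n k : ℝ)) (fun k => (T k : ℝ)) h k *
        |Real.log (mseOrder d (fun k => (n k : ℝ)) (fun k => (T k : ℝ)) h k)| ^ 4
  have hmem : ∀ ω, predict Θ gradF γ θ₀ (T k) (h k) (pts k) (fun i t => ζ k i t ω) x ∈ Θ :=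
    fun ω => predict_mem hp.compact_feasible hp.convex_feasible
      (fun i => hθ₀ _ (hO.design.mem k i)) (hf.pos_h k) hN _ _
  have hVm : Measurable V :=
    ((measurable_predict hp.compact_feasible hp.nonempty hp.convex_feasible
      (fun i => hg _ (hO.design.mem k i)) (hf.pos_h k) (T k)).comp
        (measurable_pi_iff.2 fun i => hO.measurable_path k i)).sub_const _
  have hVb : ∀ ω, ‖V ω‖ ≤ 2 * B := fun ω => norm_sub_optSol_le hp hu hx (hmem ω)
  have hVL : MemLp V 2 P := MemLp.of_bound hVm.aestronglyMeasurable (2 * B) (ae_of_all _ hVb)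
  have hVi : Integrable (fun ω => L * ‖V ω‖ ^ 2) P :=
    (hVL.integrable_norm_pow two_ne_zero).const_mul L
  have happ : ∀ j, Measurable fun w : Vec q => w j := fun j =>
    (EuclideanSpace.proj j : Vec q →L[ℝ] ℝ).continuous.measurable
  have hVj : ∀ j, Integrable (fun ω => V ω j ^ 2) P := fun j =>
    (MemLp.of_bound ((happ j).comp hVm).aestronglyMeasurable (2 * B) (ae_of_all _ fun ω =>
      (PiLp.norm_apply_le (V ω) j).trans (hVb ω))).integrable_sq
  have hint : ∫ ω, L * ‖V ω‖ ^ 2 ∂P ≤ L * (q * A) * R := by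
    simp only [EuclideanSpace.real_norm_sq_eq]
    rw [integral_const_mul, integral_finsetSum _ fun j _ => hVj j, mul_assoc L]
    refine mul_le_mul_of_nonneg_left ((Finset.sum_le_sum fun j _ => hk j).trans_eq ?_) hL.le
    rw [Finset.sum_const, Finset.card_univ, Fintype.card_fin, nsmul_eq_mul, mul_assoc]
  have hmarkov := mul_meas_ge_le_integral_of_nonneg
    (ae_of_all P fun ω => (by positivity : 0 ≤ L * ‖V ω‖ ^ 2)) hVi ε
  rw [le_div_iff₀ hε, mul_comm]
  refine le_trans ?_ (hmarkov.trans hint)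
  refine mul_le_mul_of_nonneg_left (measureReal_mono fun ω hω => ?_) hε.le
  rw [Set.mem_ofPred_eq, abs_of_nonneg (hp.gap_nonneg hx (hmem ω))] at hω
  exact le_trans hω (hp.gap_le hu hx (hmem ω))

theorem tendstoInMeasure_gap (hd : 1 ≤ d) (hp : IsRegularProblem Θ X f) (hγ : IsStepSize γ)
    (hθ₀ : ∀ x ∈ X, θ₀ x ∈ Θ) (hg : ∀ x ∈ X, Measurable fun p : Vec q × S => gradF p.1 x p.2)
    (hO : IsOfflineStage P Θ X f gradF γ θ₀ K₂ n pts ζ) (hx : x ∈ X) {Γ : ℕ → ℝ}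
    (hf : IsFeasibleRule d Γ (fun k => (n k : ℝ)) (fun k => (T k : ℝ)) h)
    (hT : Tendsto T atTop atTop) :
    TendstoInMeasure P (fun k ω =>
      f (predict Θ gradF γ θ₀ (T k) (h k) (pts k) (fun i t => ζ k i t ω) x) x -
        f (optSol Θ f x) x) atTop fun _ => 0 := by
  obtain ⟨A, hA, htail⟩ := exists_gap_tail_le hd hp hγ hθ₀ hg hO hx hf hT
  rw [tendstoInMeasure_iff_measureReal_norm]
  intro ε hε
  simp only [sub_zero, Real.norm_eq_abs]
  have h0 := ((tendsto_mul_abs_log_pow_four (mseOrder_pos hf) (tendsto_mseOrder hf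
    (tendsto_natCast_atTop_atTop.comp hT))).const_mul A).div_const ε
  rw [mul_zero, zero_div] at h0
  exact squeeze_zero' (Eventually.of_forall fun k => measureReal_nonneg)
    (htail.mono fun k hk => hk ε hε) h0

theorem isSoftOP_gap (hd : 1 ≤ d) (hp : IsRegularProblem Θ X f) (hγ : IsStepSize γ)
    (hθ₀ : ∀ x ∈ X, θ₀ x ∈ Θ) (hg : ∀ x ∈ X, Measurable fun p : Vec q × S => gradF p.1 x p.2)
    (hO : IsOfflineStage P Θ X f gradF γ θ₀ K₂ n pts ζ) (hx : x ∈ X) {Γ : ℕ → ℝ}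
    (hf : IsFeasibleRule d Γ (fun k => (n k : ℝ)) (fun k => (T k : ℝ)) h)
    (hT : Tendsto T atTop atTop) {b : ℕ → ℝ} (hb : ∀ k, 0 < b k) (hblim : Tendsto b atTop (𝓝 0))
    (hR : mseOrder d (fun k => (n k : ℝ)) (fun k => (T k : ℝ)) h =O[atTop] b) :
    IsSoftOP P (fun k ω =>
      f (predict Θ gradF γ θ₀ (T k) (h k) (pts k) (fun i t => ζ k i t ω) x) x -
        f (optSol Θ f x) x) fun k => (q : ℝ) * b k := by
  refine ⟨4, by norm_num, fun δ hδ => ?_⟩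
  have e4 : ∀ y : ℝ, |y| ^ (4 : ℝ) = |y| ^ 4 := fun y => by
    exact_mod_cast Real.rpow_natCast |y| 4
  simp only [e4]
  -- For `q = 0` the target rate is 0, but `Θ` lies in a one-point space and the gap vanishes
  -- identically.
  rcases Nat.eq_zero_or_pos q with hq | hq
  · subst hq
    refine ⟨1, one_pos, Eventually.of_forall fun k => ?_⟩
    have : ∀ ω, predict Θ gradF γ θ₀ (T k) (h k) (pts k) (fun i t => ζ k i t ω) x
      = optSol Θ f x := fun ω => Subsingleton.elim _ _
    simpa [this] using hδ
  obtain ⟨A, hA, htail⟩ := exists_gap_tail_le hd hp hγ hθ₀ hg hO hx hf hT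
  obtain ⟨C, hC⟩ := hR.bound
  have hC1 : (1 : ℝ) ≤ max 1 C := le_max_left _ _
  have hq1 : (1 : ℝ) ≤ q := by exact_mod_cast hq
  have hCb : Tendsto (fun k => max 1 C * b k) atTop (𝓝 0) := by
    simpa using hblim.const_mul (max 1 C)
  have hqb : Tendsto (fun k => q * b k) atTop (𝓝 0) := by
    simpa using hblim.const_mul (q : ℝ)
  have he1 : Real.exp (-4) ≤ 1 := Real.exp_le_one_iff.2 (by norm_num)
  -- After the rate cancels in Markov's bound, `A C / M < δ` must hold with `C` replaced by `max 1
  -- C`; the summand 1 makes the inequality strict and `M` positive.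
  refine ⟨A * max 1 C / δ + 1, by positivity, ?_⟩
  filter_upwards [htail, hC, hCb.eventually_le_const (Real.exp_pos (-4)),
    hqb.eventually_le_const (Real.exp_pos (-4))] with k k1 k2 k3 k4
  have hbk := hb k
  have hRk := mseOrder_pos hf k
  have hqbk : 0 < q * b k := by positivity
  set a := (q * b k) * |Real.log (q * b k)| ^ 4 with ha
  have hapos : 0 < a := by
    have : Real.log (q * b k) ≤ -4 := by simpa using Real.log_le_log hqbk k4
    have : 0 < |Real.log (q * b k)| := abs_pos_of_neg (by linarith)
    positivity
  have hle : mseOrder d (fun k => (n k : ℝ)) (fun k => (T k : ℝ)) h k ≤ max 1 C * b k := by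
    rw [Real.norm_of_nonneg hRk.le, Real.norm_of_nonneg hbk.le] at k2
    exact k2.trans (mul_le_mul_of_nonneg_right (le_max_right _ _) hbk.le)
  -- The three comparisons pass from the error order to `C b`, from `C b` to `b` at the price of the
  -- factor `C`, and from `b` to `q b`.
  have h1 := mul_abs_log_pow_four_mono hRk hle k3
  have h2 := mul_abs_log_pow_four_le_mul hbk hC1 (k3.trans he1)
  have h3 := mul_abs_log_pow_four_mono hbk (le_mul_of_one_le_left hbk.le hq1) k4
  have hM : 0 < A * max 1 C / δ + 1 := by positivity
  have hMa : 0 < (A * max 1 C / δ + 1) * a := by positivity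
  calc P.real {ω | (A * max 1 C / δ + 1) * a <
        |f (predict Θ gradF γ θ₀ (T k) (h k) (pts k) (fun i t => ζ k i t ω) x) x -
          f (optSol Θ f x) x|}
      ≤ P.real {ω | (A * max 1 C / δ + 1) * a ≤
        |f (predict Θ gradF γ θ₀ (T k) (h k) (pts k) (fun i t => ζ k i t ω) x) x -
          f (optSol Θ f x) x|} := measureReal_mono fun ω hω => by
        rw [Set.mem_ofPred_eq] at hω ⊢
        exact hω.le
    _ ≤ A * (max 1 C * a) / ((A * max 1 C / δ + 1) * a) := by
        refine (k1 _ hMa).trans ?_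
        exact div_le_div_of_nonneg_right (mul_le_mul_of_nonneg_left (h1.trans (h2.trans
          (mul_le_mul_of_nonneg_left h3 (by positivity)))) hA) hMa.le
    _ = A * max 1 C / (A * max 1 C / δ + 1) := by
        rw [← mul_assoc, mul_div_mul_right _ _ hapos.ne']
    _ < δ := by
        rw [div_lt_iff₀ hM, mul_add, mul_div_cancel₀ _ hδ.ne']
        linarith

end OptimalityGap

end OTP

end

/-! ### Assembly of the three statements -/

theorem theorem2 {d q : ℕ} (hd : 1 ≤ d)
    {S : Type*} [MeasurableSpace S] (ν : Measure S) [IsProbabilityMeasure ν]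
    {Ω : Type*} [MeasurableSpace Ω] (P : Measure Ω) [IsProbabilityMeasure P]
    (Θ : Set (OTP.Vec q)) (X : Set (OTP.Vec d))
    (F : OTP.Vec q → OTP.Vec d → S → ℝ) (gradF : OTP.Vec q → OTP.Vec d → S → OTP.Vec q)
    (γ : ℕ → ℝ) (θ₀ : OTP.Vec d → OTP.Vec q) (K₂ : ℝ)
    (hF : ∀ θ ∈ Θ, ∀ x ∈ X, Integrable (F θ x) ν)
    (hgradF : ∀ x ∈ X, Measurable fun p : OTP.Vec q × S => gradF p.1 x p.2)
    (hprob : OTP.IsRegularProblem Θ X (OTP.objective ν F))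
    (hγ : OTP.IsStepSize γ) (hθ₀ : ∀ x ∈ X, θ₀ x ∈ Θ) :
    -- the optimal rules and the optimal order
    (∀ Γ : ℕ → ℝ, (∀ k, 0 < Γ k) → Tendsto Γ atTop atTop →
      (∃ n T h : ℕ → ℝ, OTP.IsOptimalRule d Γ n T h) ∧
      ∀ n T h : ℕ → ℝ, (∀ k, 0 < n k) → (∀ k, 0 < T k) → (∀ k, 0 < h k) →
        (∀ k, n k * T k = Γ k) →
        ((OTP.IsOptimalRule d Γ n T h ↔
          h =Θ[atTop] (fun k => Γ k ^ (-(1 / ((d : ℝ) + 2)))) ∧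
          (fun k => Γ k ^ (1 / ((d : ℝ) + 2))) =O[atTop] T ∧
          T =o[atTop] (fun k => Γ k ^ (2 / ((d : ℝ) + 2)))) ∧
        (OTP.IsOptimalRule d Γ n T h →
          (fun k => Γ k ^ ((d : ℝ) / ((d : ℝ) + 2))) =o[atTop] n ∧
          n =O[atTop] (fun k => Γ k ^ (((d : ℝ) + 1) / ((d : ℝ) + 2))) ∧
          OTP.mseOrder d n T h =Θ[atTop] fun k => Γ k ^ (-(2 / ((d : ℝ) + 2)))))) ∧
    -- the mean squared error and the optimality gap of the algorithm
    (∀ (Γ : ℕ → ℝ) (n T : ℕ → ℕ) (h : ℕ → ℝ) (pts : ∀ k, Fin (n k) → OTP.Vec d)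
      (ζ : ∀ k, Fin (n k) → ℕ → Ω → S) (x : OTP.Vec d),
      Tendsto Γ atTop atTop → x ∈ X →
      OTP.IsOfflineStage P Θ X (OTP.objective ν F) gradF γ θ₀ K₂ n pts ζ →
      (OTP.IsFeasibleRule d Γ (fun k => (n k : ℝ)) (fun k => (T k : ℝ)) h →
        Tendsto T atTop atTop → ∀ j : Fin q,
          OTP.IsSoftO
            (fun k => ∫ ω, (OTP.predict Θ gradF γ θ₀ (T k) (h k) (pts k)
                (fun i t => ζ k i t ω) x j - OTP.optSol Θ (OTP.objective ν F) x j) ^ 2 ∂P)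
            (OTP.mseOrder d (fun k => (n k : ℝ)) (fun k => (T k : ℝ)) h)) ∧
      (OTP.IsOptimalRule d Γ (fun k => (n k : ℝ)) (fun k => (T k : ℝ)) h →
        TendstoInMeasure P
          (fun k ω =>
            OTP.objective ν F (OTP.predict Θ gradF γ θ₀ (T k) (h k) (pts k)
              (fun i t => ζ k i t ω) x) x -
            OTP.objective ν F (OTP.optSol Θ (OTP.objective ν F) x) x)
          atTop (fun _ => 0) ∧
        OTP.IsSoftOP P
          (fun k ω =>
            OTP.objective ν F (OTP.predict Θ gradF γ θ₀ (T k) (h k) (pts k)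
              (fun i t => ζ k i t ω) x) x -
            OTP.objective ν F (OTP.optSol Θ (OTP.objective ν F) x) x)
          (fun k => (q : ℝ) * Γ k ^ (-(2 / ((d : ℝ) + 2)))))) := by
  refine ⟨fun Γ hpos hlim => OTP.optimalRules hd hpos hlim,
    fun Γ n T h pts ζ x hΓ hx hO => ⟨fun hf hT j => ?_, fun ho => ?_⟩⟩
  · obtain ⟨A, -, hA⟩ := OTP.exists_mse_le hd hprob hγ hθ₀ hgradF hO hx hf hT
    exact OTP.isSoftO_of_le (fun k => integral_nonneg fun ω => sq_nonneg _)
      (fun k => (OTP.mseOrder_pos hf k).le) (hA.mono fun k hk => hk.2 j)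
  · have hf := ho.1
    have hpos : ∀ k, 0 < Γ k := fun k => hf.budget k ▸ mul_pos (hf.pos_n k) (hf.pos_T k)
    obtain ⟨hiff, horder⟩ := (OTP.optimalRules hd hpos hΓ).2 _ _ h hf.pos_n hf.pos_T hf.pos_h
      hf.budget
    obtain ⟨C, hC, hCT⟩ := (hiff.1 ho).2.1.exists_pos
    -- Optimality forces `T` to be at least of order `Γ^(1/(d+2))`, so the divergence of `T` need
    -- not be assumed here.
    have hT : Tendsto T atTop atTop := by
      rw [← tendsto_natCast_atTop_iff (R := ℝ)]
      have h1 : Tendsto (fun k => C⁻¹ * Γ k ^ (1 / ((d : ℝ) + 2))) atTop atTop :=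
        ((tendsto_rpow_atTop (by positivity)).comp hΓ).const_mul_atTop (inv_pos.2 hC)
      refine tendsto_atTop_mono' _ (hCT.bound.mono fun k hk => ?_) h1
      rw [Real.norm_of_nonneg (Real.rpow_nonneg (hpos k).le _),
        Real.norm_of_nonneg (hf.pos_T k).le] at hk
      rwa [inv_mul_le_iff₀ hC]
    exact ⟨OTP.tendstoInMeasure_gap hd hprob hγ hθ₀ hgradF hO hx hf hT,
      OTP.isSoftOP_gap hd hprob hγ hθ₀ hgradF hO hx hf hT
        (fun k => Real.rpow_pos_of_pos (hpos k) _)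
        ((tendsto_rpow_neg_atTop (by positivity)).comp hΓ) (horder ho).2.2.1⟩
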